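/- Let $M$ be a compact smooth manifold of dimension $n$, let $k\in\mathbb N$ with $k>n/2$, and let "of class $H^m$" mean that all weak derivatives of order at most $m$ exist in smooth charts and are locally square integrable. Let $\pi:E\to M$ be a real $H^k$ vector bundle of rank $q$, i.e. it carries a bundle atlas of linear trivializations $D_j$ over chart domains $U_j$ of $M$ whose transition functions are of class $H^k$. Let $\gamma$ be a bundle scalar product of class $H^k$ on $\pi$ and $\nabla$ a connection on $\pi$ which is metric for $\gamma$ and whose Christoffel symbols in the bundle charts are of class $H^{k-1}$ (so that $(\pi,\gamma,\nabla)$ is a metric $H^k$ vector bundle with connection). For $s\le k$, an operator $P$ from sections of a bundle $\pi_1$ to sections of a bundle $\pi_2$ (both trivialized over the $U_j$) is called $k$-safe of order $s$ if over every $U_j$ it has the form $$P=\sum_{r=0}^{s}\ \sum_{1\le i_1\le\dots\le i_r\le n}A_{i_1,\dots,i_r}\,\partial_{i_1}\cdots\partial_{i_r}$$ (on sections of class $H^s$, almost everywhere) with matrix-valued functions $A_{i_1,\dots,i_r}$ on $U_j$ of class $H^{a}$, $a=\max\{k-s,\ r-s+\lfloor n/2\rfloor+1\}$. (1) The connection $\nabla:\Gamma(\pi)\to\Gamma(T^*M\otimes\pi)$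 is a $k$-safe operator of order $1$. (2) Assume moreover $k-1>n/2$, let $h$ be a scalar product of class $H^{k-1}$ on $TM$, and let $D$ be a connection on $TM$ which is metric for $h$ and which either is torsion-free (i.e. is the Levi-Civita connection of $h$) or has Christoffel symbols of class $H^{k-2}$ in the charts. Then $D$ and $\nabla$ induce, by the product rule $(\tilde\nabla_Xw)(Y)=\nabla_X(w(Y))-w(D_XY)$, a connection $\tilde\nabla$ on sections of class $H^1$ of $T^*M\otimes\pi=\mathrm{Hom}(TM,\pi)$ (determined up to null sets), and the Bochner Laplacian $\Delta^\pi=\mathrm{tr}_h(\tilde\nabla\circ\nabla)$ on $\pi$ is a $k$-safe operator of order $2$. -/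

import Mathlib

open MeasureTheory Set Filter Topology
open scoped Manifold ContDiff

/-! ## Local Sobolev spaces on open subsets of Euclidean space -/

/-- `g` is the weak `i`-th partial derivative of `f` on the open set `Ω ⊆ ℝⁿ`. -/
structure IsWeakDeriv {n : ℕ} (i : Fin n) (Ω : Set (EuclideanSpace ℝ (Fin n)))
    (f g : EuclideanSpace ℝ (Fin n) → ℝ) : Prop where
  locallyIntegrableOn_left : LocallyIntegrableOn f Ω volume
  locallyIntegrableOn_right : LocallyIntegrableOn g Ω volume
  integral_eq : ∀ ψ : EuclideanSpace ℝ (Fin n) → ℝ, ContDiff ℝ ∞ ψ → HasCompactSupport ψ →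
    tsupport ψ ⊆ Ω →
    ∫ y, f y * fderiv ℝ ψ y (EuclideanSpace.single i 1) = - ∫ y, g y * ψ y

/-- `f` is locally square integrable on `Ω`. -/
def MemL2loc {n : ℕ} (Ω : Set (EuclideanSpace ℝ (Fin n)))
    (f : EuclideanSpace ℝ (Fin n) → ℝ) : Prop :=
  ∀ K : Set (EuclideanSpace ℝ (Fin n)), IsCompact K → K ⊆ Ω → MemLp f 2 (volume.restrict K)

/-- `f` is of class `Hᵐ` (locally) on the open set `Ω`: all weak derivatives of order at most `m`
exist and are locally square integrable on `Ω`. -/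
def MemHloc {n : ℕ} : ℕ → Set (EuclideanSpace ℝ (Fin n)) → (EuclideanSpace ℝ (Fin n) → ℝ) → Prop
  | 0, Ω, f => MemL2loc Ω f
  | m + 1, Ω, f => MemL2loc Ω f ∧ ∀ i : Fin n, ∃ g, IsWeakDeriv i Ω f g ∧ MemHloc m Ω g

open Classical in
/-- The weak `i`-th partial derivative of `f` on `Ω` (well defined up to null sets of `Ω`; by
convention `0` if `f` has no weak derivative). -/
noncomputable def weakDeriv {n : ℕ} (i : Fin n) (Ω : Set (EuclideanSpace ℝ (Fin n)))
    (f : EuclideanSpace ℝ (Fin n) → ℝ) : EuclideanSpace ℝ (Fin n) → ℝ :=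
  if h : ∃ g, IsWeakDeriv i Ω f g then h.choose else 0

/-- The iterated weak derivative `∂_{i₁} ⋯ ∂_{i_r} f` on `Ω` for a tuple `(i₁, …, i_r)`. -/
noncomputable def iterWeakDeriv {n r : ℕ} (I : Fin r → Fin n)
    (Ω : Set (EuclideanSpace ℝ (Fin n))) (f : EuclideanSpace ℝ (Fin n) → ℝ) :
    EuclideanSpace ℝ (Fin n) → ℝ :=
  (List.ofFn I).foldr (fun i g => weakDeriv i Ω g) f

/-! ## Sobolev functions and bundles over a smooth manifold -/

section Manifold

variable {n : ℕ} {M : Type*} [TopologicalSpace M] [ChartedSpace (EuclideanSpace ℝ (Fin n)) M]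

/-- `f` is of class `Hᵐ` on the open set `U ⊆ M`: it is so in every smooth chart. -/
def MemHlocOn (n : ℕ) {M : Type*} [TopologicalSpace M] [ChartedSpace (EuclideanSpace ℝ (Fin n)) M]
    (m : ℕ) (U : Set M) (f : M → ℝ) : Prop :=
  ∀ φ ∈ IsManifold.maximalAtlas (𝓡 n) ∞ M,
    MemHloc m (φ.target ∩ φ.symm ⁻¹' U) (fun y => f (φ.symm y))

/-- A family of smooth charts of `M` whose domains `U_j` cover `M`. -/
structure BaseCharts (n : ℕ) (ι : Type*) (M : Type*) [TopologicalSpace M]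
    [ChartedSpace (EuclideanSpace ℝ (Fin n)) M] where
  chart : ι → OpenPartialHomeomorph M (EuclideanSpace ℝ (Fin n))
  mem_maximalAtlas : ∀ j, chart j ∈ IsManifold.maximalAtlas (𝓡 n) ∞ M
  cover : ∀ x, ∃ j, x ∈ (chart j).source

variable {ι : Type*}

/-- The property `p` holds almost everywhere on `M` (null sets are taken in the charts). -/
def BaseCharts.AE (C : BaseCharts n ι M) (p : M → Prop) : Prop :=
  ∀ j, ∀ᵐ y ∂(volume.restrict (C.chart j).target), p ((C.chart j).symm y)

/-- Linear trivializations `D_j` of the family of vector spaces `V x` (`x ∈ M`) over the chart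
domains `U_j`, with typical fibre `κ → ℝ`. Only the values at points of `U_j` matter:
`coord j x = D_j|_{V x}` and `frame j x` is its inverse. Without a regularity assumption on the
transition functions there is no topology on the total space. -/
structure BundleCharts (C : BaseCharts n ι M) (κ : Type) (V : M → Type*)
    [∀ x, AddCommGroup (V x)] [∀ x, Module ℝ (V x)] where
  coord : ι → ∀ x, V x →ₗ[ℝ] (κ → ℝ)
  frame : ι → ∀ x, (κ → ℝ) →ₗ[ℝ] V x
  frame_coord : ∀ j, ∀ x ∈ (C.chart j).source, ∀ v, frame j x (coord j x v) = v
  coord_frame : ∀ j, ∀ x ∈ (C.chart j).source, ∀ v, coord j x (frame j x v) = v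

section Bundle

variable {C : BaseCharts n ι M} {κ : Type} {V : M → Type*}
  [∀ x, AddCommGroup (V x)] [∀ x, Module ℝ (V x)]

/-- The element `e_a` of the local frame given by the trivialization `D_j`. -/
def BundleCharts.basisSection [DecidableEq κ] (B : BundleCharts C κ V) (j : ι) (a : κ) (x : M) :
    V x :=
  B.frame j x (Pi.single a 1)

/-- The trivializations form an `Hᵏ` bundle atlas: all entries of all transition functions
`D_i ∘ D_j⁻¹` are of class `Hᵏ` on `U_i ∩ U_j`. -/
def BundleCharts.IsSobolev [DecidableEq κ] (B : BundleCharts C κ V) (k : ℕ) : Prop :=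
  ∀ i j a b, MemHlocOn n k ((C.chart i).source ∩ (C.chart j).source)
    (fun x => B.coord i x (B.basisSection j a x) b)

/-- The section `u` is of class `Hᵐ`: its components in all bundle charts are. -/
def BundleCharts.MemH (B : BundleCharts C κ V) (m : ℕ) (u : ∀ x, V x) : Prop :=
  ∀ j a, MemHlocOn n m (C.chart j).source (fun x => B.coord j x (u x) a)

/-- The expression of the section `u` in the `j`-th bundle chart, a function of `y ∈ φ_j(U_j)`. -/
def BundleCharts.localRep (B : BundleCharts C κ V) (j : ι) (u : ∀ x, V x)
    (y : EuclideanSpace ℝ (Fin n)) : κ → ℝ :=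
  B.coord j ((C.chart j).symm y) (u ((C.chart j).symm y))

/-- A scalar product of class `Hᵐ` on a bundle. Since functions of class `Hᵐ` matter only up to
null sets, positivity is also required in the form which survives a change on null sets: local
uniform positivity almost everywhere. For `m > n / 2` it says that the continuous representative
is positive definite. -/
structure SobolevMetric [Fintype κ] [DecidableEq κ] (B : BundleCharts C κ V) (m : ℕ) where
  inner : ∀ x, V x →ₗ[ℝ] V x →ₗ[ℝ] ℝ
  symm : ∀ x v w, inner x v w = inner x w v
  pos : ∀ x v, v ≠ 0 → 0 < inner x v v
  regular : ∀ j a b, MemHlocOn n m (C.chart j).source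
    (fun x => inner x (B.basisSection j a x) (B.basisSection j b x))
  locally_uniformly_pos : ∀ j, ∀ K ⊆ (C.chart j).target, IsCompact K → ∃ c : ℝ, 0 < c ∧
    ∀ᵐ y ∂(volume.restrict K), ∀ v : κ → ℝ,
      c * ∑ a, v a ^ 2 ≤ inner ((C.chart j).symm y) (B.frame j ((C.chart j).symm y) v)
        (B.frame j ((C.chart j).symm y) v)

end Bundle

/-! ## The tangent bundle and `T*M ⊗ V = Hom(TM, V)` -/

theorem BaseCharts.mdifferentiable (C : BaseCharts n ι M) (j : ι) :
    (C.chart j).MDifferentiable (𝓡 n) (𝓡 n) :=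
  ⟨(contMDiffOn_of_mem_maximalAtlas (C.mem_maximalAtlas j)).mdifferentiableOn (by simp),
    (contMDiffOn_symm_of_mem_maximalAtlas (C.mem_maximalAtlas j)).mdifferentiableOn (by simp)⟩

variable [IsManifold (𝓡 n) ∞ M]

/-- The standard bundle charts of `TM`: the differentials of the charts of `M`. -/
noncomputable def BaseCharts.tangent (C : BaseCharts n ι M) :
    BundleCharts C (Fin n) (fun x : M => TangentSpace (𝓡 n) x) where
  coord j x := (EuclideanSpace.equiv (Fin n) ℝ).toLinearEquiv.toLinearMap ∘ₗ
    (mfderiv (𝓡 n) (𝓡 n) (C.chart j) x).toLinearMap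
  frame j x := (mfderiv (𝓡 n) (𝓡 n) (C.chart j).symm (C.chart j x)).toLinearMap ∘ₗ
    (EuclideanSpace.equiv (Fin n) ℝ).symm.toLinearEquiv.toLinearMap
  frame_coord := by
    intro j x hx v
    have : IsManifold (𝓡 n) 1 M := IsManifold.of_le (n := ∞) (by simp)
    have h := DFunLike.congr_fun ((C.mdifferentiable j).symm_comp_deriv hx) v
    exact h
  coord_frame := by
    intro j x hx v
    have : IsManifold (𝓡 n) 1 M := IsManifold.of_le (n := ∞) (by simp)
    have h := DFunLike.congr_fun ((C.mdifferentiable j).comp_symm_deriv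
      ((C.chart j).map_source hx)) ((EuclideanSpace.equiv (Fin n) ℝ).symm v)
    rw [(C.chart j).left_inv hx] at h
    have h2 := congrArg (EuclideanSpace.equiv (Fin n) ℝ) h
    exact h2.trans ((EuclideanSpace.equiv (Fin n) ℝ).apply_symm_apply v)

/-- The coordinate vector field `∂_i` of the `j`-th chart. -/
noncomputable def BaseCharts.partialVec (C : BaseCharts n ι M) (j : ι) (i : Fin n) (x : M) :
    TangentSpace (𝓡 n) x :=
  C.tangent.basisSection j i x

section Hom

variable {C : BaseCharts n ι M} {κ : Type} {V : M → Type*}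
  [∀ x, AddCommGroup (V x)] [∀ x, Module ℝ (V x)]

/-- The bundle charts of `T*M ⊗ V = Hom(TM, V)` induced by those of `TM` and `V`: the
`(i, a)`-component of `w` is the `a`-th component of `w(∂_i)`. -/
noncomputable def BundleCharts.hom (B : BundleCharts C κ V) :
    BundleCharts C (Fin n × κ) (fun x : M => TangentSpace (𝓡 n) x →ₗ[ℝ] V x) where
  coord j x :=
    { toFun := fun w p => B.coord j x (w (C.partialVec j p.1 x)) p.2
      map_add' := fun w w' => by ext p; simp
      map_smul' := fun c w => by ext p; simp }
  frame j x :=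
    { toFun := fun c => B.frame j x ∘ₗ
        ∑ i, (LinearMap.proj i ∘ₗ C.tangent.coord j x).smulRight (fun a => c (i, a))
      map_add' := fun c c' => by
        ext X
        simp only [LinearMap.comp_apply, LinearMap.sum_apply, LinearMap.smulRight_apply,
          LinearMap.add_apply, ← map_add, ← Finset.sum_add_distrib, ← smul_add]
        rfl
      map_smul' := fun r c => by
        ext X
        simp only [LinearMap.comp_apply, LinearMap.sum_apply, LinearMap.smulRight_apply,
          LinearMap.smul_apply, RingHom.id_apply, ← map_smul, Finset.smul_sum, smul_comm r]
        rfl }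
  frame_coord := by
    intro j x hx w
    ext X
    have h1 : ∑ i, C.tangent.coord j x X i • C.partialVec j i x = X := by
      have h := C.tangent.frame_coord j x hx X
      rw [pi_eq_sum_univ' (C.tangent.coord j x X), map_sum] at h
      simp only [map_smul] at h
      exact h
    have h2 : ∀ i, (fun a => B.coord j x (w (C.partialVec j i x)) a) =
        B.coord j x (w (C.partialVec j i x)) := fun _ => rfl
    conv_rhs => rw [← h1, map_sum]
    simp only [map_smul, LinearMap.coe_mk, AddHom.coe_mk, LinearMap.comp_apply,
      LinearMap.sum_apply, LinearMap.smulRight_apply, LinearMap.proj_apply, map_sum, h2,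
      B.frame_coord j x hx]
  coord_frame := by
    intro j x hx c
    ext ⟨i, a⟩
    have h1 : C.tangent.coord j x (C.partialVec j i x) = Pi.single i 1 :=
      C.tangent.coord_frame j x hx _
    simp [h1, B.coord_frame j x hx, Pi.single_apply]

/-! ## Connections -/

/-- A connection on a bundle with bundle charts: an additive operator from sections to sections of
`T*M ⊗ V`, defined (up to null sets) on sections of class `H¹`, which satisfies the Leibniz rule
`∇(f u) = df ⊗ u + f ∇u`. Here `conn u x X` is `∇_X u` at `x`. The values of `toFun` on sections
that are not of class `H¹` are irrelevant. -/
structure SobolevConnection (B : BundleCharts C κ V) where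
  toFun : (∀ x, V x) → ∀ x : M, TangentSpace (𝓡 n) x →ₗ[ℝ] V x
  add : ∀ u v, B.MemH 1 u → B.MemH 1 v →
    C.AE (fun x => toFun (fun z => u z + v z) x = toFun u x + toFun v x)
  leibniz : ∀ (f : M → ℝ) u, MemHlocOn n 1 univ f → B.MemH 1 u → B.MemH 1 (fun x => f x • u x) →
    ∀ j i g, IsWeakDeriv i (C.chart j).target (fun y => f ((C.chart j).symm y)) g →
    ∀ᵐ y ∂(volume.restrict (C.chart j).target),
      toFun (fun x => f x • u x) ((C.chart j).symm y) (C.partialVec j i ((C.chart j).symm y)) =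
        g y • u ((C.chart j).symm y) + f ((C.chart j).symm y) •
          toFun u ((C.chart j).symm y) (C.partialVec j i ((C.chart j).symm y))

/-- `Γ i a b` (functions on `φ_j(U_j)`) are the Christoffel symbols of the connection in the
`j`-th bundle chart: `∇_{∂_i} e_a = ∑ b, Γ i a b • e_b`. As `e_a` is only defined on `U_j`, this
is expressed by all sections that agree with `e_a` on some open subset of `U_j`. -/
def SobolevConnection.IsChristoffel [DecidableEq κ] {B : BundleCharts C κ V}
    (conn : SobolevConnection B) (j : ι)
    (Γ : Fin n → κ → κ → EuclideanSpace ℝ (Fin n) → ℝ) : Prop :=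
  ∀ (a : κ) (U : Set M), IsOpen U → U ⊆ (C.chart j).source → ∀ u, B.MemH 1 u →
    (∀ x ∈ U, u x = B.basisSection j a x) →
    ∀ i b, ∀ᵐ y ∂(volume.restrict ((C.chart j).target ∩ (C.chart j).symm ⁻¹' U)),
      B.coord j ((C.chart j).symm y)
        (conn.toFun u ((C.chart j).symm y) (C.partialVec j i ((C.chart j).symm y))) b = Γ i a b y

/-- The Christoffel symbols of the connection in the bundle charts are of class `Hᵐ`. -/
def SobolevConnection.ChristoffelRegular [DecidableEq κ] {B : BundleCharts C κ V}
    (conn : SobolevConnection B) (m : ℕ) : Prop :=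
  ∀ j, ∃ Γ : Fin n → κ → κ → EuclideanSpace ℝ (Fin n) → ℝ,
    conn.IsChristoffel j Γ ∧ ∀ i a b, MemHloc m (C.chart j).target (Γ i a b)

/-- The connection is metric: `∂_i ⟨u, v⟩ = ⟨∇_i u, v⟩ + ⟨u, ∇_i v⟩` for `u, v` of class `Hᵐ`. -/
def SobolevConnection.IsMetric [Fintype κ] [DecidableEq κ] {B : BundleCharts C κ V} {m : ℕ}
    (conn : SobolevConnection B) (g : SobolevMetric B m) : Prop :=
  ∀ u v, B.MemH m u → B.MemH m v → ∀ j i,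
    IsWeakDeriv i (C.chart j).target
      (fun y => g.inner ((C.chart j).symm y) (u ((C.chart j).symm y)) (v ((C.chart j).symm y)))
      (fun y =>
        g.inner ((C.chart j).symm y)
          (conn.toFun u ((C.chart j).symm y) (C.partialVec j i ((C.chart j).symm y)))
          (v ((C.chart j).symm y)) +
        g.inner ((C.chart j).symm y) (u ((C.chart j).symm y))
          (conn.toFun v ((C.chart j).symm y) (C.partialVec j i ((C.chart j).symm y))))

end Hom

/-- `Y` is a smooth vector field on `M`. -/
def IsSmoothVectorField (n : ℕ) {M : Type*} [TopologicalSpace M]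
    [ChartedSpace (EuclideanSpace ℝ (Fin n)) M] [IsManifold (𝓡 n) ∞ M]
    (Y : ∀ x : M, TangentSpace (𝓡 n) x) : Prop :=
  ContMDiff (𝓡 n) (𝓡 n).tangent ∞ (fun x => (⟨x, Y x⟩ : TangentBundle (𝓡 n) M))

/-- The connection on `TM` is torsion-free: `D_X Y - D_Y X = [X, Y]`. -/
def SobolevConnection.IsTorsionFree {C : BaseCharts n ι M}
    (D : SobolevConnection C.tangent) : Prop :=
  ∀ X Y, IsSmoothVectorField n X → IsSmoothVectorField n Y →
    C.AE (fun x => D.toFun Y x (X x) - D.toFun X x (Y x) =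
      VectorField.mlieBracket (𝓡 n) X Y x)

section Laplace

variable {C : BaseCharts n ι M} {κ : Type} {V : M → Type*}
  [∀ x, AddCommGroup (V x)] [∀ x, Module ℝ (V x)]

/-- `conn'` is the connection on `T*M ⊗ V = Hom(TM, V)` induced by a connection `D` on `TM` and a
connection `conn` on `V`: `(∇'_X w)(Y) = ∇_X (w(Y)) - w(D_X Y)` for sections `w` of class `H¹` and
smooth vector fields `Y`. This determines `∇'w` up to null sets. -/
def IsInducedConnection {B : BundleCharts C κ V}
    (conn : SobolevConnection B) (D : SobolevConnection C.tangent)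
    (conn' : (∀ x : M, TangentSpace (𝓡 n) x →ₗ[ℝ] V x) →
      ∀ x : M, TangentSpace (𝓡 n) x →ₗ[ℝ] TangentSpace (𝓡 n) x →ₗ[ℝ] V x) : Prop :=
  ∀ w, B.hom.MemH 1 w → ∀ Y, IsSmoothVectorField n Y →
    C.AE (fun x => ∀ X : TangentSpace (𝓡 n) x,
      conn' w x X (Y x) = conn.toFun (fun z => w z (Y z)) x X - w x (D.toFun Y x X))

/-- The trace `∑ i j, h^{ij} W(b_i, b_j)` of a vector-valued bilinear form `W` with respect to a
scalar product `h`, computed in a basis `b` (its choice is irrelevant). -/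
noncomputable def metricTrace {T F : Type*} [AddCommGroup T] [Module ℝ T] [Module.Finite ℝ T]
    [AddCommGroup F] [Module ℝ F] (h : T →ₗ[ℝ] T →ₗ[ℝ] ℝ) (W : T →ₗ[ℝ] T →ₗ[ℝ] F) : F :=
  ∑ i, ∑ j, ((Matrix.of fun i j => h (Module.finBasis ℝ T i) (Module.finBasis ℝ T j))⁻¹ i j) •
    W (Module.finBasis ℝ T i) (Module.finBasis ℝ T j)

/-- The Bochner Laplacian `tr_h (∇' ∘ ∇)`. -/
noncomputable def bochnerLaplacian {B : BundleCharts C κ V} {m : ℕ}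
    (h : SobolevMetric C.tangent m) (conn : SobolevConnection B)
    (conn' : (∀ x : M, TangentSpace (𝓡 n) x →ₗ[ℝ] V x) →
      ∀ x : M, TangentSpace (𝓡 n) x →ₗ[ℝ] TangentSpace (𝓡 n) x →ₗ[ℝ] V x)
    (u : ∀ x, V x) (x : M) : V x :=
  haveI : Module.Finite ℝ (TangentSpace (𝓡 n) x) :=
    inferInstanceAs (Module.Finite ℝ (EuclideanSpace ℝ (Fin n)))
  metricTrace (h.inner x) (conn' (conn.toFun u) x)

/-! ## Safe operators -/

/-- The required regularity `max {k - s, r - s + ⌊n / 2⌋ + 1}` of the coefficients of the partial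
derivatives of order `r` in an operator of order `s ≤ k`. (If `r + ⌊n / 2⌋ + 1 < s`, then the second
entry is negative and does not matter, in the integers as well as here.) -/
def safeExponent (n k s r : ℕ) : ℕ := max (k - s) (r + n / 2 + 1 - s)

open Classical in
/-- The operator `P` from sections of `V` to sections of `W` is a `k`-safe differential operator of
order `s ≤ k`: in every bundle chart,
`P = ∑_{r ≤ s} ∑_{i₁ ≤ ⋯ ≤ i_r} A_{i₁, …, i_r} ∂_{i₁} ⋯ ∂_{i_r}` on sections of class `Hˢ`, with
matrices `A_{i₁, …, i_r}` of class `H^{max {k - s, r - s + ⌊n / 2⌋ + 1}}`. -/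
def IsSafe {κ' : Type} {W : M → Type*} [∀ x, AddCommGroup (W x)] [∀ x, Module ℝ (W x)] [Fintype κ]
    (k s : ℕ) (BV : BundleCharts C κ V) (BW : BundleCharts C κ' W)
    (P : (∀ x, V x) → ∀ x, W x) : Prop :=
  s ≤ k ∧ ∀ j, ∃ A : ∀ r : ℕ, (Fin r → Fin n) → EuclideanSpace ℝ (Fin n) → Matrix κ' κ ℝ,
    (∀ r ≤ s, ∀ I : Fin r → Fin n, Monotone I → ∀ a b,
      MemHloc (safeExponent n k s r) (C.chart j).target (fun y => A r I y a b)) ∧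
    ∀ u, BV.MemH s u → ∀ᵐ y ∂(volume.restrict (C.chart j).target),
      BW.localRep j (P u) y =
        ∑ r ∈ Finset.range (s + 1), ∑ I : Fin r → Fin n with Monotone I,
          (A r I y).mulVec
            (fun b => iterWeakDeriv I (C.chart j).target (fun z => BV.localRep j u z b) y)

end Laplace

end Manifold

/-! In a bundle chart a connection reads $(\nabla_i u)^b=\partial_i u^b+\sum_a\Gamma_{ia}^b u^a$.
This follows from locality (multiply by a cutoff and use the Leibniz rule) and from expanding `u` in
the local frame. Hence `∇` has constant first order coefficients and zeroth order coefficients of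
class $H^{k-1}$. Since $k>n/2$ means $\lfloor n/2\rfloor+1\le k$, the exponent demanded for `r = 0`,
`s = 1` is exactly $k-1$. This is claim (1).

For claim (2), write $g^{il}$ for the inverse Gram matrix and $\Lambda$ for the Christoffel symbols
of `D`. Applying the local formula twice gives an operator of order two with coefficients $g^{il}$
in order two, sums of $g\Gamma$ and $g\Lambda$ in order one, and sums of
$g(\partial\Gamma+\Gamma\Gamma-\Lambda\Gamma)$ in order zero. With $k-1>n/2$ the required classes
are at most $H^{k-1}$, and $H^{k-2}$ in orders one and zero. So everything rests on three facts.

Multiplication: $H^p\cdot H^s\subseteq H^s$ for $s\le p$, $p>n/2$ (`MemHloc.mul`). The core case,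
$H^a\cdot H^b\subseteq L^2$ for $a+b>n/2$, is an estimate for the convolution of Fourier transforms
(`lintegral_enorm_mul_sq_le`). Higher orders follow from the product rule (`MemHloc.mul_of_lt`).

Inversion: the inverse Gram matrix is of class $H^{k-1}$ by Cramer's rule and `MemHloc.inv_mul`,
because uniform positivity bounds the determinant away from zero.

Levi-Civita: for torsion-free `D` the Koszul formula expresses $\Lambda$ through $g^{-1}\partial
h\in H^{k-2}$ (`SobolevConnection.IsMetric.isChristoffel_leviCivita`), so both alternatives for `D`
provide the same regularity.

The induced connection exists because $\nabla_X(w(Y))-w(D_XY)$ is tensorial in `Y`: the derivative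
terms cancel (`IsCutoff.sum_smul_induced`), and finitely many cut-off frames suffice by compactness.
It may be applied to $\nabla u$ because $\nabla u$ is of class $H^1$ for $u$ of class $H^2$. As the
Sobolev classes on `M` refer to all charts of the maximal atlas, this needs invariance of $H^1$
under diffeomorphisms. Product rule, rule for inverses and change of variables for weak derivatives
all come from mollification and $L^2$ convergence. -/

/-! ## Test functions and weak derivatives -/

section WeakDerivatives

variable {n : ℕ} {Ω Ω' : Set (EuclideanSpace ℝ (Fin n))}
  {f f' g g' χ ψ : EuclideanSpace ℝ (Fin n) → ℝ} {i l : Fin n}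

/-- `ψ` is a test function on `Ω`. -/
structure IsTestFunction (Ω : Set (EuclideanSpace ℝ (Fin n)))
    (ψ : EuclideanSpace ℝ (Fin n) → ℝ) : Prop where
  contDiff : ContDiff ℝ ∞ ψ
  hasCompactSupport : HasCompactSupport ψ
  tsupport_subset : tsupport ψ ⊆ Ω

theorem IsTestFunction.fderiv_apply (hψ : IsTestFunction Ω ψ) (v : EuclideanSpace ℝ (Fin n)) :
    IsTestFunction Ω (fun y => fderiv ℝ ψ y v) :=
  ⟨(hψ.1.fderiv_right (m := ∞) (by simp)).clm_apply contDiff_const,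
    hψ.2.fderiv_apply ℝ v, (tsupport_fderiv_apply_subset ℝ v).trans hψ.3⟩

theorem IsTestFunction.continuous (hψ : IsTestFunction Ω ψ) : Continuous ψ := hψ.1.continuous

theorem IsTestFunction.eq_zero (hψ : IsTestFunction Ω ψ) {y : EuclideanSpace ℝ (Fin n)}
    (hy : y ∉ Ω) : ψ y = 0 :=
  image_eq_zero_of_notMem_tsupport fun h => hy (hψ.3 h)

/-- The product of a test function on `Ω` with a smooth function on `Ω` which vanishes near
`Ω \ Ω'` is a test function on `Ω'`. -/
theorem IsTestFunction.mul_of_eventuallyEq_zero (hψ : IsTestFunction Ω ψ) (hΩ : IsOpen Ω)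
    (hχ : ContDiffOn ℝ ∞ χ Ω) (h0 : ∀ y ∈ Ω, y ∉ Ω' → χ =ᶠ[𝓝 y] 0) :
    IsTestFunction Ω' (fun y => χ y * ψ y) := by
  refine ⟨contDiff_iff_contDiffAt.2 fun y => ?_, hψ.2.mul_left, fun y hy => ?_⟩
  · by_cases hy : y ∈ tsupport ψ
    · exact (hχ.contDiffAt (hΩ.mem_nhds (hψ.3 hy))).mul hψ.1.contDiffAt
    · have : (fun y => χ y * ψ y) =ᶠ[𝓝 y] fun _ => 0 := by
        filter_upwards [notMem_tsupport_iff_eventuallyEq.1 hy] with z hz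
        simp [hz]
      exact contDiffAt_const.congr_of_eventuallyEq this
  · have hyΩ : y ∈ Ω := hψ.3 (closure_mono (Function.support_mul_subset_right χ ψ) hy)
    by_contra h
    refine (notMem_tsupport_iff_eventuallyEq.2 ?_) hy
    filter_upwards [h0 y hyΩ h] with z hz
    simp [hz]

theorem MeasureTheory.LocallyIntegrableOn.integrable_mul_testFunction
    (hf : LocallyIntegrableOn f Ω volume) (hψ : IsTestFunction Ω ψ) :
    Integrable (fun y => f y * ψ y) := by
  have hK : IsCompact (tsupport ψ) := hψ.2
  have : (tsupport ψ).indicator (fun y => f y * ψ y) = (fun y => f y * ψ y) := by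
    refine indicator_eq_self.2 (Function.support_subset_iff'.2 fun y hy => ?_)
    simp [image_eq_zero_of_notMem_tsupport hy]
  rw [← this, integrable_indicator_iff hK.measurableSet]
  refine Integrable.mul_of_top_left (hf.integrableOn_compact_subset hψ.3 hK) ?_
  exact (hψ.1.continuous.memLp_top_of_hasCompactSupport hψ.2 volume).mono_measure
    Measure.restrict_le_self

theorem integral_mul_testFunction_congr (h : f =ᵐ[volume.restrict Ω] f') (hΩ : IsOpen Ω)
    (hψ : IsTestFunction Ω ψ) : ∫ y, f y * ψ y = ∫ y, f' y * ψ y := by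
  refine integral_congr_ae ?_
  filter_upwards [(ae_restrict_iff' hΩ.measurableSet).1 h] with y hy
  by_cases hyΩ : y ∈ Ω
  · simp [hy hyΩ]
  · simp [hψ.eq_zero hyΩ]

theorem MeasureTheory.LocallyIntegrableOn.congr_ae_restrict (hf : LocallyIntegrableOn f Ω volume)
    (hΩ : IsOpen Ω) (h : f =ᵐ[volume.restrict Ω] f') : LocallyIntegrableOn f' Ω volume := by
  rw [locallyIntegrableOn_iff hΩ.isLocallyClosed] at hf ⊢
  intro K hK hKc
  exact (hf K hK hKc).congr (ae_restrict_of_ae_restrict_of_subset hK h)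

theorem IsWeakDeriv.mono (h : IsWeakDeriv i Ω f g) (hs : Ω' ⊆ Ω) : IsWeakDeriv i Ω' f g :=
  ⟨h.1.mono_set hs, h.2.mono_set hs, fun ψ h1 h2 h3 => h.3 ψ h1 h2 (h3.trans hs)⟩

theorem IsWeakDeriv.integral_mul_fderiv (h : IsWeakDeriv i Ω f g) (hψ : IsTestFunction Ω ψ) :
    ∫ y, f y * fderiv ℝ ψ y (EuclideanSpace.single i 1) = - ∫ y, g y * ψ y :=
  h.3 ψ hψ.1 hψ.2 hψ.3

theorem IsWeakDeriv.congr (h : IsWeakDeriv i Ω f g) (hΩ : IsOpen Ω)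
    (hf : f =ᵐ[volume.restrict Ω] f') (hg : g =ᵐ[volume.restrict Ω] g') :
    IsWeakDeriv i Ω f' g' := by
  refine ⟨h.1.congr_ae_restrict hΩ hf, h.2.congr_ae_restrict hΩ hg, fun ψ h1 h2 h3 => ?_⟩
  have hψ : IsTestFunction Ω ψ := ⟨h1, h2, h3⟩
  rw [← integral_mul_testFunction_congr hf hΩ (hψ.fderiv_apply _),
    ← integral_mul_testFunction_congr hg hΩ hψ, h.integral_mul_fderiv hψ]

theorem IsWeakDeriv.ae_eq (h : IsWeakDeriv i Ω f g) (h' : IsWeakDeriv i Ω f g')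
    (hΩ : IsOpen Ω) : g =ᵐ[volume.restrict Ω] g' := by
  have := hΩ.ae_eq_zero_of_integral_contDiff_smul_eq_zero (μ := volume)
    (f := fun y => g y - g' y) (h.2.sub h'.2) fun ψ h1 h2 h3 => by
      have hψ : IsTestFunction Ω ψ := ⟨h1, h2, h3⟩
      have e := h.integral_mul_fderiv hψ
      rw [h'.integral_mul_fderiv hψ] at e
      simp only [smul_eq_mul, mul_comm (ψ _), sub_mul]
      rw [integral_sub (h.2.integrable_mul_testFunction hψ) (h'.2.integrable_mul_testFunction hψ)]
      linarith
  filter_upwards [(ae_restrict_iff' hΩ.measurableSet).2 this] with y hy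
  linarith

theorem IsWeakDeriv.isWeakDeriv_weakDeriv (h : IsWeakDeriv i Ω f g) :
    IsWeakDeriv i Ω f (weakDeriv i Ω f) := by
  have h' : ∃ g, IsWeakDeriv i Ω f g := ⟨g, h⟩
  rw [weakDeriv, dif_pos h']
  exact h'.choose_spec

theorem IsWeakDeriv.weakDeriv_ae_eq (h : IsWeakDeriv i Ω f g) (hΩ : IsOpen Ω) :
    weakDeriv i Ω f =ᵐ[volume.restrict Ω] g :=
  h.isWeakDeriv_weakDeriv.ae_eq h hΩ

theorem IsWeakDeriv.add (h : IsWeakDeriv i Ω f g) (h' : IsWeakDeriv i Ω f' g') :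
    IsWeakDeriv i Ω (fun y => f y + f' y) (fun y => g y + g' y) := by
  refine ⟨h.1.add h'.1, h.2.add h'.2, fun ψ h1 h2 h3 => ?_⟩
  have hψ : IsTestFunction Ω ψ := ⟨h1, h2, h3⟩
  simp only [add_mul]
  rw [integral_add (h.1.integrable_mul_testFunction (hψ.fderiv_apply _))
    (h'.1.integrable_mul_testFunction (hψ.fderiv_apply _)),
    integral_add (h.2.integrable_mul_testFunction hψ) (h'.2.integrable_mul_testFunction hψ),
    h.integral_mul_fderiv hψ, h'.integral_mul_fderiv hψ, neg_add]

theorem IsWeakDeriv.const_mul (h : IsWeakDeriv i Ω f g) (c : ℝ) :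
    IsWeakDeriv i Ω (fun y => c * f y) (fun y => c * g y) := by
  refine ⟨fun y hy => (h.1 y hy).smul c, fun y hy => (h.2 y hy).smul c, fun ψ h1 h2 h3 => ?_⟩
  simp only [mul_assoc, integral_const_mul, h.3 ψ h1 h2 h3, mul_neg]

/-- The classical derivative of a continuously differentiable function is its weak derivative. -/
theorem isWeakDeriv_of_contDiffOn (hΩ : IsOpen Ω) (hf : ContDiffOn ℝ 1 f Ω) (i : Fin n) :
    IsWeakDeriv i Ω f (fun y => fderiv ℝ f y (EuclideanSpace.single i 1)) := by
  have hf' : ContinuousOn (fun y => fderiv ℝ f y (EuclideanSpace.single i 1)) Ω :=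
    (hf.continuousOn_fderiv_of_isOpen hΩ le_rfl).clm_apply continuousOn_const
  have h1 := hf.continuousOn.locallyIntegrableOn (μ := volume) hΩ.measurableSet
  have h2 := hf'.locallyIntegrableOn (μ := volume) hΩ.measurableSet
  refine ⟨h1, h2, fun ψ a b c => ?_⟩
  have hψ : IsTestFunction Ω ψ := ⟨a, b, c⟩
  exact integral_mul_fderiv_eq_neg_fderiv_mul_of_integrable
    (h2.integrable_mul_testFunction hψ) (h1.integrable_mul_testFunction (hψ.fderiv_apply _))
    (h1.integrable_mul_testFunction hψ)
    (fun x hx => (hf.differentiableOn one_ne_zero).differentiableAt (hΩ.mem_nhds (c hx)))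
    (fun x _ => (a.differentiable (by simp)).differentiableAt)

/-- Having `ρ = 1` near every point of `K`, not only on `K`, also makes the derivatives of `ρ`
vanish on `K`, so that no error terms survive when the cutoff is removed. -/
theorem exists_testFunction_eq_one {K : Set (EuclideanSpace ℝ (Fin n))} (hK : IsCompact K)
    (hΩ : IsOpen Ω) (hKΩ : K ⊆ Ω) : ∃ ρ : EuclideanSpace ℝ (Fin n) → ℝ, IsTestFunction Ω ρ ∧
      (∀ y ∈ K, ρ =ᶠ[𝓝 y] 1) ∧ ∀ y, ρ y ∈ Icc (0 : ℝ) 1 := by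
  obtain ⟨K', hK', hKK', hK'Ω⟩ := exists_compact_between hK hΩ hKΩ
  obtain ⟨ρ, h1, h0, h01⟩ := exists_contMDiffMap_one_nhds_of_subset_interior (n := (⊤ : ℕ∞))
    (𝓘(ℝ, EuclideanSpace ℝ (Fin n))) hK.isClosed hKK'
  have hs : tsupport ρ ⊆ K' := closure_minimal (Function.support_subset_iff'.2 h0) hK'.isClosed
  exact ⟨ρ, ⟨ρ.contMDiff.contDiff, hK'.of_isClosed_subset (isClosed_tsupport _) hs,
    hs.trans hK'Ω⟩, fun y hy => (eventually_nhdsSet_iff_forall.1 h1) y hy, h01⟩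

/-- Extending by zero a locally integrable function multiplied with a cutoff. -/
theorem exists_compact_eq_zero_of_eventuallyEq_zero {K : Set (EuclideanSpace ℝ (Fin n))}
    (hK : IsCompact K) (hKΩ : K ⊆ Ω) (h0 : ∀ y ∈ Ω, y ∉ Ω' → χ =ᶠ[𝓝 y] 0) :
    ∃ K' ⊆ K, IsCompact K' ∧ K' ⊆ Ω' ∧ ∀ y ∈ K, y ∉ K' → χ y = 0 := by
  -- A function on `Ω'` is controlled only on compact subsets of `Ω'`; intersecting with the closed
  -- support of `χ` produces one that carries the whole product on `K`.
  have hs : K ∩ tsupport χ ⊆ Ω' := by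
    rintro y ⟨hyK, hy⟩
    by_contra h
    exact notMem_tsupport_iff_eventuallyEq.2 (h0 y (hKΩ hyK) h) hy
  exact ⟨K ∩ tsupport χ, inter_subset_left, hK.inter_right (isClosed_tsupport _), hs,
    fun y hy hy' => image_eq_zero_of_notMem_tsupport fun h => hy' ⟨hy, h⟩⟩

theorem MeasureTheory.LocallyIntegrableOn.mul_of_eventuallyEq_zero
    (hf : LocallyIntegrableOn f Ω' volume) (hΩ : IsOpen Ω)
    (hχ : ContinuousOn χ Ω) (h0 : ∀ y ∈ Ω, y ∉ Ω' → χ =ᶠ[𝓝 y] 0) :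
    LocallyIntegrableOn (fun y => χ y * f y) Ω volume := by
  rw [locallyIntegrableOn_iff hΩ.isLocallyClosed]
  intro K hKΩ hK
  obtain ⟨K', hK'K, hK', hK'Ω, hz⟩ := exists_compact_eq_zero_of_eventuallyEq_zero hK hKΩ h0
  have h1 : IntegrableOn (fun y => χ y * f y) K' volume :=
    (hf.integrableOn_compact_subset hK'Ω hK').continuousOn_mul (hχ.mono (hK'K.trans hKΩ)) hK'
  have h2 : IntegrableOn (fun y => χ y * f y) (K \ K') volume :=
    integrableOn_zero.congr_fun (fun y hy => by simp [hz y hy.1 hy.2])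
      (hK.measurableSet.diff hK'.measurableSet)
  exact (h1.union h2).mono_set (by simp)

theorem MemL2loc.mul_of_eventuallyEq_zero (hf : MemL2loc Ω' f)
    (hχ : ContinuousOn χ Ω) (h0 : ∀ y ∈ Ω, y ∉ Ω' → χ =ᶠ[𝓝 y] 0) :
    MemL2loc Ω (fun y => χ y * f y) := by
  intro K hK hKΩ
  obtain ⟨K', hK'K, hK', hK'Ω, hz⟩ := exists_compact_eq_zero_of_eventuallyEq_zero hK hKΩ h0
  obtain ⟨c, hc⟩ := hK'.exists_bound_of_continuousOn (hχ.mono (hK'K.trans hKΩ))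
  have h1 : MemLp (fun y => χ y * f y) 2 (volume.restrict K') := by
    refine MemLp.of_le_mul (c := c) (hf K' hK' hK'Ω) ?_ ?_
    · exact ((hχ.mono (hK'K.trans hKΩ)).aestronglyMeasurable hK'.measurableSet).mul
        (hf K' hK' hK'Ω).1
    · filter_upwards [ae_restrict_mem hK'.measurableSet] with y hy
      rw [norm_mul]
      exact mul_le_mul_of_nonneg_right (hc y hy) (norm_nonneg _)
  have h2 : (fun y => χ y * f y) =ᵐ[volume.restrict K] K'.indicator (fun y => χ y * f y) := by
    filter_upwards [ae_restrict_mem hK.measurableSet] with y hy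
    by_cases h : y ∈ K'
    · simp [h]
    · simp [h, hz y hy h]
  refine MemLp.ae_eq h2.symm ?_
  rw [memLp_indicator_iff_restrict hK'.measurableSet, Measure.restrict_restrict hK'.measurableSet,
    inter_eq_left.2 hK'K]
  exact h1

theorem fderiv_eventuallyEq_zero {y : EuclideanSpace ℝ (Fin n)} (h : χ =ᶠ[𝓝 y] 0)
    (v : EuclideanSpace ℝ (Fin n)) : (fun y => fderiv ℝ χ y v) =ᶠ[𝓝 y] 0 := by
  filter_upwards [h.fderiv (𝕜 := ℝ)] with z hz
  rw [hz]; simp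

theorem ContDiffOn.fderiv_apply_const (hΩ : IsOpen Ω) (hχ : ContDiffOn ℝ ∞ χ Ω)
    (v : EuclideanSpace ℝ (Fin n)) : ContDiffOn ℝ ∞ (fun y => fderiv ℝ χ y v) Ω :=
  (hχ.fderiv_of_isOpen hΩ (by simp)).clm_apply contDiffOn_const

/-- The Leibniz rule for a smooth and a weakly differentiable factor, extended by zero. -/
theorem IsWeakDeriv.smooth_mul_of_eventuallyEq_zero (h : IsWeakDeriv i Ω' f g) (hΩ : IsOpen Ω)
    (hχ : ContDiffOn ℝ ∞ χ Ω) (h0 : ∀ y ∈ Ω, y ∉ Ω' → χ =ᶠ[𝓝 y] 0) :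
    IsWeakDeriv i Ω (fun y => χ y * f y)
      (fun y => fderiv ℝ χ y (EuclideanSpace.single i 1) * f y + χ y * g y) := by
  have hχ' := hχ.fderiv_apply_const hΩ (EuclideanSpace.single i 1)
  have h0' : ∀ y ∈ Ω, y ∉ Ω' →
      (fun y => fderiv ℝ χ y (EuclideanSpace.single i 1)) =ᶠ[𝓝 y] 0 :=
    fun y hy hy' => fderiv_eventuallyEq_zero (h0 y hy hy') _
  have l1 := h.1.mul_of_eventuallyEq_zero hΩ hχ.continuousOn h0
  have l2 := h.2.mul_of_eventuallyEq_zero hΩ hχ.continuousOn h0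
  have l3 := h.1.mul_of_eventuallyEq_zero hΩ hχ'.continuousOn h0'
  refine ⟨l1, l3.add l2, fun ψ a b c => ?_⟩
  have hψ : IsTestFunction Ω ψ := ⟨a, b, c⟩
  -- The product `χψ` is an admissible test function on `Ω'`; the classical product rule for its
  -- derivative yields the claim.
  have e := h.integral_mul_fderiv (hψ.mul_of_eventuallyEq_zero hΩ hχ h0)
  have e2 : ∀ y, f y * fderiv ℝ (fun y => χ y * ψ y) y (EuclideanSpace.single i 1) =
      (χ y * f y) * fderiv ℝ ψ y (EuclideanSpace.single i 1) +
      (fderiv ℝ χ y (EuclideanSpace.single i 1) * f y) * ψ y := by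
    intro y
    by_cases hy : y ∈ Ω
    · have d1 : DifferentiableAt ℝ χ y :=
        ((hχ.contDiffAt (hΩ.mem_nhds hy)).differentiableAt (by simp))
      have d2 : DifferentiableAt ℝ ψ y := (a.differentiable (by simp)) y
      rw [fderiv_fun_mul d1 d2]
      simp
      ring
    · have t : y ∉ tsupport (fun y => χ y * ψ y) :=
        fun h => hy (hψ.3 (closure_mono (Function.support_mul_subset_right χ ψ) h))
      have t2 : y ∉ tsupport ψ := fun h => hy (hψ.3 h)
      rw [image_eq_zero_of_notMem_tsupport t2,
        (notMem_tsupport_iff_eventuallyEq.1 t).fderiv_eq,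
        (notMem_tsupport_iff_eventuallyEq.1 t2).fderiv_eq]
      simp
  simp only [e2] at e
  rw [integral_add (l1.integrable_mul_testFunction (hψ.fderiv_apply _))
    (l3.integrable_mul_testFunction hψ)] at e
  simp only [add_mul]
  rw [integral_add (l3.integrable_mul_testFunction hψ) (l2.integrable_mul_testFunction hψ)]
  have e3 : ∫ y, g y * (χ y * ψ y) = ∫ y, χ y * g y * ψ y := by
    congr 1; ext y; ring
  linarith

theorem fderiv_fderiv_comm (hψ : ContDiff ℝ ∞ ψ) (y v w : EuclideanSpace ℝ (Fin n)) :
    fderiv ℝ (fun z => fderiv ℝ ψ z v) y w = fderiv ℝ (fun z => fderiv ℝ ψ z w) y v := by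
  have hd : DifferentiableAt ℝ (fderiv ℝ ψ) y :=
    ((hψ.fderiv_right (m := ∞) (by simp)).differentiable (by simp)) y
  have key : ∀ a b, fderiv ℝ (fun z => fderiv ℝ ψ z a) y b = fderiv ℝ (fderiv ℝ ψ) y b a := by
    intro a b
    rw [fderiv_clm_apply hd (differentiableAt_const a)]
    simp
  rw [key, key]
  exact (hψ.contDiffAt.isSymmSndFDerivAt (by simpa using WithTop.coe_le_coe.2 (le_top (a := (2 : ℕ∞))))) w v

/-- Weak derivatives commute. -/
theorem IsWeakDeriv.comm {fi fl h : EuclideanSpace ℝ (Fin n) → ℝ} (hi : IsWeakDeriv i Ω f fi)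
    (hl : IsWeakDeriv l Ω f fl) (hil : IsWeakDeriv l Ω fi h) : IsWeakDeriv i Ω fl h := by
  refine ⟨hl.2, hil.2, fun ψ a b c => ?_⟩
  have hψ : IsTestFunction Ω ψ := ⟨a, b, c⟩
  -- All derivatives are moved to the test function, where they commute. Thus weak differentiability
  -- of `fl` is a conclusion and need not be assumed.
  have e1 := hl.integral_mul_fderiv (hψ.fderiv_apply (EuclideanSpace.single i 1))
  have e2 := hi.integral_mul_fderiv (hψ.fderiv_apply (EuclideanSpace.single l 1))
  have e3 := hil.integral_mul_fderiv hψ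
  simp only [fderiv_fderiv_comm a _ (EuclideanSpace.single i 1)] at e1
  linarith

end WeakDerivatives

/-! ## Elementary properties of the local Sobolev classes -/

section LocalSobolev

variable {n m m' : ℕ} {Ω Ω' : Set (EuclideanSpace ℝ (Fin n))}
  {f f' g g' χ ψ : EuclideanSpace ℝ (Fin n) → ℝ} {i l : Fin n}

theorem MemL2loc.mono (hf : MemL2loc Ω f) (h : Ω' ⊆ Ω) : MemL2loc Ω' f :=
  fun K hK hKΩ => hf K hK (hKΩ.trans h)

theorem MemL2loc.congr (hf : MemL2loc Ω f) (h : f =ᵐ[volume.restrict Ω] f') : MemL2loc Ω f' :=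
  fun K hK hKΩ => (hf K hK hKΩ).ae_eq (ae_restrict_of_ae_restrict_of_subset hKΩ h)

theorem MemL2loc.add (hf : MemL2loc Ω f) (hg : MemL2loc Ω g) :
    MemL2loc Ω (fun y => f y + g y) :=
  fun K hK hKΩ => (hf K hK hKΩ).add (hg K hK hKΩ)

theorem MemL2loc.const_mul (hf : MemL2loc Ω f) (c : ℝ) : MemL2loc Ω (fun y => c * f y) :=
  fun K hK hKΩ => (hf K hK hKΩ).const_mul c

theorem ContinuousOn.memL2loc (hf : ContinuousOn f Ω) : MemL2loc Ω f := by
  intro K hK hKΩ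
  obtain ⟨c, hc⟩ := hK.exists_bound_of_continuousOn (hf.mono hKΩ)
  have : IsFiniteMeasure (volume.restrict K) := ⟨by simpa using hK.measure_lt_top⟩
  exact MemLp.of_bound ((hf.mono hKΩ).aestronglyMeasurable hK.measurableSet) c
    ((ae_restrict_mem hK.measurableSet).mono hc)

theorem MemL2loc.locallyIntegrableOn (hf : MemL2loc Ω f) (hΩ : IsOpen Ω) :
    LocallyIntegrableOn f Ω volume := by
  rw [locallyIntegrableOn_iff hΩ.isLocallyClosed]
  intro K hKΩ hK
  have : IsFiniteMeasure (volume.restrict K) := ⟨by simpa using hK.measure_lt_top⟩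
  exact (hf K hK hKΩ).integrable one_le_two

theorem MemL2loc.mul_locallyIntegrableOn (hf : MemL2loc Ω f) (hg : MemL2loc Ω g)
    (hΩ : IsOpen Ω) : LocallyIntegrableOn (fun y => f y * g y) Ω volume := by
  rw [locallyIntegrableOn_iff hΩ.isLocallyClosed]
  intro K hKΩ hK
  exact (hf K hK hKΩ).integrable_mul (hg K hK hKΩ)

theorem MemHloc.memL2loc (hf : MemHloc m Ω f) : MemL2loc Ω f := by
  cases m with
  | zero => exact hf
  | succ m => exact hf.1

theorem MemHloc.locallyIntegrableOn (hf : MemHloc m Ω f) (hΩ : IsOpen Ω) :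
    LocallyIntegrableOn f Ω volume := hf.memL2loc.locallyIntegrableOn hΩ

theorem MemHloc.mono (hf : MemHloc m Ω f) (h : Ω' ⊆ Ω) : MemHloc m Ω' f := by
  induction m generalizing f with
  | zero => exact MemL2loc.mono hf h
  | succ m ih =>
    refine ⟨hf.1.mono h, fun i => ?_⟩
    obtain ⟨g, hg, hgm⟩ := hf.2 i
    exact ⟨g, hg.mono h, ih hgm⟩

theorem MemHloc.congr (hf : MemHloc m Ω f) (hΩ : IsOpen Ω) (h : f =ᵐ[volume.restrict Ω] f') :
    MemHloc m Ω f' := by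
  cases m with
  | zero => exact MemL2loc.congr hf h
  | succ m =>
    refine ⟨hf.1.congr h, fun i => ?_⟩
    obtain ⟨g, hg, hgm⟩ := hf.2 i
    exact ⟨g, hg.congr hΩ h EventuallyEq.rfl, hgm⟩

theorem MemHloc.congr_on (hf : MemHloc m Ω f) (hΩ : IsOpen Ω) (h : ∀ y ∈ Ω, f y = f' y) :
    MemHloc m Ω f' :=
  hf.congr hΩ ((ae_restrict_mem hΩ.measurableSet).mono h)

theorem MemHloc.of_succ (hf : MemHloc (m + 1) Ω f) : MemHloc m Ω f := by
  induction m generalizing f with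
  | zero => exact hf.1
  | succ m ih =>
    refine ⟨hf.1, fun i => ?_⟩
    obtain ⟨g, hg, hgm⟩ := hf.2 i
    exact ⟨g, hg, ih hgm⟩

theorem MemHloc.of_le (hf : MemHloc m Ω f) (h : m' ≤ m) : MemHloc m' Ω f := by
  induction m, h using Nat.le_induction with
  | base => exact hf
  | succ m _ ih => exact ih hf.of_succ

theorem MemHloc.isWeakDeriv (hf : MemHloc (m + 1) Ω f) (i : Fin n) :
    IsWeakDeriv i Ω f (weakDeriv i Ω f) := by
  obtain ⟨g, hg, -⟩ := hf.2 i
  exact hg.isWeakDeriv_weakDeriv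

/-- The definition of `MemHloc` grants one regular weak derivative; uniqueness up to null sets
passes the regularity to every other, in particular to `weakDeriv`. -/
theorem MemHloc.memHloc_of_isWeakDeriv (hf : MemHloc (m + 1) Ω f) (hΩ : IsOpen Ω)
    (hg : IsWeakDeriv i Ω f g) : MemHloc m Ω g := by
  obtain ⟨g', hg', hm⟩ := hf.2 i
  exact hm.congr hΩ (hg'.ae_eq hg hΩ)

theorem MemHloc.weakDeriv (hf : MemHloc (m + 1) Ω f) (hΩ : IsOpen Ω) (i : Fin n) :
    MemHloc m Ω (weakDeriv i Ω f) :=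
  hf.memHloc_of_isWeakDeriv hΩ (hf.isWeakDeriv i)

theorem MemHloc.add (hf : MemHloc m Ω f) (hg : MemHloc m Ω g) :
    MemHloc m Ω (fun y => f y + g y) := by
  induction m generalizing f g with
  | zero => exact MemL2loc.add hf hg
  | succ m ih =>
    refine ⟨hf.1.add hg.1, fun i => ?_⟩
    obtain ⟨f₁, hf₁, hfm⟩ := hf.2 i
    obtain ⟨g₁, hg₁, hgm⟩ := hg.2 i
    exact ⟨_, hf₁.add hg₁, ih hfm hgm⟩

theorem MemHloc.const_mul (hf : MemHloc m Ω f) (c : ℝ) : MemHloc m Ω (fun y => c * f y) := by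
  induction m generalizing f with
  | zero => exact MemL2loc.const_mul hf c
  | succ m ih =>
    refine ⟨hf.1.const_mul c, fun i => ?_⟩
    obtain ⟨f₁, hf₁, hfm⟩ := hf.2 i
    exact ⟨_, hf₁.const_mul c, ih hfm⟩

theorem MemHloc.neg (hf : MemHloc m Ω f) : MemHloc m Ω (fun y => - f y) := by
  simpa using hf.const_mul (-1)

theorem MemHloc.sub (hf : MemHloc m Ω f) (hg : MemHloc m Ω g) :
    MemHloc m Ω (fun y => f y - g y) := by
  simpa [sub_eq_add_neg] using hf.add hg.neg

theorem ContDiffOn.memHloc (hΩ : IsOpen Ω) (hf : ContDiffOn ℝ ∞ f Ω) : MemHloc m Ω f := by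
  induction m generalizing f with
  | zero => exact hf.continuousOn.memL2loc
  | succ m ih =>
    exact ⟨hf.continuousOn.memL2loc, fun i => ⟨_, isWeakDeriv_of_contDiffOn hΩ (hf.of_le (by simp)) i,
      ih (hf.fderiv_apply_const hΩ _)⟩⟩

theorem memHloc_const (hΩ : IsOpen Ω) (c : ℝ) : MemHloc m Ω (fun _ => c) :=
  ContDiffOn.memHloc hΩ contDiffOn_const

theorem MemHloc.sum {ι : Type*} (s : Finset ι) {F : ι → EuclideanSpace ℝ (Fin n) → ℝ}
    (hΩ : IsOpen Ω) (h : ∀ a ∈ s, MemHloc m Ω (F a)) : MemHloc m Ω (fun y => ∑ a ∈ s, F a y) := by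
  classical
  induction s using Finset.induction_on with
  | empty => simpa using memHloc_const hΩ 0
  | insert a s ha ih =>
    simp only [Finset.sum_insert ha]
    exact (h a (by simp)).add (ih fun b hb => h b (by simp [hb]))

theorem IsWeakDeriv.sum {ι : Type*} (s : Finset ι) {F G : ι → EuclideanSpace ℝ (Fin n) → ℝ}
    (hΩ : IsOpen Ω) (h : ∀ a ∈ s, IsWeakDeriv i Ω (F a) (G a)) :
    IsWeakDeriv i Ω (fun y => ∑ a ∈ s, F a y) (fun y => ∑ a ∈ s, G a y) := by
  classical
  induction s using Finset.induction_on with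
  | empty => simpa using isWeakDeriv_of_contDiffOn (f := fun _ => 0) hΩ contDiffOn_const i
  | insert a s ha ih =>
    simp only [Finset.sum_insert ha]
    exact (h a (by simp)).add (ih fun b hb => h b (by simp [hb]))

/-- The product of a Sobolev function on `Ω'` with a smooth function on `Ω` which vanishes near
`Ω \ Ω'` is a Sobolev function on `Ω`. -/
theorem MemHloc.smooth_mul_of_eventuallyEq_zero (hf : MemHloc m Ω' f) (hΩ : IsOpen Ω)
    (hχ : ContDiffOn ℝ ∞ χ Ω) (h0 : ∀ y ∈ Ω, y ∉ Ω' → χ =ᶠ[𝓝 y] 0) :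
    MemHloc m Ω (fun y => χ y * f y) := by
  induction m generalizing f χ with
  | zero => exact MemL2loc.mul_of_eventuallyEq_zero hf hχ.continuousOn h0
  | succ m ih =>
    refine ⟨hf.1.mul_of_eventuallyEq_zero hχ.continuousOn h0, fun i => ?_⟩
    obtain ⟨f₁, hf₁, hfm⟩ := hf.2 i
    exact ⟨_, hf₁.smooth_mul_of_eventuallyEq_zero hΩ hχ h0,
      (ih hf.of_succ (hχ.fderiv_apply_const hΩ _)
        fun y hy hy' => fderiv_eventuallyEq_zero (h0 y hy hy') _).add (ih hfm hχ h0)⟩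

theorem MemHloc.smooth_mul (hf : MemHloc m Ω f) (hΩ : IsOpen Ω) (hχ : ContDiffOn ℝ ∞ χ Ω) :
    MemHloc m Ω (fun y => χ y * f y) :=
  hf.smooth_mul_of_eventuallyEq_zero hΩ hχ fun _ h h' => (h' h).elim

theorem IsWeakDeriv.smooth_mul (hf : IsWeakDeriv i Ω f g) (hΩ : IsOpen Ω)
    (hχ : ContDiffOn ℝ ∞ χ Ω) : IsWeakDeriv i Ω (fun y => χ y * f y)
      (fun y => fderiv ℝ χ y (EuclideanSpace.single i 1) * f y + χ y * g y) :=
  hf.smooth_mul_of_eventuallyEq_zero hΩ hχ fun _ h h' => (h' h).elim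

/-- Multiplication with a test function on `Ω` localizes a Sobolev function on `Ω` to a global
Sobolev function. -/
theorem MemHloc.testFunction_mul (hf : MemHloc m Ω f) (hχ : IsTestFunction Ω χ) :
    MemHloc m univ (fun y => χ y * f y) :=
  hf.smooth_mul_of_eventuallyEq_zero isOpen_univ hχ.1.contDiffOn
    fun _ _ hy => notMem_tsupport_iff_eventuallyEq.1 fun h => hy (hχ.3 h)

end LocalSobolev

/-! ## Young's inequality and mollification -/

section Young

variable {G : Type*} [MeasurableSpace G]

/-- The Cauchy–Schwarz inequality with a weight. -/
theorem sq_lintegral_mul_le {μ : Measure G} {k F : G → ENNReal} (hk : Measurable k)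
    (hF : Measurable F) :
    (∫⁻ y, k y * F y ∂μ) ^ 2 ≤ (∫⁻ y, k y ∂μ) * ∫⁻ y, k y * F y ^ 2 ∂μ := by
  -- Hölder's inequality for `F` and the constant `1` with respect to the measure with density `k`.
  have h := ENNReal.lintegral_mul_le_Lp_mul_Lq (μ.withDensity k) Real.HolderConjugate.two_two
    (f := F) (g := 1) hF.aemeasurable measurable_one.aemeasurable
  have e1 : ∫⁻ y, (F * 1) y ∂(μ.withDensity k) = ∫⁻ y, k y * F y ∂μ := by
    rw [lintegral_withDensity_eq_lintegral_mul _ hk (by simpa using hF)]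
    simp
  have e2 : ∫⁻ y, F y ^ (2 : ℝ) ∂(μ.withDensity k) = ∫⁻ y, k y * F y ^ 2 ∂μ := by
    rw [lintegral_withDensity_eq_lintegral_mul _ hk (hF.pow_const _)]
    simp
  have e3 : ∫⁻ y, (1 : G → ENNReal) y ^ (2 : ℝ) ∂(μ.withDensity k) = ∫⁻ y, k y ∂μ := by
    simp
  rw [e1, e2, e3] at h
  calc (∫⁻ y, k y * F y ∂μ) ^ 2
      ≤ ((∫⁻ y, k y * F y ^ 2 ∂μ) ^ (1 / 2 : ℝ) * (∫⁻ y, k y ∂μ) ^ (1 / 2 : ℝ)) ^ 2 := by gcongr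
    _ = (∫⁻ y, k y ∂μ) * ∫⁻ y, k y * F y ^ 2 ∂μ := by
      rw [mul_pow, ← ENNReal.rpow_natCast, ← ENNReal.rpow_natCast, ← ENNReal.rpow_mul,
        ← ENNReal.rpow_mul]
      norm_num [mul_comm]

/-- Young's inequality for the convolution of an integrable and a square integrable function. -/
theorem lintegral_sq_lintegral_mul_sub_le [AddCommGroup G] [MeasurableAdd₂ G] [MeasurableNeg G]
    {μ : Measure G} [SFinite μ] [μ.IsAddLeftInvariant] {k F : G → ENNReal} (hk : Measurable k)
    (hF : Measurable F) :
    ∫⁻ x, (∫⁻ y, k y * F (x - y) ∂μ) ^ 2 ∂μ ≤ (∫⁻ y, k y ∂μ) ^ 2 * ∫⁻ y, F y ^ 2 ∂μ := by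
  -- Weighted Cauchy–Schwarz for each `x`, then Tonelli and translation invariance.
  calc ∫⁻ x, (∫⁻ y, k y * F (x - y) ∂μ) ^ 2 ∂μ
      ≤ ∫⁻ x, (∫⁻ y, k y ∂μ) * ∫⁻ y, k y * F (x - y) ^ 2 ∂μ ∂μ :=
        lintegral_mono fun x =>
          sq_lintegral_mul_le hk (hF.comp (measurable_const.sub measurable_id))
    _ = (∫⁻ y, k y ∂μ) * ∫⁻ x, ∫⁻ y, k y * F (x - y) ^ 2 ∂μ ∂μ := by
        refine lintegral_const_mul _ (Measurable.lintegral_prod_right' (f := fun p : G × G =>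
          k p.2 * F (p.1 - p.2) ^ 2) ?_)
        exact (hk.comp measurable_snd).mul
          ((hF.comp (measurable_fst.sub measurable_snd)).pow_const _)
    _ = (∫⁻ y, k y ∂μ) * ∫⁻ y, ∫⁻ x, k y * F (x - y) ^ 2 ∂μ ∂μ := by
        rw [lintegral_lintegral_swap]
        exact ((hk.comp measurable_snd).mul
          ((hF.comp (measurable_fst.sub measurable_snd)).pow_const _)).aemeasurable
    _ = (∫⁻ y, k y ∂μ) * ∫⁻ y, k y * ∫⁻ x, F x ^ 2 ∂μ ∂μ := by
        congr 2 with y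
        have hm : Measurable fun x => F (x - y) ^ 2 :=
          (hF.comp (measurable_id.sub_const y)).pow_const _
        rw [lintegral_const_mul _ hm, lintegral_sub_right_eq_self (fun x => F x ^ 2)]
    _ = (∫⁻ y, k y ∂μ) ^ 2 * ∫⁻ y, F y ^ 2 ∂μ := by
        rw [lintegral_mul_const _ hk, sq, mul_assoc]

end Young

/-! ### Convergence in $L^2$ -/

section Convergence

variable {α : Type*} [MeasurableSpace α] {μ : Measure α}

theorem eLpNorm_two_eq_lintegral {E : Type*} [NormedAddCommGroup E] (f : α → E) :
    eLpNorm f 2 μ = (∫⁻ x, ‖f x‖ₑ ^ 2 ∂μ) ^ (1 / 2 : ℝ) := by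
  rw [eLpNorm_eq_lintegral_rpow_enorm_toReal (by simp) (by simp)]
  simp

theorem eLpNorm_two_sq {E : Type*} [NormedAddCommGroup E] (f : α → E) :
    eLpNorm f 2 μ ^ 2 = ∫⁻ x, ‖f x‖ₑ ^ 2 ∂μ := by
  rw [eLpNorm_two_eq_lintegral, ← ENNReal.rpow_natCast, ← ENNReal.rpow_mul]
  norm_num

/-- Almost everywhere convergence without increase of the `L²` norm is `L²` convergence. -/
theorem tendsto_eLpNorm_sub_of_ae_tendsto {F : ℕ → α → ℝ} {f : α → ℝ}
    (hF : ∀ j, MemLp (F j) 2 μ) (hf : MemLp f 2 μ)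
    (h : ∀ᵐ x ∂μ, Tendsto (fun j => F j x) atTop (𝓝 (f x)))
    (hle : ∀ j, eLpNorm (F j) 2 μ ≤ eLpNorm f 2 μ) :
    Tendsto (fun j => eLpNorm (F j - f) 2 μ) atTop (𝓝 0) := by
  set A := (eLpNorm f 2 μ).toReal with hA
  set b : ℕ → ℝ := fun j => (eLpNorm (F j + f) 2 μ).toReal with hb
  have hAe : ENNReal.ofReal A = eLpNorm f 2 μ := ENNReal.ofReal_toReal hf.2.ne
  have hbe : ∀ j, ENNReal.ofReal (b j) = eLpNorm (F j + f) 2 μ :=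
    fun j => ENNReal.ofReal_toReal ((hF j).add hf).2.ne
  have hA0 : 0 ≤ A := ENNReal.toReal_nonneg
  have hb0 : ∀ j, 0 ≤ b j := fun j => ENNReal.toReal_nonneg
  -- The parallelogram law bounds $\|F_j-f\|^2$ by $4\|f\|^2-\|F_j+f\|^2$. It remains to bound
  -- $\|F_j+f\|$ from below.
  have key : ∀ j, (eLpNorm (F j - f) 2 μ).toReal ^ 2 ≤ 4 * A ^ 2 - b j ^ 2 := by
    intro j
    have hp := parallelogram_law_with_norm ℝ ((hF j).toLp (F j)) (hf.toLp f)
    rw [← MemLp.toLp_add, ← MemLp.toLp_sub, Lp.norm_toLp, Lp.norm_toLp, Lp.norm_toLp,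
      Lp.norm_toLp] at hp
    have h1 : (eLpNorm (F j) 2 μ).toReal ≤ A := ENNReal.toReal_mono hf.2.ne (hle j)
    have h2 : (eLpNorm (F j) 2 μ).toReal ^ 2 ≤ A ^ 2 :=
      pow_le_pow_left₀ ENNReal.toReal_nonneg h1 2
    simp only [hb, hA] at *
    linarith
  -- Fatou's lemma for $F_j+f\to 2f$.
  have hlim : ENNReal.ofReal (2 * A) ≤ liminf (fun j => ENNReal.ofReal (b j)) atTop := by
    have h1 := Lp.eLpNorm_lim_le_liminf_eLpNorm (p := 2) (μ := μ) (f := fun j => F j + f)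
      (fun j => ((hF j).add hf).1) (fun x => (2 : ℝ) * f x) (by
        filter_upwards [h] with x hx
        simpa [two_mul] using hx.add_const (f x))
    simp only [hbe]
    refine le_trans (le_of_eq ?_) h1
    have : (fun x => (2 : ℝ) * f x) = (2 : ℝ) • f := by ext; simp
    rw [this, eLpNorm_const_smul, ENNReal.ofReal_mul (by norm_num), hAe]
    congr 1
    simp [Real.enorm_eq_ofReal]
  have hev : ∀ ε > 0, ∀ᶠ j in atTop, 2 * A - ε < b j := by
    intro ε hε
    by_cases h2 : 2 * A - ε < 0
    · exact Eventually.of_forall fun j => h2.trans_le (hb0 j)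
    have h3 : ENNReal.ofReal (2 * A - ε) < liminf (fun j => ENNReal.ofReal (b j)) atTop :=
      lt_of_lt_of_le ((ENNReal.ofReal_lt_ofReal_iff_of_nonneg (not_lt.1 h2)).2 (by linarith)) hlim
    filter_upwards [eventually_lt_of_lt_liminf h3] with j hj
    exact (ENNReal.ofReal_lt_ofReal_iff_of_nonneg (not_lt.1 h2)).1 hj
  have hreal : Tendsto (fun j => (eLpNorm (F j - f) 2 μ).toReal) atTop (𝓝 0) := by
    refine Metric.tendsto_atTop'.2 fun ε hε => ?_
    -- For $2A-\delta<b\le 2A$ one has $4A^2-b^2=(2A-b)(2A+b)\le 4A\delta<\varepsilon^2$; the `+ 1`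
    -- keeps the last inequality strict and admits `A = 0`.
    have hδ : 0 < min 1 (ε ^ 2 / (4 * A + 1)) := by positivity
    obtain ⟨N, hN⟩ := eventually_atTop.1 (hev _ hδ)
    refine ⟨N, fun j hj => ?_⟩
    have h1 := hN j hj.le
    set δ := min 1 (ε ^ 2 / (4 * A + 1))
    have hd1 : δ * (4 * A + 1) ≤ ε ^ 2 := by
      have : δ ≤ ε ^ 2 / (4 * A + 1) := min_le_right _ _
      rwa [le_div_iff₀ (by positivity)] at this
    have hsq : (eLpNorm (F j - f) 2 μ).toReal ^ 2 < ε ^ 2 := by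
      have h2 := key j
      by_cases hc : b j ≤ 2 * A
      · nlinarith [hb0 j]
      · nlinarith [hb0 j, sq_nonneg ε, pow_pos hε 2]
    rw [Real.dist_eq, sub_zero, abs_of_nonneg ENNReal.toReal_nonneg]
    exact lt_of_pow_lt_pow_left₀ 2 hε.le hsq
  rw [← ENNReal.tendsto_toReal_iff (fun j => ((hF j).sub hf).2.ne) (by simp)]
  simpa using hreal

/-- Integrals of products converge if one factor converges in `L²` and the other one almost
everywhere with a square integrable bound. -/
theorem tendsto_integral_mul_of_tendsto_eLpNorm {F G : ℕ → α → ℝ} {f g b : α → ℝ}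
    (hF : ∀ j, MemLp (F j) 2 μ) (hf : MemLp f 2 μ)
    (hlim : Tendsto (fun j => eLpNorm (F j - f) 2 μ) atTop (𝓝 0))
    (hG : ∀ j, AEStronglyMeasurable (G j) μ) (hb : MemLp b 2 μ)
    (hGb : ∀ j, ∀ᵐ x ∂μ, ‖G j x‖ ≤ b x)
    (hGg : ∀ᵐ x ∂μ, Tendsto (fun j => G j x) atTop (𝓝 (g x))) :
    Tendsto (fun j => ∫ x, F j x * G j x ∂μ) atTop (𝓝 (∫ x, f x * g x ∂μ)) := by
  have hG2 : ∀ j, MemLp (G j) 2 μ := fun j =>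
    hb.of_le (hG j) ((hGb j).mono fun x hx => hx.trans (le_abs_self _))
  -- Split $F_jG_j=(F_j-f)G_j+fG_j$. The second term is dominated by $|f|b$; the first tends to zero
  -- in $L^1$ by Hölder.
  have h1 : Tendsto (fun j => ∫ x, f x * G j x ∂μ) atTop (𝓝 (∫ x, f x * g x ∂μ)) := by
    refine tendsto_integral_of_dominated_convergence (fun x => ‖f x‖ * b x)
      (fun j => hf.1.mul (hG j)) (hf.norm.integrable_mul hb) (fun j => ?_) ?_
    · filter_upwards [hGb j] with x hx
      rw [norm_mul]
      exact mul_le_mul_of_nonneg_left hx (norm_nonneg _)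
    · filter_upwards [hGg] with x hx
      exact hx.const_mul _
  have h2 : Tendsto (fun j => ∫ x, (F j x - f x) * G j x ∂μ) atTop (𝓝 0) := by
    have h3 : Tendsto (fun j => eLpNorm ((fun x => (F j x - f x) * G j x) - fun _ => (0 : ℝ)) 1 μ)
        atTop (𝓝 0) := by
      have hB : eLpNorm b 2 μ ≠ ⊤ := hb.2.ne
      refine tendsto_of_tendsto_of_tendsto_of_le_of_le tendsto_const_nhds
        (h := fun j => eLpNorm (F j - f) 2 μ * eLpNorm b 2 μ) ?_ (fun _ => zero_le) fun j => ?_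
      · simpa using ENNReal.Tendsto.mul_const hlim (Or.inr hB)
      · have := eLpNorm_smul_le_mul_eLpNorm (p := 2) (q := 2) (r := 1) ((hF j).sub hf).1 (hG j)
        have e : ((fun x => (F j x - f x) * G j x) - fun _ => (0 : ℝ)) = G j • (F j - f) := by
          ext x; simp [mul_comm]
        rw [e]
        rw [mul_comm] at this
        exact this.trans (mul_le_mul_right (eLpNorm_mono_ae_real (hGb j)) _)
    have h4 := tendsto_integral_of_L1' (fun _ => (0 : ℝ)) aestronglyMeasurable_const
      (Eventually.of_forall fun j => ((hF j).sub hf).integrable_mul (hG2 j)) h3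
    simpa using h4
  have h5 := h2.add h1
  rw [zero_add] at h5
  refine h5.congr fun j => ?_
  have e := integral_add (((hF j).sub hf).integrable_mul (hG2 j)) (hf.integrable_mul (hG2 j))
  simp only [Pi.mul_apply, Pi.sub_apply] at e
  rw [← e]
  congr 1; ext x; ring

end Convergence

/-! ### Mollification -/

section Mollify

variable {n : ℕ} {f g : EuclideanSpace ℝ (Fin n) → ℝ} {i : Fin n}

/-- A sequence of bump functions whose supports shrink to the origin. -/
noncomputable def mollifier (n : ℕ) (j : ℕ) : ContDiffBump (0 : EuclideanSpace ℝ (Fin n)) where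
  rIn := 1 / (j + 1)
  rOut := 2 / (j + 1)
  rIn_pos := by positivity
  rIn_lt_rOut := by gcongr; norm_num

/-- The mollifications of a locally integrable function. -/
noncomputable def mollify (j : ℕ) (f : EuclideanSpace ℝ (Fin n) → ℝ) :
    EuclideanSpace ℝ (Fin n) → ℝ :=
  convolution ((mollifier n j).normed volume) f (ContinuousLinearMap.lsmul ℝ ℝ) volume

theorem mollify_eq_integral (j : ℕ) (f : EuclideanSpace ℝ (Fin n) → ℝ)
    (x : EuclideanSpace ℝ (Fin n)) :
    mollify j f x = ∫ t, (mollifier n j).normed volume t * f (x - t) := by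
  simp [mollify, convolution_def]

theorem mollify_congr (j : ℕ) (h : f =ᵐ[volume] g) : mollify j f = mollify j g :=
  convolution_congr _ EventuallyEq.rfl h

theorem contDiff_mollify (j : ℕ) (hf : LocallyIntegrable f volume) :
    ContDiff ℝ ∞ (mollify j f) :=
  HasCompactSupport.contDiff_convolution_left _ (mollifier n j).hasCompactSupport_normed
    (mollifier n j).contDiff_normed hf

theorem HasCompactSupport.mollify (j : ℕ) (hf : HasCompactSupport f) :
    HasCompactSupport (mollify j f) :=
  HasCompactSupport.convolution _ (mollifier n j).hasCompactSupport_normed hf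

theorem mollify_nonneg (j : ℕ) (hf : 0 ≤ᵐ[volume] f) (x : EuclideanSpace ℝ (Fin n)) :
    0 ≤ mollify j f x := by
  rw [mollify_eq_integral]
  refine integral_nonneg_of_ae ?_
  filter_upwards [(quasiMeasurePreserving_sub_left volume x).ae hf] with t ht
  exact mul_nonneg ((mollifier n j).nonneg_normed t) ht

theorem ae_tendsto_mollify (hf : LocallyIntegrable f volume) :
    ∀ᵐ x, Tendsto (fun j => mollify j f x) atTop (𝓝 (f x)) := by
  have h0 : Tendsto (fun j : ℕ => (2 : ℝ) / (j + 1)) atTop (𝓝 0) := by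
    have := tendsto_one_div_add_atTop_nhds_zero_nat (𝕜 := ℝ)
    simpa [div_eq_mul_inv] using this.const_mul 2
  -- `K` bounds the ratio of outer to inner radius. A bounded ratio makes the kernels comparable to
  -- averages over balls, so that Lebesgue differentiation applies.
  refine ContDiffBump.ae_convolution_tendsto_right_of_locallyIntegrable (K := 2) h0
    (Eventually.of_forall fun j => le_of_eq ?_) hf
  simp only [mollifier]; ring

/-- Young's inequality for a kernel of mass one. Together with almost everywhere convergence, this
absence of norm increase is what forces $L^2$ convergence. -/
theorem eLpNorm_mollify_le (j : ℕ) (hf : AEStronglyMeasurable f volume) :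
    eLpNorm (mollify j f) 2 volume ≤ eLpNorm f 2 volume := by
  rw [mollify_congr j hf.ae_eq_mk, eLpNorm_congr_ae hf.ae_eq_mk]
  set F := hf.mk f
  have hF : Measurable F := hf.stronglyMeasurable_mk.measurable
  set k := (mollifier n j).normed volume with hk
  have hkm : Measurable k := (mollifier n j).continuous_normed.measurable
  have hk1 : ∫⁻ t, ‖k t‖ₑ = 1 := by
    have := ofReal_integral_eq_lintegral_ofReal (μ := volume) (f := k)
      (mollifier n j).integrable_normed (Eventually.of_forall (mollifier n j).nonneg_normed)
    rw [(mollifier n j).integral_normed, ENNReal.ofReal_one] at this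
    rw [this]
    congr 1; ext t
    rw [Real.enorm_eq_ofReal ((mollifier n j).nonneg_normed t)]
  have h := lintegral_sq_lintegral_mul_sub_le (μ := volume) hkm.enorm hF.enorm
  rw [hk1, one_pow, one_mul] at h
  rw [eLpNorm_two_eq_lintegral, eLpNorm_two_eq_lintegral]
  gcongr 1
  refine le_trans (lintegral_mono fun x => ?_) h
  gcongr
  rw [mollify_eq_integral]
  refine (enorm_integral_le_lintegral_enorm _).trans (le_of_eq ?_)
  simp [enorm_mul, hk]

theorem MeasureTheory.MemLp.mollify (j : ℕ) (hf : MemLp f 2 volume) :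
    MemLp (mollify j f) 2 volume :=
  ⟨(contDiff_mollify j (hf.locallyIntegrable one_le_two)).continuous.aestronglyMeasurable,
    (eLpNorm_mollify_le j hf.1).trans_lt hf.2⟩

theorem tendsto_eLpNorm_mollify_sub (hf : MemLp f 2 volume) :
    Tendsto (fun j => eLpNorm (mollify j f - f) 2 volume) atTop (𝓝 0) :=
  tendsto_eLpNorm_sub_of_ae_tendsto (fun j => hf.mollify j) hf
    (ae_tendsto_mollify (hf.locallyIntegrable one_le_two)) fun j => eLpNorm_mollify_le j hf.1

/-- The derivative falls on the kernel, and `t ↦ k (x - t)` is itself a test function; the sign from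
the reflection cancels the sign in the definition of the weak derivative. -/
theorem fderiv_mollify (j : ℕ) (h : IsWeakDeriv i univ f g) (x : EuclideanSpace ℝ (Fin n)) :
    fderiv ℝ (mollify j f) x (EuclideanSpace.single i 1) = mollify j g x := by
  set k := (mollifier n j).normed volume with hk
  have hkc : HasCompactSupport k := (mollifier n j).hasCompactSupport_normed
  have hkd : ContDiff ℝ ∞ k := (mollifier n j).contDiff_normed
  have hfl : LocallyIntegrable f volume := locallyIntegrableOn_univ.1 h.1
  have h1 := (hkc.hasFDerivAt_convolution_left (ContinuousLinearMap.lsmul ℝ ℝ)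
    (hkd.of_le (by simp)) hfl x).fderiv
  have hψ : IsTestFunction univ (fun t => k (x - t)) :=
    ⟨hkd.comp (contDiff_const.sub contDiff_id),
      hkc.comp_homeomorph (Homeomorph.subLeft x), subset_univ _⟩
  have h2 := h.integral_mul_fderiv hψ
  have h3 : ∀ t, fderiv ℝ (fun t => k (x - t)) t (EuclideanSpace.single i 1) =
      - fderiv ℝ k (x - t) (EuclideanSpace.single i 1) := by
    intro t
    have : HasFDerivAt (fun t => k (x - t))
        ((fderiv ℝ k (x - t)).comp (-ContinuousLinearMap.id ℝ _)) t :=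
      ((hkd.differentiable (by simp)) (x - t)).hasFDerivAt.comp t
        ((hasFDerivAt_id t).const_sub x)
    rw [this.fderiv]; simp
  simp only [h3, mul_neg, integral_neg, neg_inj] at h2
  have h4 : mollify j g x = ∫ t, g t * k (x - t) := by
    rw [mollify, convolution_eq_swap]
    simp [mul_comm, hk]
  rw [h4, ← h2, mollify, h1, convolution_eq_swap]
  have hint : Integrable (fun t => ((ContinuousLinearMap.lsmul ℝ ℝ).precompL
      (EuclideanSpace ℝ (Fin n)) (fderiv ℝ k (x - t))) (f t)) volume := by
    have := (HasCompactSupport.convolutionExists_left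
      ((ContinuousLinearMap.lsmul ℝ ℝ).precompL (EuclideanSpace ℝ (Fin n)))
      (hkc.fderiv (𝕜 := ℝ)) (hkd.continuous_fderiv (by simp)) hfl) x
    exact (convolutionExistsAt_iff_integrable_swap).1 this
  rw [ContinuousLinearMap.integral_apply hint]
  congr 1; ext t
  simp [ContinuousLinearMap.precompL_apply, mul_comm]

end Mollify

/-! ## Product rule, chain rule and change of variables for weak derivatives -/

section Calculus

variable {n m : ℕ} {Ω Ω' : Set (EuclideanSpace ℝ (Fin n))}
  {f f' g g' χ ψ ρ : EuclideanSpace ℝ (Fin n) → ℝ} {i : Fin n}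

theorem MemL2loc.memLp_of_hasCompactSupport (hf : MemL2loc univ f) (h : HasCompactSupport f) :
    MemLp f 2 volume := by
  have := hf _ h (subset_univ _)
  rw [← memLp_indicator_iff_restrict h.measurableSet] at this
  rwa [indicator_eq_self.2 (subset_tsupport f)] at this

theorem MemL2loc.testFunction_mul (hf : MemL2loc Ω f) (hχ : IsTestFunction Ω χ) :
    MemLp (fun y => χ y * f y) 2 volume :=
  MemL2loc.memLp_of_hasCompactSupport (hf.mul_of_eventuallyEq_zero hχ.continuous.continuousOn
    fun _ _ hy => notMem_tsupport_iff_eventuallyEq.1 fun h => hy (hχ.3 h)) hχ.2.mul_right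

/-- Localization of a weakly differentiable function by a test function. -/
theorem IsWeakDeriv.testFunction_mul (hf : IsWeakDeriv i Ω f f') (hρ : IsTestFunction Ω ρ) :
    IsWeakDeriv i univ (fun y => ρ y * f y)
      (fun y => fderiv ℝ ρ y (EuclideanSpace.single i 1) * f y + ρ y * f' y) :=
  hf.smooth_mul_of_eventuallyEq_zero isOpen_univ hρ.1.contDiffOn
    fun _ _ hy => notMem_tsupport_iff_eventuallyEq.1 fun h => hy (hρ.3 h)

/-- This removes the auxiliary cutoff `ρ` from integrands that contain `ψ` or its derivative. -/
theorem eq_zero_or_eq_one_of_cutoff (hρ1 : ∀ y ∈ tsupport ψ, ρ =ᶠ[𝓝 y] 1)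
    (e y : EuclideanSpace ℝ (Fin n)) :
    fderiv ℝ ψ y e = 0 ∧ ψ y = 0 ∨ ρ y = 1 ∧ fderiv ℝ ρ y e = 0 := by
  by_cases hy : y ∈ tsupport ψ
  · right
    refine ⟨(hρ1 y hy).eq_of_nhds, ?_⟩
    rw [(hρ1 y hy).fderiv_eq]; simp
  · left
    refine ⟨?_, image_eq_zero_of_notMem_tsupport hy⟩
    rw [(notMem_tsupport_iff_eventuallyEq.1 hy).fderiv_eq]; simp

/-- The product rule for weak derivatives. -/
theorem IsWeakDeriv.mul (hf : IsWeakDeriv i Ω f f') (hg : IsWeakDeriv i Ω g g') (hΩ : IsOpen Ω)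
    (hf2 : MemL2loc Ω f) (hf2' : MemL2loc Ω f') (hg2 : MemL2loc Ω g) (hg2' : MemL2loc Ω g') :
    IsWeakDeriv i Ω (fun y => f y * g y) (fun y => f' y * g y + f y * g' y) := by
  have l1 := hf2.mul_locallyIntegrableOn hg2 hΩ
  have l2 := hf2'.mul_locallyIntegrableOn hg2 hΩ
  have l3 := hf2.mul_locallyIntegrableOn hg2' hΩ
  refine ⟨l1, l2.add l3, fun ψ a b c => ?_⟩
  have hψ : IsTestFunction Ω ψ := ⟨a, b, c⟩
  obtain ⟨ρ, hρ, hρ1, -⟩ := exists_testFunction_eq_one b hΩ c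
  set e := EuclideanSpace.single i (1 : ℝ)
  -- Only one factor is localized and mollified. The product rule with a smooth factor then holds
  -- for each `j`, and each term pairs a mollification with a fixed $L^2$ function, so $L^2$
  -- convergence is enough for the limit.
  set G : EuclideanSpace ℝ (Fin n) → ℝ := fun y => ρ y * g y with hG
  set G' : EuclideanSpace ℝ (Fin n) → ℝ := fun y => fderiv ℝ ρ y e * g y + ρ y * g' y with hG'
  have hGG' : IsWeakDeriv i univ G G' := hg.testFunction_mul hρ
  have hG2 : MemLp G 2 volume := hg2.testFunction_mul hρ
  have hG2' : MemLp G' 2 volume :=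
    (hg2.testFunction_mul (hρ.fderiv_apply e)).add (hg2'.testFunction_mul hρ)
  have hGl := hG2.locallyIntegrable one_le_two
  have hFψ : MemLp (fun y => ψ y * f y) 2 volume := hf2.testFunction_mul hψ
  have hFψ' : MemLp (fun y => fderiv ℝ ψ y e * f y) 2 volume :=
    hf2.testFunction_mul (hψ.fderiv_apply e)
  have hFψ'' : MemLp (fun y => ψ y * f' y) 2 volume := hf2'.testFunction_mul hψ
  have T : ∀ {H K : EuclideanSpace ℝ (Fin n) → ℝ}, MemLp H 2 volume → MemLp K 2 volume →
      Tendsto (fun j => ∫ y, mollify j H y * K y) atTop (𝓝 (∫ y, H y * K y)) := fun hH hK =>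
    tendsto_integral_mul_of_tendsto_eLpNorm (fun j => hH.mollify j) hH
      (tendsto_eLpNorm_mollify_sub hH) (fun _ => hK.1) hK.norm
      (fun _ => Eventually.of_forall fun _ => le_rfl)
      (Eventually.of_forall fun _ => tendsto_const_nhds)
  have hlim := ((T hG2 hFψ').add (T hG2 hFψ'')).add (T hG2' hFψ)
  have hzero : ∀ j, ((∫ y, mollify j G y * (fderiv ℝ ψ y e * f y)) +
      ∫ y, mollify j G y * (ψ y * f' y)) + ∫ y, mollify j G' y * (ψ y * f y) = 0 := by
    intro j
    have h1 := (hf.smooth_mul hΩ (contDiff_mollify j hGl).contDiffOn).integral_mul_fderiv hψ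
    simp only [fderiv_mollify j hGG'] at h1
    have i1 := (hG2'.mollify j).integrable_mul hFψ
    have i2 := (hG2.mollify j).integrable_mul hFψ''
    have e1 := integral_add i1 i2
    simp only [Pi.mul_apply] at e1
    have h2 : ∫ y, (mollify j G' y * f y + mollify j G y * f' y) * ψ y =
        ∫ y, (mollify j G' y * (ψ y * f y) + mollify j G y * (ψ y * f' y)) := by
      congr 1; ext y; ring
    have h3 : ∫ y, mollify j G y * f y * fderiv ℝ ψ y e =
        ∫ y, mollify j G y * (fderiv ℝ ψ y e * f y) := by
      congr 1; ext y; ring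
    rw [h2, h3, e1] at h1
    linarith
  have hfin := tendsto_nhds_unique (hlim.congr hzero) tendsto_const_nhds
  have hsub := eq_zero_or_eq_one_of_cutoff hρ1 e
  have e1 : ∫ y, G y * (fderiv ℝ ψ y e * f y) = ∫ y, f y * g y * fderiv ℝ ψ y e := by
    congr 1; ext y
    rcases hsub y with ⟨h1, h2⟩ | ⟨h1, h2⟩
    · simp [h1]
    · simp only [hG, h1]; ring
  have e2 : ∫ y, G y * (ψ y * f' y) = ∫ y, f' y * g y * ψ y := by
    congr 1; ext y
    rcases hsub y with ⟨h1, h2⟩ | ⟨h1, h2⟩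
    · simp [h2]
    · simp only [hG, h1]; ring
  have e3 : ∫ y, G' y * (ψ y * f y) = ∫ y, f y * g' y * ψ y := by
    congr 1; ext y
    rcases hsub y with ⟨h1, h2⟩ | ⟨h1, h2⟩
    · simp [h2]
    · simp only [hG', h1, h2]; ring
  rw [e1, e2, e3] at hfin
  simp only [add_mul]
  rw [integral_add (l2.integrable_mul_testFunction hψ) (l3.integrable_mul_testFunction hψ)]
  linarith

/-- The function is almost everywhere bounded from below by positive constants on compact
sets. -/
def LocallyUniformlyPos (Ω : Set (EuclideanSpace ℝ (Fin n)))
    (f : EuclideanSpace ℝ (Fin n) → ℝ) : Prop :=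
  ∀ K ⊆ Ω, IsCompact K → ∃ c : ℝ, 0 < c ∧ ∀ᵐ y ∂(volume.restrict K), c ≤ f y

/-- Multiplication with the inverse of a locally uniformly positive function. -/
theorem MemL2loc.inv_mul (hf : AEStronglyMeasurable f (volume.restrict Ω))
    (hpos : LocallyUniformlyPos Ω f) (hg : MemL2loc Ω g) :
    MemL2loc Ω (fun y => (f y)⁻¹ * g y) := by
  intro K hK hKΩ
  obtain ⟨c, hc, hcf⟩ := hpos K hKΩ hK
  refine (hg K hK hKΩ).of_le_mul (c := c⁻¹) ?_ ?_
  · exact (hf.mono_measure (Measure.restrict_mono hKΩ le_rfl)).aemeasurable.inv.aestronglyMeasurable.mul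
      (hg K hK hKΩ).1
  · filter_upwards [hcf] with y hy
    rw [norm_mul, norm_inv, Real.norm_eq_abs, abs_of_pos (hc.trans_le hy)]
    gcongr

/-- The chain rule for the inverse of a locally uniformly positive function. -/
theorem IsWeakDeriv.inv (hf : IsWeakDeriv i Ω f f') (hΩ : IsOpen Ω) (hf2 : MemL2loc Ω f)
    (hf2' : MemL2loc Ω f') (hpos : LocallyUniformlyPos Ω f) :
    IsWeakDeriv i Ω (fun y => (f y)⁻¹) (fun y => -((f y)⁻¹ * ((f y)⁻¹ * f' y))) := by
  have hfm : AEStronglyMeasurable f (volume.restrict Ω) := hf.1.aestronglyMeasurable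
  have l1 : LocallyIntegrableOn (fun y => (f y)⁻¹) Ω volume := by
    simpa using (MemL2loc.inv_mul hfm hpos (continuousOn_const (c := (1 : ℝ))).memL2loc).locallyIntegrableOn hΩ
  have l2 : LocallyIntegrableOn (fun y => -((f y)⁻¹ * ((f y)⁻¹ * f' y))) Ω volume :=
    ((MemL2loc.inv_mul hfm hpos (MemL2loc.inv_mul hfm hpos hf2')).locallyIntegrableOn hΩ).neg
  refine ⟨l1, l2, fun ψ a b c => ?_⟩
  have hψ : IsTestFunction Ω ψ := ⟨a, b, c⟩
  obtain ⟨ρ, hρ, hρ1, hρ01⟩ := exists_testFunction_eq_one b hΩ c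
  obtain ⟨r, hr, hrf⟩ := hpos _ hρ.3 hρ.2
  set e := EuclideanSpace.single i (1 : ℝ)
  -- Subtracting the lower bound `r` first makes the localized function nonnegative, so that `r`
  -- plus its mollification is a smooth function which is at least `r` everywhere. Where `ρ = 1`,
  -- its limit is `f`.
  have hfr : IsWeakDeriv i Ω (fun y => f y - r) f' := by
    have := hf.add (isWeakDeriv_of_contDiffOn (f := fun _ => -r) hΩ contDiffOn_const i)
    simpa [sub_eq_add_neg] using this
  have hfr2 : MemL2loc Ω (fun y => f y - r) := by
    simpa [sub_eq_add_neg] using hf2.add (continuousOn_const (c := -r)).memL2loc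
  set H : EuclideanSpace ℝ (Fin n) → ℝ := fun y => ρ y * (f y - r) with hH
  set H' : EuclideanSpace ℝ (Fin n) → ℝ :=
    fun y => fderiv ℝ ρ y e * (f y - r) + ρ y * f' y with hH'
  have hHH' : IsWeakDeriv i univ H H' := hfr.testFunction_mul hρ
  have hH2 : MemLp H 2 volume := hfr2.testFunction_mul hρ
  have hH2' : MemLp H' 2 volume :=
    (hfr2.testFunction_mul (hρ.fderiv_apply e)).add (hf2'.testFunction_mul hρ)
  have hHl := hH2.locallyIntegrable one_le_two
  have hHpos : 0 ≤ᵐ[volume] H := by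
    filter_upwards [(ae_restrict_iff' hρ.2.measurableSet).1 hrf] with y hy
    by_cases h : y ∈ tsupport ρ
    · exact mul_nonneg (hρ01 y).1 (sub_nonneg.2 (hy h))
    · simp [hH, image_eq_zero_of_notMem_tsupport h]
  set v : ℕ → EuclideanSpace ℝ (Fin n) → ℝ := fun j y => r + mollify j H y with hv
  have hvpos : ∀ j y, r ≤ v j y := fun j y => by
    simpa [hv] using mollify_nonneg j hHpos y
  have hvd : ∀ j, ContDiff ℝ ∞ (v j) := fun j => contDiff_const.add (contDiff_mollify j hHl)
  have hvlim : ∀ᵐ y, Tendsto (fun j => (v j y)⁻¹) atTop (𝓝 (r + H y)⁻¹) := by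
    filter_upwards [ae_tendsto_mollify hHl, hHpos] with y hy hy0
    refine (hy.const_add r).inv₀ ?_
    have : (0 : ℝ) ≤ H y := hy0
    positivity
  have hvle : ∀ j y, ‖(v j y)⁻¹‖ ≤ r⁻¹ := fun j y => by
    rw [norm_inv, Real.norm_eq_abs, abs_of_pos (hr.trans_le (hvpos j y))]
    gcongr
    exact hvpos j y
  have hvm : ∀ j, AEStronglyMeasurable (fun y => (v j y)⁻¹) volume := fun j =>
    ((hvd j).continuous.inv₀ fun y => (hr.trans_le (hvpos j y)).ne').aestronglyMeasurable
  have hzero : ∀ j, ∫ y, (v j y)⁻¹ * fderiv ℝ ψ y e =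
      ∫ y, mollify j H' y * ((v j y)⁻¹ * (v j y)⁻¹ * ψ y) := by
    intro j
    have h0 : ∀ y, v j y ≠ 0 := fun y => (hr.trans_le (hvpos j y)).ne'
    have h1 := (isWeakDeriv_of_contDiffOn hΩ
      (((hvd j).inv h0).of_le (by simp)).contDiffOn i).integral_mul_fderiv hψ
    refine h1.trans ?_
    rw [← integral_neg]
    congr 1; ext y
    have hd : HasFDerivAt (v j) (fderiv ℝ (v j) y) y :=
      ((hvd j).differentiable (by simp) y).hasFDerivAt
    have e1 : fderiv ℝ (v j) y e = mollify j H' y := by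
      rw [← fderiv_mollify j hHH', hv]
      simp [e]
    have e2 : fderiv ℝ (v j)⁻¹ y e = -((v j y) ^ 2)⁻¹ * fderiv ℝ (v j) y e := by
      have h : fderiv ℝ (v j)⁻¹ y = -((v j y) ^ 2)⁻¹ • fderiv ℝ (v j) y :=
        ((hasDerivAt_inv (h0 y)).comp_hasFDerivAt y hd).fderiv
      rw [h]; simp
    change -(fderiv ℝ (v j)⁻¹ y e * ψ y) = _
    rw [e2, e1]
    field_simp
  have lim1 : Tendsto (fun j => ∫ y, (v j y)⁻¹ * fderiv ℝ ψ y e) atTop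
      (𝓝 (∫ y, (r + H y)⁻¹ * fderiv ℝ ψ y e)) := by
    have hint : Integrable (fun y => fderiv ℝ ψ y e) volume :=
      (hψ.fderiv_apply e).continuous.integrable_of_hasCompactSupport (hψ.fderiv_apply e).2
    refine tendsto_integral_of_dominated_convergence (fun y => r⁻¹ * ‖fderiv ℝ ψ y e‖)
      (fun j => (hvm j).mul hint.1) (hint.norm.const_mul _) (fun j => Eventually.of_forall fun y => ?_)
      (hvlim.mono fun y hy => hy.mul_const _)
    rw [norm_mul]
    exact mul_le_mul_of_nonneg_right (hvle j y) (norm_nonneg _)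
  -- The derivative converges in $L^2$ only; the inverses converge almost everywhere with the
  -- uniform bound $r^{-1}$.
  have lim2 : Tendsto (fun j => ∫ y, mollify j H' y * ((v j y)⁻¹ * (v j y)⁻¹ * ψ y)) atTop
      (𝓝 (∫ y, H' y * ((r + H y)⁻¹ * (r + H y)⁻¹ * ψ y))) := by
    have hψ2 : MemLp ψ 2 volume := a.continuous.memLp_of_hasCompactSupport b
    refine tendsto_integral_mul_of_tendsto_eLpNorm (fun j => hH2'.mollify j) hH2'
      (tendsto_eLpNorm_mollify_sub hH2') (fun j => ((hvm j).mul (hvm j)).mul hψ2.1)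
      (hψ2.norm.const_mul (r⁻¹ * r⁻¹)) (fun j => Eventually.of_forall fun y => ?_)
      (hvlim.mono fun y hy => (hy.mul hy).mul_const _)
    rw [norm_mul, norm_mul]
    gcongr
    · exact hvle j y
    · exact hvle j y
  have hfin := tendsto_nhds_unique lim1 (lim2.congr fun j => (hzero j).symm)
  have hsub := eq_zero_or_eq_one_of_cutoff hρ1 e
  rw [← integral_neg]
  convert hfin using 2
  · ext y
    rcases hsub y with ⟨h1, h2⟩ | ⟨h1, h2⟩
    · simp [h1]
    · simp [hH, h1]
  · ext y
    rcases hsub y with ⟨h1, h2⟩ | ⟨h1, h2⟩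
    · simp [h2]
    · simp only [hH, hH', h1, h2]; ring_nf

/-! ### Change of variables -/

variable {Φ Ψ : EuclideanSpace ℝ (Fin n) → EuclideanSpace ℝ (Fin n)}

/-- A smooth diffeomorphism between open sets has locally bounded distortion of volume. -/
theorem exists_map_restrict_le (hΩ : IsOpen Ω) (hΦ : ContDiffOn ℝ ∞ Φ Ω')
    (hΨ : ContDiffOn ℝ ∞ Ψ Ω) (hΦΩ : MapsTo Φ Ω' Ω) (hl : ∀ y ∈ Ω', Ψ (Φ y) = y)
    {K : Set (EuclideanSpace ℝ (Fin n))} (hK : IsCompact K) (hKΩ : K ⊆ Ω') :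
    ∃ C : ENNReal, C ≠ 0 ∧ C ≠ ⊤ ∧
      (volume.restrict K).map Φ ≤ C • volume.restrict (Φ '' K) := by
  have hΦK : ContinuousOn Φ K := hΦ.continuousOn.mono hKΩ
  have hK2 : IsCompact (Φ '' K) := hK.image_of_continuousOn hΦK
  have hK2Ω : Φ '' K ⊆ Ω := (hΦΩ.mono_left hKΩ).image_subset
  have hd : ContinuousOn (fun x => |(fderiv ℝ Ψ x).det|) (Φ '' K) :=
    (ContinuousLinearMap.continuous_det.comp_continuousOn
      ((hΨ.continuousOn_fderiv_of_isOpen hΩ (by simp)).mono hK2Ω)).abs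
  obtain ⟨C, hC⟩ := hK2.exists_bound_of_continuousOn hd
  -- The maximum with `1` makes the constant nonzero, which scaling $L^2$ norms by it will require.
  refine ⟨ENNReal.ofReal (max C 1), by simp, by simp, ?_⟩
  refine Measure.le_iff.2 fun S hS => ?_
  have hm : AEMeasurable Φ (volume.restrict K) := hΦK.aemeasurable hK.measurableSet
  rw [Measure.map_apply_of_aemeasurable hm hS, Measure.smul_apply, Measure.restrict_apply hS]
  -- Written as an image under `Ψ`, the preimage has volume given by the change of variables
  -- formula, with the Jacobian of `Ψ` bounded on the compact set `Φ '' K`.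
  have hin : Φ ⁻¹' S ∩ K = Ψ '' (S ∩ Φ '' K) := by
    ext y
    constructor
    · rintro ⟨hyS, hyK⟩
      exact ⟨Φ y, ⟨hyS, mem_image_of_mem _ hyK⟩, hl y (hKΩ hyK)⟩
    · rintro ⟨_, ⟨hxS, y', hy', rfl⟩, rfl⟩
      rw [hl y' (hKΩ hy')]
      exact ⟨hxS, hy'⟩
  have hmeas : MeasurableSet (S ∩ Φ '' K) := hS.inter hK2.measurableSet
  have hinj : InjOn Ψ (S ∩ Φ '' K) := by
    rintro _ ⟨-, y, hy, rfl⟩ _ ⟨-, z, hz, rfl⟩ h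
    rw [hl y (hKΩ hy), hl z (hKΩ hz)] at h
    rw [h]
  have hder : ∀ x ∈ S ∩ Φ '' K, HasFDerivWithinAt Ψ (fderiv ℝ Ψ x) (S ∩ Φ '' K) x :=
    fun x hx => ((hΨ.contDiffAt (hΩ.mem_nhds (hK2Ω hx.2))).differentiableAt
      (by simp)).hasFDerivAt.hasFDerivWithinAt
  have hle : volume (Φ ⁻¹' S ∩ K) ≤ ENNReal.ofReal (max C 1) * volume (S ∩ Φ '' K) := by
    rw [hin, ← lintegral_abs_det_fderiv_eq_addHaar_image volume hmeas hder hinj]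
    calc ∫⁻ x in S ∩ Φ '' K, ENNReal.ofReal |(fderiv ℝ Ψ x).det|
        ≤ ∫⁻ _ in S ∩ Φ '' K, ENNReal.ofReal (max C 1) := by
          refine setLIntegral_mono measurable_const fun x hx => ENNReal.ofReal_le_ofReal ?_
          have := hC x hx.2
          rw [Real.norm_eq_abs, abs_abs] at this
          exact this.trans (le_max_left _ _)
      _ = _ := by simp
  refine le_trans ?_ hle
  rw [Measure.restrict_apply₀' hK.measurableSet.nullMeasurableSet]

theorem MemL2loc.comp_diffeo (hf : MemL2loc Ω f) (hΩ : IsOpen Ω)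
    (hΦ : ContDiffOn ℝ ∞ Φ Ω') (hΨ : ContDiffOn ℝ ∞ Ψ Ω) (hΦΩ : MapsTo Φ Ω' Ω)
    (hl : ∀ y ∈ Ω', Ψ (Φ y) = y) : MemL2loc Ω' (fun y => f (Φ y)) := by
  intro K hK hKΩ
  obtain ⟨C, hC0, hC, hle⟩ := exists_map_restrict_le hΩ hΦ hΨ hΦΩ hl hK hKΩ
  have hΦK : ContinuousOn Φ K := hΦ.continuousOn.mono hKΩ
  have h1 := hf _ (hK.image_of_continuousOn hΦK) (hΦΩ.mono_left hKΩ).image_subset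
  exact ((h1.smul_measure hC).mono_measure hle).comp_of_map (hΦK.aemeasurable hK.measurableSet)

/-- The chain rule is classical for the mollifications of the localized function. The volume
distortion bound turns their $L^2$ convergence into $L^2$ convergence after composition with `Φ` on
the support of the test function. -/
theorem IsWeakDeriv.comp_diffeo {F : Fin n → EuclideanSpace ℝ (Fin n) → ℝ}
    (hF : ∀ l, IsWeakDeriv l Ω f (F l)) (hf2 : MemL2loc Ω f) (hF2 : ∀ l, MemL2loc Ω (F l))
    (hΩ : IsOpen Ω) (hΩ' : IsOpen Ω') (hΦ : ContDiffOn ℝ ∞ Φ Ω') (hΨ : ContDiffOn ℝ ∞ Ψ Ω)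
    (hΦΩ : MapsTo Φ Ω' Ω) (hl : ∀ y ∈ Ω', Ψ (Φ y) = y) (i : Fin n) :
    IsWeakDeriv i Ω' (fun y => f (Φ y))
      (fun y => ∑ l, fderiv ℝ (fun z => Φ z l) y (EuclideanSpace.single i 1) * F l (Φ y)) := by
  have hΦl : ∀ l, ContDiffOn ℝ ∞ (fun z => Φ z l) Ω' := fun l => (contDiffOn_piLp 2).1 hΦ l
  have hD : ∀ l, ContinuousOn
      (fun y => fderiv ℝ (fun z => Φ z l) y (EuclideanSpace.single i 1)) Ω' :=
    fun l => ((hΦl l).fderiv_apply_const hΩ' _).continuousOn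
  have m1 : MemL2loc Ω' (fun y => f (Φ y)) := hf2.comp_diffeo hΩ hΦ hΨ hΦΩ hl
  have m2 : ∀ l, LocallyIntegrableOn
      (fun y => fderiv ℝ (fun z => Φ z l) y (EuclideanSpace.single i 1) * F l (Φ y)) Ω' volume :=
    fun l => ((((hF2 l).comp_diffeo hΩ hΦ hΨ hΦΩ hl).locallyIntegrableOn
      hΩ').mul_of_eventuallyEq_zero hΩ' (hD l) fun _ h h' => (h' h).elim)
  have m3 : LocallyIntegrableOn (fun y => ∑ l,
      fderiv ℝ (fun z => Φ z l) y (EuclideanSpace.single i 1) * F l (Φ y)) Ω' volume := by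
    rw [locallyIntegrableOn_iff hΩ'.isLocallyClosed]
    intro K hK hKc
    exact integrable_finsetSum _ fun l _ => (m2 l).integrableOn_compact_subset hK hKc
  refine ⟨m1.locallyIntegrableOn hΩ', m3, fun ψ a b c => ?_⟩
  have hψ : IsTestFunction Ω' ψ := ⟨a, b, c⟩
  set e := EuclideanSpace.single i (1 : ℝ)
  set K := tsupport ψ with hKdef
  have hK : IsCompact K := b
  have hΦK : ContinuousOn Φ K := hΦ.continuousOn.mono c
  have hmΦ : AEMeasurable Φ (volume.restrict K) := hΦK.aemeasurable hK.measurableSet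
  obtain ⟨C, hC0, hC, hle⟩ := exists_map_restrict_le hΩ hΦ hΨ hΦΩ hl hK c
  obtain ⟨ρ, hρ, hρ1, -⟩ := exists_testFunction_eq_one (hK.image_of_continuousOn hΦK) hΩ
    (hΦΩ.mono_left c).image_subset
  set H : EuclideanSpace ℝ (Fin n) → ℝ := fun y => ρ y * f y with hH
  set H' : Fin n → EuclideanSpace ℝ (Fin n) → ℝ :=
    fun l y => fderiv ℝ ρ y (EuclideanSpace.single l 1) * f y + ρ y * F l y with hH'
  have hHH' : ∀ l, IsWeakDeriv l univ H (H' l) := fun l => (hF l).testFunction_mul hρ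
  have hH2 : MemLp H 2 volume := hf2.testFunction_mul hρ
  have hH2' : ∀ l, MemLp (H' l) 2 volume := fun l =>
    (hf2.testFunction_mul (hρ.fderiv_apply _)).add ((hF2 l).testFunction_mul hρ)
  have hHl := hH2.locallyIntegrable one_le_two
  have comp : ∀ {P : EuclideanSpace ℝ (Fin n) → ℝ}, MemLp P 2 volume →
      MemLp (fun y => P (Φ y)) 2 (volume.restrict K) := fun hP =>
    (((hP.mono_measure Measure.restrict_le_self).smul_measure hC).mono_measure hle).comp_of_map hmΦ
  have T : ∀ {P q : EuclideanSpace ℝ (Fin n) → ℝ}, MemLp P 2 volume → ContinuousOn q K →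
      Tendsto (fun j => ∫ y in K, mollify j P (Φ y) * q y) atTop
        (𝓝 (∫ y in K, P (Φ y) * q y)) := by
    intro P q hP hq
    have hq2 : MemLp q 2 (volume.restrict K) := hq.memL2loc K hK le_rfl
    refine tendsto_integral_mul_of_tendsto_eLpNorm (fun j => comp (hP.mollify j)) (comp hP) ?_
      (fun _ => hq2.1) hq2.norm (fun _ => Eventually.of_forall fun _ => le_rfl)
      (Eventually.of_forall fun _ => tendsto_const_nhds)
    have h0 : Tendsto (fun j => C ^ (1 / (2 : ENNReal)).toReal * eLpNorm (mollify j P - P) 2 volume)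
        atTop (𝓝 0) := by
      have := ENNReal.Tendsto.const_mul (tendsto_eLpNorm_mollify_sub hP)
        (Or.inr (ENNReal.rpow_ne_top_of_nonneg (y := (1 / (2 : ENNReal)).toReal) (by simp) hC))
      simpa using this
    refine tendsto_of_tendsto_of_tendsto_of_le_of_le tendsto_const_nhds h0 (fun _ => zero_le)
      fun j => ?_
    have hPm : MemLp (mollify j P - P) 2 volume := (hP.mollify j).sub hP
    have hPmap : MemLp (mollify j P - P) 2 ((volume.restrict K).map Φ) :=
      ((hPm.mono_measure Measure.restrict_le_self).smul_measure hC).mono_measure hle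
    calc eLpNorm ((fun y => mollify j P (Φ y)) - fun y => P (Φ y)) 2 (volume.restrict K)
        = eLpNorm (mollify j P - P) 2 ((volume.restrict K).map Φ) :=
          (eLpNorm_map_measure hPmap.1 hmΦ).symm
      _ ≤ eLpNorm (mollify j P - P) 2 (C • volume.restrict (Φ '' K)) :=
          eLpNorm_mono_measure _ hle
      _ = C ^ (1 / (2 : ENNReal)).toReal *
            eLpNorm (mollify j P - P) 2 (volume.restrict (Φ '' K)) := by
          rw [eLpNorm_smul_measure_of_ne_zero hC0, smul_eq_mul]
      _ ≤ _ := by gcongr; exact Measure.restrict_le_self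
  have cq : ContinuousOn (fun y => fderiv ℝ ψ y e) K :=
    (hψ.fderiv_apply e).continuous.continuousOn
  have cq' : ∀ l, ContinuousOn (fun y => fderiv ℝ (fun z => Φ z l) y e * ψ y) K := fun l =>
    ((hD l).mono c).mul hψ.continuous.continuousOn
  have toK : ∀ P : EuclideanSpace ℝ (Fin n) → ℝ, (∀ y, y ∉ K → P y = 0) →
      ∫ y, P y = ∫ y in K, P y := fun P hP => (setIntegral_eq_integral_of_forall_compl_eq_zero hP).symm
  have z1 : ∀ y, y ∉ K → ψ y = 0 := fun y hy => image_eq_zero_of_notMem_tsupport hy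
  have z2 : ∀ y, y ∉ K → fderiv ℝ ψ y e = 0 := fun y hy => by
    rw [(notMem_tsupport_iff_eventuallyEq.1 hy).fderiv_eq]; simp
  have hsplit : ∀ {P : Fin n → EuclideanSpace ℝ (Fin n) → ℝ}, (∀ l, MemLp (P l) 2 volume) →
      ∫ y, (∑ l, fderiv ℝ (fun z => Φ z l) y e * P l (Φ y)) * ψ y =
        ∑ l, ∫ y in K, P l (Φ y) * (fderiv ℝ (fun z => Φ z l) y e * ψ y) := by
    intro P hP
    rw [toK _ fun y hy => by rw [z1 y hy, mul_zero], ← integral_finsetSum]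
    · congr 1; ext y; rw [Finset.sum_mul]
      exact Finset.sum_congr rfl fun l _ => by ring
    · intro l _
      exact (comp (hP l)).integrable_mul ((cq' l).memL2loc K hK le_rfl)
  have hj : ∀ j, ∫ y in K, mollify j H (Φ y) * fderiv ℝ ψ y e =
      - ∑ l, ∫ y in K, mollify j (H' l) (Φ y) * (fderiv ℝ (fun z => Φ z l) y e * ψ y) := by
    intro j
    have hcd : ContDiffOn ℝ ∞ (fun y => mollify j H (Φ y)) Ω' :=
      (contDiff_mollify j hHl).comp_contDiffOn hΦ
    have h1 := (isWeakDeriv_of_contDiffOn hΩ' (hcd.of_le (by simp)) i).integral_mul_fderiv hψ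
    rw [← hsplit fun l => (hH2' l).mollify j, ← toK _ fun y hy => by rw [z2 y hy, mul_zero]]
    refine h1.trans ?_
    congr 2; ext y
    by_cases hy : y ∈ K
    swap
    · rw [z1 y hy, mul_zero, mul_zero]
    congr 1
    have hdΦ : HasFDerivAt Φ (fderiv ℝ Φ y) y :=
      ((hΦ.contDiffAt (hΩ'.mem_nhds (c hy))).differentiableAt (by simp)).hasFDerivAt
    have hdm : HasFDerivAt (mollify j H) (fderiv ℝ (mollify j H) (Φ y)) (Φ y) :=
      ((contDiff_mollify j hHl).differentiable (by simp) _).hasFDerivAt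
    have e1 : fderiv ℝ (fun y => mollify j H (Φ y)) y e =
        fderiv ℝ (mollify j H) (Φ y) (fderiv ℝ Φ y e) := by
      exact congrArg (fun L => L e) (hdm.comp y hdΦ).fderiv
    have e2 : ∀ l, fderiv ℝ (fun z => Φ z l) y e = (fderiv ℝ Φ y e) l := by
      intro l
      exact congrArg (fun L => L e)
        ((EuclideanSpace.proj (𝕜 := ℝ) l).hasFDerivAt.comp y hdΦ).fderiv
    have e3 : fderiv ℝ Φ y e =
        ∑ l, (fderiv ℝ Φ y e) l • EuclideanSpace.single l (1 : ℝ) := by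
      have := (EuclideanSpace.basisFun (Fin n) ℝ).sum_repr (fderiv ℝ Φ y e)
      simpa using this.symm
    change fderiv ℝ (fun y => mollify j H (Φ y)) y e = _
    rw [e1, e3, map_sum]
    refine Finset.sum_congr rfl fun l _ => ?_
    rw [map_smul, fderiv_mollify j (hHH' l), smul_eq_mul, e2]
  have hfin := tendsto_nhds_unique (T hH2 cq) (((tendsto_finsetSum Finset.univ
    fun l _ => T (hH2' l) (cq' l)).neg).congr fun j => (hj j).symm)
  rw [← hsplit hH2', ← toK _ fun y hy => by rw [z2 y hy, mul_zero]] at hfin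
  have hρK : ∀ y ∈ K, ρ =ᶠ[𝓝 (Φ y)] 1 := fun y hy => hρ1 _ (mem_image_of_mem _ hy)
  convert hfin using 2
  · ext y
    by_cases hy : y ∈ K
    · simp [hH, (hρK y hy).eq_of_nhds]
    · rw [z2 y hy, mul_zero, mul_zero]
  · congr 1; ext y
    by_cases hy : y ∈ K
    · simp [hH', (hρK y hy).eq_of_nhds, (hρK y hy).fderiv_eq]
    · rw [z1 y hy, mul_zero, mul_zero]

/-- Functions of class `H¹` are invariant under diffeomorphisms. -/
theorem MemHloc.comp_diffeo (hf : MemHloc 1 Ω f) (hΩ : IsOpen Ω) (hΩ' : IsOpen Ω')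
    (hΦ : ContDiffOn ℝ ∞ Φ Ω') (hΨ : ContDiffOn ℝ ∞ Ψ Ω) (hΦΩ : MapsTo Φ Ω' Ω)
    (hl : ∀ y ∈ Ω', Ψ (Φ y) = y) : MemHloc 1 Ω' (fun y => f (Φ y)) := by
  have hF : ∀ l, MemHloc 0 Ω (_root_.weakDeriv l Ω f) := fun l => hf.weakDeriv hΩ l
  refine ⟨hf.1.comp_diffeo hΩ hΦ hΨ hΦΩ hl, fun i => ⟨_, IsWeakDeriv.comp_diffeo
    (fun l => hf.isWeakDeriv l) hf.1 (fun l => (hF l).memL2loc) hΩ hΩ' hΦ hΨ hΦΩ hl i, ?_⟩⟩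
  refine MemHloc.sum _ hΩ' fun l _ => MemHloc.smooth_mul ?_ hΩ'
    (((contDiffOn_piLp 2).1 hΦ l).fderiv_apply_const hΩ' _)
  exact MemL2loc.comp_diffeo (hF l) hΩ hΦ hΨ hΦΩ hl

end Calculus

/-! ## The Sobolev multiplication theorem -/

section FourierWeights

open scoped SchwartzMap FourierTransform LineDeriv

variable {n : ℕ}

/-- The weight `1 + |ξ|²`. -/
noncomputable def japaneseWeight (ξ : EuclideanSpace ℝ (Fin n)) : ENNReal :=
  ENNReal.ofReal (1 + ‖ξ‖ ^ 2)

theorem japaneseWeight_ne_zero (ξ : EuclideanSpace ℝ (Fin n)) : japaneseWeight ξ ≠ 0 := by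
  have : 0 < 1 + ‖ξ‖ ^ 2 := by positivity
  simpa [japaneseWeight] using this

theorem japaneseWeight_ne_top (ξ : EuclideanSpace ℝ (Fin n)) : japaneseWeight ξ ≠ ⊤ :=
  ENNReal.ofReal_ne_top

theorem measurable_japaneseWeight : Measurable (japaneseWeight (n := n)) := by
  unfold japaneseWeight; fun_prop

/-- The square of the `Hᵃ` norm of a Schwartz function, in terms of its Fourier transform. -/
noncomputable def fourierSobolevSq (a : ℕ) (u : 𝓢(EuclideanSpace ℝ (Fin n), ℂ)) : ENNReal :=
  ∫⁻ ξ, japaneseWeight ξ ^ a * ‖𝓕⁻ u ξ‖ₑ ^ 2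

theorem lintegral_enorm_sq_fourier (p : 𝓢(EuclideanSpace ℝ (Fin n), ℂ)) :
    ∫⁻ ξ, ‖𝓕 p ξ‖ₑ ^ 2 = ∫⁻ y, ‖p y‖ₑ ^ 2 := by
  have key : ∀ q : 𝓢(EuclideanSpace ℝ (Fin n), ℂ),
      ∫⁻ y, ‖q y‖ₑ ^ 2 = ENNReal.ofReal (∫ y, ‖q y‖ ^ 2) := by
    intro q
    have hq : MemLp q 2 volume := q.memLp 2 volume
    rw [ofReal_integral_eq_lintegral_ofReal hq.norm.integrable_sq
      (Eventually.of_forall fun y => sq_nonneg _)]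
    congr 1; ext y
    rw [← ofReal_norm, ENNReal.ofReal_pow (norm_nonneg _)]
  rw [key, key, SchwartzMap.integral_norm_sq_fourier]

theorem fourierSobolevSq_zero (u : 𝓢(EuclideanSpace ℝ (Fin n), ℂ)) :
    fourierSobolevSq 0 u = ∫⁻ y, ‖u y‖ₑ ^ 2 := by
  have := lintegral_enorm_sq_fourier (𝓕⁻ u)
  rw [FourierTransform.fourier_fourierInv_eq] at this
  simp [fourierSobolevSq, this]

/-- One factor of the weight is $1+\sum_i\xi_i^2$, and $\partial_i$ becomes multiplication by $\mp
2\pi\mathrm i\,\xi_i$, of modulus at least $|\xi_i|$. Iteration controls the weighted norm by $L^2$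
norms of derivatives. -/
theorem fourierSobolevSq_succ_le (a : ℕ) (u : 𝓢(EuclideanSpace ℝ (Fin n), ℂ)) :
    fourierSobolevSq (a + 1) u ≤ fourierSobolevSq a u +
      ∑ i : Fin n, fourierSobolevSq a (∂_{EuclideanSpace.single i (1 : ℝ)} u) := by
  have hm : ∀ q : 𝓢(EuclideanSpace ℝ (Fin n), ℂ),
      Measurable fun ξ => japaneseWeight ξ ^ a * ‖𝓕⁻ q ξ‖ₑ ^ 2 := fun q =>
    (measurable_japaneseWeight.pow_const _).mul
      ((𝓕⁻ q).continuous.measurable.enorm.pow_const _)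
  unfold fourierSobolevSq
  rw [← lintegral_finsetSum _ fun i _ => hm _, ← lintegral_add_left (hm u)]
  refine lintegral_mono fun ξ => ?_
  have h1 : ∀ i : Fin n, ‖ENNReal.ofReal (ξ i ^ 2)‖ₑ * ‖𝓕⁻ u ξ‖ₑ ^ 2 ≤
      ‖𝓕⁻ (∂_{EuclideanSpace.single i (1 : ℝ)} u) ξ‖ₑ ^ 2 := by
    intro i
    have ht : (inner ℝ · (EuclideanSpace.single i (1 : ℝ)) :
      EuclideanSpace ℝ (Fin n) → ℝ).HasTemperateGrowth := by fun_prop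
    rw [SchwartzMap.fourierInv_lineDerivOp_eq]
    simp only [smul_apply, SchwartzMap.smulLeftCLM_apply_apply ht]
    have e : inner ℝ ξ (EuclideanSpace.single i (1 : ℝ)) = ξ i := by
      simp [EuclideanSpace.inner_single_right]
    rw [e, enorm_smul, enorm_smul, mul_pow, mul_pow, ← mul_assoc, enorm_eq_self]
    gcongr
    have e1 : ‖ξ i‖ₑ ^ 2 = ENNReal.ofReal (ξ i ^ 2) := by
      rw [← ofReal_norm, ← ENNReal.ofReal_pow (norm_nonneg _)]
      simp
    rw [← e1]
    refine le_mul_of_one_le_left zero_le ?_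
    have e2 : (1 : ENNReal) ≤ ‖-(2 * (Real.pi : ℂ) * Complex.I)‖ₑ := by
      rw [← ofReal_norm, ← ENNReal.ofReal_one]
      refine ENNReal.ofReal_le_ofReal ?_
      simp only [norm_neg, norm_mul, Complex.norm_I, Complex.norm_real, Complex.norm_ofNat]
      rw [Real.norm_eq_abs, abs_of_pos Real.pi_pos]
      linarith [Real.pi_gt_three]
    exact one_le_pow₀ e2
  have h2 : japaneseWeight ξ = 1 + ∑ i, ENNReal.ofReal (ξ i ^ 2) := by
    rw [japaneseWeight, ENNReal.ofReal_add zero_le_one (by positivity), EuclideanSpace.norm_sq_eq,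
      ENNReal.ofReal_sum_of_nonneg fun i _ => by positivity]
    simp
  calc japaneseWeight ξ ^ (a + 1) * ‖𝓕⁻ u ξ‖ₑ ^ 2
      = japaneseWeight ξ ^ a * ‖𝓕⁻ u ξ‖ₑ ^ 2 +
        ∑ i, japaneseWeight ξ ^ a * (‖ENNReal.ofReal (ξ i ^ 2)‖ₑ * ‖𝓕⁻ u ξ‖ₑ ^ 2) := by
        rw [← Finset.mul_sum, ← Finset.sum_mul, pow_succ]
        nth_rewrite 2 [h2]
        simp only [enorm_eq_self]
        ring
    _ ≤ _ := by
        gcongr with i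
        exact h1 i

theorem lintegral_japaneseWeight_rpow_lt_top {s : ℕ} (hs : n < 2 * s) :
    ∫⁻ ξ : EuclideanSpace ℝ (Fin n), japaneseWeight ξ ^ (-(s : ℝ)) < ⊤ := by
  have h := integrable_rpow_neg_one_add_norm_sq (E := EuclideanSpace ℝ (Fin n)) (μ := volume)
    (r := 2 * s) (by simp; exact_mod_cast hs)
  have h2 := h.lintegral_lt_top
  refine lt_of_le_of_lt (le_of_eq ?_) h2
  congr 1; ext ξ
  rw [japaneseWeight, ENNReal.ofReal_rpow_of_pos (by positivity)]
  congr 2; ring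

theorem japaneseWeight_mono {x y : EuclideanSpace ℝ (Fin n)} (h : ‖x‖ ≤ ‖y‖) :
    japaneseWeight x ≤ japaneseWeight y := by
  unfold japaneseWeight; gcongr

/-- Young's inequality with a weight. -/
theorem lintegral_sq_weighted_convolution_le {s : ℕ} {P Q : EuclideanSpace ℝ (Fin n) → ENNReal}
    (hP : Measurable P) (hQ : Measurable Q) :
    ∫⁻ x, (∫⁻ y, (japaneseWeight y ^ (-(s : ℝ) / 2) * P y) * Q (x - y)) ^ 2 ≤
      (∫⁻ ξ : EuclideanSpace ℝ (Fin n), japaneseWeight ξ ^ (-(s : ℝ))) *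
        (∫⁻ y, P y ^ 2) * ∫⁻ y, Q y ^ 2 := by
  have hw : ∀ t : ℝ, Measurable fun y : EuclideanSpace ℝ (Fin n) => japaneseWeight y ^ t :=
    fun t => measurable_japaneseWeight.pow_const _
  refine (lintegral_sq_lintegral_mul_sub_le ((hw _).mul hP) hQ).trans ?_
  gcongr
  -- Cauchy–Schwarz bounds the $L^1$ norm of $w^{-s/2}P$ by $L^2$ norms. The integrand is written as
  -- $w^{-s}\cdot(w^{s/2}P)$ to fit the weighted form.
  have h := sq_lintegral_mul_le (μ := volume) (hw (-(s : ℝ))) ((hw ((s : ℝ) / 2)).mul hP)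
  simp only [Pi.mul_apply] at h
  have e1 : ∀ y : EuclideanSpace ℝ (Fin n),
      japaneseWeight y ^ (-(s : ℝ)) * (japaneseWeight y ^ ((s : ℝ) / 2) * P y) =
        japaneseWeight y ^ (-(s : ℝ) / 2) * P y := by
    intro y
    rw [← mul_assoc, ← ENNReal.rpow_add _ _ (japaneseWeight_ne_zero y) (japaneseWeight_ne_top y)]
    congr 2; ring
  have e2 : ∀ y : EuclideanSpace ℝ (Fin n),
      japaneseWeight y ^ (-(s : ℝ)) * (japaneseWeight y ^ ((s : ℝ) / 2) * P y) ^ 2 = P y ^ 2 := by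
    intro y
    rw [mul_pow, ← mul_assoc, ← ENNReal.rpow_natCast, ← ENNReal.rpow_mul,
      ← ENNReal.rpow_add _ _ (japaneseWeight_ne_zero y) (japaneseWeight_ne_top y)]
    have : -(s : ℝ) + (s : ℝ) / 2 * ((2 : ℕ) : ℝ) = 0 := by push_cast; ring
    rw [this]; simp
  simp only [e1, e2] at h
  exact h

/-- The Sobolev product estimate for Schwartz functions. -/
theorem lintegral_enorm_mul_sq_le (a b : ℕ) (u v : 𝓢(EuclideanSpace ℝ (Fin n), ℂ)) :
    ∫⁻ y, ‖u y * v y‖ₑ ^ 2 ≤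
      4 * ((∫⁻ ξ : EuclideanSpace ℝ (Fin n), japaneseWeight ξ ^ (-((a + b : ℕ) : ℝ))) *
        fourierSobolevSq a u * fourierSobolevSq b v) := by
  set p := 𝓕⁻ u with hp
  set q := 𝓕⁻ v with hq
  set L := ContinuousLinearMap.mul ℂ ℂ
  have hw : ∀ t : ℝ, Measurable fun y : EuclideanSpace ℝ (Fin n) => japaneseWeight y ^ t :=
    fun t => measurable_japaneseWeight.pow_const _
  -- Plancherel: $uv$ is the Fourier transform of $p*q$. This is why the norms are defined through
  -- the inverse transform.
  have h1 : ∫⁻ y, ‖u y * v y‖ₑ ^ 2 = ∫⁻ x, ‖SchwartzMap.convolution L p q x‖ₑ ^ 2 := by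
    rw [← lintegral_enorm_sq_fourier, SchwartzMap.fourier_convolution, hp, hq,
      FourierTransform.fourier_fourierInv_eq, FourierTransform.fourier_fourierInv_eq]
    simp [L]
  set P : EuclideanSpace ℝ (Fin n) → ENNReal :=
    fun y => japaneseWeight y ^ ((a : ℝ) / 2) * ‖p y‖ₑ with hP
  set Q : EuclideanSpace ℝ (Fin n) → ENNReal :=
    fun y => japaneseWeight y ^ ((b : ℝ) / 2) * ‖q y‖ₑ with hQ
  have mP : Measurable P := (hw _).mul p.continuous.measurable.enorm
  have mQ : Measurable Q := (hw _).mul q.continuous.measurable.enorm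
  have sq_eq : ∀ (c : ℕ) (r : 𝓢(EuclideanSpace ℝ (Fin n), ℂ)),
      ∫⁻ y, (japaneseWeight y ^ ((c : ℝ) / 2) * ‖r y‖ₑ) ^ 2 =
        ∫⁻ y, japaneseWeight y ^ c * ‖r y‖ₑ ^ 2 := by
    intro c r
    congr 1; ext y
    rw [mul_pow, ← ENNReal.rpow_natCast (_ ^ ((c : ℝ) / 2)), ← ENNReal.rpow_mul]
    congr 1
    rw [← ENNReal.rpow_natCast]
    congr 1; push_cast; ring
  have P2 : ∫⁻ y, P y ^ 2 = fourierSobolevSq a u := sq_eq a p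
  have Q2 : ∫⁻ y, Q y ^ 2 = fourierSobolevSq b v := sq_eq b q
  set s := a + b
  set I₁ : EuclideanSpace ℝ (Fin n) → ENNReal :=
    fun x => ∫⁻ y, (japaneseWeight y ^ (-(s : ℝ) / 2) * P y) * Q (x - y) with hI₁
  set I₂ : EuclideanSpace ℝ (Fin n) → ENNReal :=
    fun x => ∫⁻ y, (japaneseWeight y ^ (-(s : ℝ) / 2) * Q y) * P (x - y) with hI₂
  have J₁ := lintegral_sq_weighted_convolution_le (s := s) mP mQ
  have J₂ := lintegral_sq_weighted_convolution_le (s := s) mQ mP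
  rw [P2, Q2] at J₁ J₂
  have inv_cancel : ∀ (y : EuclideanSpace ℝ (Fin n)) (c : ℝ) (z : ENNReal),
      z = japaneseWeight y ^ (-c) * (japaneseWeight y ^ c * z) := by
    intro y c z
    rw [← mul_assoc, ← ENNReal.rpow_add _ _ (japaneseWeight_ne_zero y) (japaneseWeight_ne_top y)]
    simp
  -- The negative powers of both weights may be collected at the smaller frequency. There the total
  -- decay of order `a + b` is available, whichever of `p` and `q` carries it.
  have wle : ∀ {y z : EuclideanSpace ℝ (Fin n)} (c d : ℕ), ‖y‖ ≤ ‖z‖ →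
      japaneseWeight y ^ (-((c : ℝ) / 2)) * japaneseWeight z ^ (-((d : ℝ) / 2)) ≤
        japaneseWeight y ^ (-((c + d : ℕ) : ℝ) / 2) := by
    intro y z c d hyz
    have h := japaneseWeight_mono hyz
    have h2 : japaneseWeight z ^ (-((d : ℝ) / 2)) ≤ japaneseWeight y ^ (-((d : ℝ) / 2)) := by
      rw [ENNReal.rpow_neg, ENNReal.rpow_neg]
      exact ENNReal.inv_le_inv.2 (ENNReal.rpow_le_rpow h (by positivity))
    calc _ ≤ japaneseWeight y ^ (-((c : ℝ) / 2)) * japaneseWeight y ^ (-((d : ℝ) / 2)) := by gcongr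
      _ = _ := by
        rw [← ENNReal.rpow_add _ _ (japaneseWeight_ne_zero y) (japaneseWeight_ne_top y)]
        congr 1; push_cast; ring
  have pointwise : ∀ x, ‖SchwartzMap.convolution L p q x‖ₑ ≤ I₁ x + I₂ x := by
    intro x
    have hI₂' : I₂ x = ∫⁻ y, P y * (japaneseWeight (x - y) ^ (-(s : ℝ) / 2) * Q (x - y)) := by
      have h := lintegral_sub_left_eq_self (μ := volume)
        (fun y => (japaneseWeight y ^ (-(s : ℝ) / 2) * Q y) * P (x - y)) x
      change ∫⁻ y, (japaneseWeight y ^ (-(s : ℝ) / 2) * Q y) * P (x - y) = _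
      rw [← h]
      refine lintegral_congr fun y => ?_
      rw [sub_sub_cancel]; ring
    rw [hI₂', SchwartzMap.convolution_apply, convolution_def]
    have m1 : Measurable fun y => (japaneseWeight y ^ (-(s : ℝ) / 2) * P y) * Q (x - y) :=
      ((hw _).mul mP).mul (mQ.comp (measurable_const.sub measurable_id))
    simp only [hI₁]
    rw [← lintegral_add_left m1]
    refine (enorm_integral_le_lintegral_enorm _).trans (lintegral_mono fun y => ?_)
    simp only [L, ContinuousLinearMap.mul_apply', enorm_mul]
    have ep : ‖p y‖ₑ = japaneseWeight y ^ (-((a : ℝ) / 2)) * P y := inv_cancel y _ _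
    have eq : ‖q (x - y)‖ₑ = japaneseWeight (x - y) ^ (-((b : ℝ) / 2)) * Q (x - y) :=
      inv_cancel (x - y) _ _
    rw [ep, eq]
    -- The frequency of `p` is the smaller one in the first case, that of `q` in the second; `I₁`
    -- and `I₂` bound the two regions.
    rcases le_total ‖y‖ ‖x - y‖ with h | h
    · refine le_trans ?_ le_self_add
      calc _ = (japaneseWeight y ^ (-((a : ℝ) / 2)) * japaneseWeight (x - y) ^ (-((b : ℝ) / 2))) *
            P y * Q (x - y) := by ring
        _ ≤ _ := by gcongr; exact wle a b h
    · refine le_trans ?_ le_add_self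
      calc _ = P y * ((japaneseWeight (x - y) ^ (-((b : ℝ) / 2)) *
            japaneseWeight y ^ (-((a : ℝ) / 2))) * Q (x - y)) := by ring
        _ ≤ _ := by
          gcongr
          have := wle b a h
          rwa [add_comm b a] at this
  have m1 : Measurable I₁ := Measurable.lintegral_prod_right'
    (f := fun z : EuclideanSpace ℝ (Fin n) × EuclideanSpace ℝ (Fin n) =>
      (japaneseWeight z.2 ^ (-(s : ℝ) / 2) * P z.2) * Q (z.1 - z.2))
    ((((hw _).mul mP).comp measurable_snd).mul (mQ.comp (measurable_fst.sub measurable_snd)))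
  rw [h1]
  -- The constant is `4 = 2 + 2`, from $(I_1+I_2)^2\le 2I_1^2+2I_2^2$ and the same bound for both
  -- integrals.
  calc ∫⁻ x, ‖SchwartzMap.convolution L p q x‖ₑ ^ 2
      ≤ ∫⁻ x, (2 * I₁ x ^ 2 + 2 * I₂ x ^ 2) := by
        refine lintegral_mono fun x => ?_
        refine (pow_le_pow_left₀ zero_le (pointwise x) 2).trans ?_
        have := ENNReal.rpow_add_le_mul_rpow_add_rpow (I₁ x) (I₂ x) (p := 2) one_le_two
        have e : (2 : ENNReal) ^ ((2 : ℝ) - 1) = 2 := by norm_num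
        rw [e] at this
        rw [← mul_add]
        simpa using this
    _ = 2 * (∫⁻ x, I₁ x ^ 2) + 2 * ∫⁻ x, I₂ x ^ 2 := by
        rw [lintegral_add_left ((m1.pow_const 2).const_mul 2),
          lintegral_const_mul' _ _ (by simp), lintegral_const_mul' _ _ (by simp)]
    _ ≤ _ := by
        refine (add_le_add (mul_le_mul_right J₁ 2) (mul_le_mul_right J₂ 2)).trans (le_of_eq ?_)
        ring

end FourierWeights

/-! ### Products, inverses and matrices of Sobolev functions -/

section SobolevAlgebra

open scoped SchwartzMap LineDeriv

variable {n m p s a b : ℕ} {Ω : Set (EuclideanSpace ℝ (Fin n))}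
  {f g : EuclideanSpace ℝ (Fin n) → ℝ} {i : Fin n}

/-- The mollifications of a compactly supported Sobolev function are bounded in `Hᵃ`. -/
theorem MemHloc.exists_fourierSobolevSq_mollify_le (hf : MemHloc a univ f)
    (hc : HasCompactSupport f) : ∃ C : ENNReal, C ≠ ⊤ ∧
      ∀ (j : ℕ) (u : 𝓢(EuclideanSpace ℝ (Fin n), ℂ)), (∀ y, u y = (mollify j f y : ℂ)) →
        fourierSobolevSq a u ≤ C := by
  induction a generalizing f with
  | zero =>
    have hf2 : MemLp f 2 volume := hf.memL2loc.memLp_of_hasCompactSupport hc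
    refine ⟨eLpNorm f 2 volume ^ 2, ENNReal.pow_ne_top hf2.2.ne, fun j u hu => ?_⟩
    rw [fourierSobolevSq_zero]
    calc ∫⁻ y, ‖u y‖ₑ ^ 2 = eLpNorm (mollify j f) 2 volume ^ 2 := by
          rw [eLpNorm_two_sq]
          refine lintegral_congr fun y => ?_
          rw [hu y, ← ofReal_norm, ← ofReal_norm, Complex.norm_real]
      _ ≤ _ := by
          gcongr
          exact eLpNorm_mollify_le j hf2.1
  | succ a ih =>
    have hder : ∀ i : Fin n, ∃ g, IsWeakDeriv i univ f g ∧ MemHloc a univ g ∧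
        HasCompactSupport g := by
      intro i
      obtain ⟨g, hg, hgm⟩ := hf.2 i
      -- The weak derivative vanishes almost everywhere off the support of `f`, hence may be
      -- modified to have compact support, as the induction hypothesis demands.
      have hz : (fun _ => (0 : ℝ)) =ᵐ[volume.restrict (tsupport f)ᶜ] g := by
        have ho : IsOpen (tsupport f)ᶜ := (isClosed_tsupport f).isOpen_compl
        have h0 : IsWeakDeriv i (tsupport f)ᶜ (fun _ => 0) (fun _ => 0) := by
          simpa using isWeakDeriv_of_contDiffOn (f := fun _ => (0 : ℝ)) ho contDiffOn_const i
        refine (h0.congr ho ?_ EventuallyEq.rfl).ae_eq (hg.mono (subset_univ _)) ho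
        filter_upwards [ae_restrict_mem ho.measurableSet] with y hy
        exact (image_eq_zero_of_notMem_tsupport hy).symm
      have hgi : g =ᵐ[volume.restrict univ] (tsupport f).indicator g := by
        rw [Measure.restrict_univ]
        filter_upwards [(ae_restrict_iff' (isClosed_tsupport f).isOpen_compl.measurableSet).1 hz]
          with y hy
        by_cases h : y ∈ tsupport f
        · simp [h]
        · simpa [h] using (hy h).symm
      refine ⟨(tsupport f).indicator g, hg.congr isOpen_univ EventuallyEq.rfl hgi,
        hgm.congr isOpen_univ hgi, HasCompactSupport.of_support_subset_isCompact hc ?_⟩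
      exact Set.support_indicator_subset
    choose g hg hgm hgc using hder
    obtain ⟨C, hC, hCj⟩ := ih hf.of_succ hc
    choose D hD hDj using fun i => ih (hgm i) (hgc i)
    refine ⟨C + ∑ i, D i, by simp [hC, hD], fun j u hu => ?_⟩
    refine (fourierSobolevSq_succ_le a u).trans ?_
    gcongr with i
    · exact hCj j u hu
    · refine hDj i j _ fun y => ?_
      have hu' : (u : EuclideanSpace ℝ (Fin n) → ℂ) = fun y => ((mollify j f y : ℝ) : ℂ) :=
        funext hu
      have hd : HasFDerivAt (mollify j f) (fderiv ℝ (mollify j f) y) y :=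
        ((contDiff_mollify j (locallyIntegrableOn_univ.1
          (hf.locallyIntegrableOn isOpen_univ))).differentiable (by simp) y).hasFDerivAt
      rw [SchwartzMap.lineDerivOp_apply_eq_fderiv, hu', ← fderiv_mollify j (hg i)]
      exact congrArg (fun L => L (EuclideanSpace.single i 1))
        (Complex.ofRealCLM.hasFDerivAt.comp y hd).fderiv

/-- The product of functions of class `Hᵃ` and `Hᵇ` is locally square integrable if
`a + b > n / 2`. -/
theorem MemHloc.memL2loc_mul (hf : MemHloc a Ω f) (hg : MemHloc b Ω g) (hΩ : IsOpen Ω)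
    (h : n < 2 * (a + b)) : MemL2loc Ω (fun y => f y * g y) := by
  intro K hK hKΩ
  obtain ⟨ρ, hρ, hρ1, -⟩ := exists_testFunction_eq_one hK hΩ hKΩ
  set F : EuclideanSpace ℝ (Fin n) → ℝ := fun y => ρ y * f y with hF
  set G : EuclideanSpace ℝ (Fin n) → ℝ := fun y => ρ y * g y with hG
  have hFm : MemHloc a univ F := hf.testFunction_mul hρ
  have hGm : MemHloc b univ G := hg.testFunction_mul hρ
  have hFc : HasCompactSupport F := hρ.2.mul_right
  have hGc : HasCompactSupport G := hρ.2.mul_right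
  have hFl := locallyIntegrableOn_univ.1 (hFm.locallyIntegrableOn isOpen_univ)
  have hGl := locallyIntegrableOn_univ.1 (hGm.locallyIntegrableOn isOpen_univ)
  obtain ⟨C, hC, hCj⟩ := hFm.exists_fourierSobolevSq_mollify_le hFc
  obtain ⟨D, hD, hDj⟩ := hGm.exists_fourierSobolevSq_mollify_le hGc
  set J := ∫⁻ ξ : EuclideanSpace ℝ (Fin n), japaneseWeight ξ ^ (-((a + b : ℕ) : ℝ)) with hJ
  have hJt : J ≠ ⊤ := (lintegral_japaneseWeight_rpow_lt_top h).ne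
  have hsch : ∀ {H : EuclideanSpace ℝ (Fin n) → ℝ}, HasCompactSupport H →
      LocallyIntegrable H volume → ∀ j, ∃ u : 𝓢(EuclideanSpace ℝ (Fin n), ℂ),
        ∀ y, u y = (mollify j H y : ℂ) := fun hHc hHl j =>
    ⟨HasCompactSupport.toSchwartzMap (f := fun y => ((mollify j _ y : ℝ) : ℂ))
      ((hHc.mollify j).comp_left Complex.ofReal_zero)
      (Complex.ofRealCLM.contDiff.comp (contDiff_mollify j hHl)), fun y => rfl⟩
  have hbound : ∀ j, eLpNorm (fun y => mollify j F y * mollify j G y) 2 volume ≤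
      (4 * (J * C * D)) ^ (1 / 2 : ℝ) := by
    intro j
    obtain ⟨u, hu⟩ := hsch hFc hFl j
    obtain ⟨v, hv⟩ := hsch hGc hGl j
    rw [eLpNorm_two_eq_lintegral]
    gcongr
    calc ∫⁻ y, ‖mollify j F y * mollify j G y‖ₑ ^ 2 = ∫⁻ y, ‖u y * v y‖ₑ ^ 2 := by
          refine lintegral_congr fun y => ?_
          rw [hu, hv, ← Complex.ofReal_mul, ← ofReal_norm, ← ofReal_norm, Complex.norm_real]
      _ ≤ _ := lintegral_enorm_mul_sq_le a b u v
      _ ≤ _ := by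
        gcongr
        · exact hCj j u hu
        · exact hDj j v hv
  -- The products of mollifications are bounded in $L^2$ and converge almost everywhere to the
  -- product of the localized functions; Fatou's lemma transfers the bound to the limit.
  have hlim := Lp.eLpNorm_lim_le_liminf_eLpNorm (p := 2) (μ := volume)
    (f := fun j y => mollify j F y * mollify j G y)
    (fun j => ((contDiff_mollify j hFl).continuous.mul
      (contDiff_mollify j hGl).continuous).aestronglyMeasurable) (fun y => F y * G y) (by
      filter_upwards [ae_tendsto_mollify hFl, ae_tendsto_mollify hGl] with y h1 h2
      exact h1.mul h2)
  have hFG : MemLp (fun y => F y * G y) 2 volume := by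
    refine ⟨hFl.aestronglyMeasurable.mul hGl.aestronglyMeasurable, lt_of_le_of_lt
      (hlim.trans (liminf_le_of_frequently_le' (Frequently.of_forall hbound))) ?_⟩
    refine ENNReal.rpow_lt_top_of_nonneg (by norm_num) ?_
    exact ENNReal.mul_ne_top (by simp) (ENNReal.mul_ne_top (ENNReal.mul_ne_top hJt hC) hD)
  refine (hFG.mono_measure Measure.restrict_le_self).ae_eq ?_
  filter_upwards [ae_restrict_mem hK.measurableSet] with y hy
  simp [hF, hG, (hρ1 y hy).eq_of_nhds]

/-- The Sobolev multiplication theorem. -/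
theorem MemHloc.mul_of_lt (hf : MemHloc a Ω f) (hg : MemHloc b Ω g) (hΩ : IsOpen Ω)
    (ha : s ≤ a) (hb : s ≤ b) (h : n + 2 * s < 2 * (a + b)) :
    MemHloc s Ω (fun y => f y * g y) := by
  induction s generalizing a b f g with
  | zero => exact hf.memL2loc_mul hg hΩ (by omega)
  | succ s ih =>
    -- Each Leibniz term lowers `s` and exactly one of `a`, `b` by one, which preserves `n + 2 * s <
    -- 2 * (a + b)`.
    obtain ⟨a, rfl⟩ : ∃ a', a = a' + 1 := ⟨a - 1, by omega⟩
    obtain ⟨b, rfl⟩ : ∃ b', b = b' + 1 := ⟨b - 1, by omega⟩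
    refine ⟨hf.memL2loc_mul hg hΩ (by omega), fun i => ?_⟩
    obtain ⟨f', hf', hfm⟩ := hf.2 i
    obtain ⟨g', hg', hgm⟩ := hg.2 i
    exact ⟨_, hf'.mul hg' hΩ hf.1 hfm.memL2loc hg.1 hgm.memL2loc,
      (ih hfm hg (by omega) (by omega) (by omega)).add
        (ih hf hgm (by omega) (by omega) (by omega))⟩

theorem MemHloc.mul (hp : n < 2 * p) (hf : MemHloc p Ω f) (hg : MemHloc s Ω g) (hΩ : IsOpen Ω)
    (hs : s ≤ p) : MemHloc s Ω (fun y => f y * g y) :=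
  hf.mul_of_lt hg hΩ hs le_rfl (by omega)

theorem MemHloc.prod {ι : Type*} (hp : n < 2 * p) (t : Finset ι)
    {F : ι → EuclideanSpace ℝ (Fin n) → ℝ} (hΩ : IsOpen Ω) (h : ∀ c ∈ t, MemHloc p Ω (F c)) :
    MemHloc p Ω (fun y => ∏ c ∈ t, F c y) := by
  classical
  induction t using Finset.induction_on with
  | empty => simpa using memHloc_const hΩ 1
  | insert c t hc ih =>
    simp only [Finset.prod_insert hc]
    exact MemHloc.mul hp (h c (by simp)) (ih fun d hd => h d (by simp [hd])) hΩ le_rfl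

/-- Multiplication with the inverse of a locally uniformly positive Sobolev function. -/
theorem MemHloc.inv_mul (hp : n < 2 * p) (hf : MemHloc p Ω f) (hΩ : IsOpen Ω)
    (hpos : LocallyUniformlyPos Ω f) (hg : MemHloc s Ω g) (hs : s ≤ p) :
    MemHloc s Ω (fun y => (f y)⁻¹ * g y) := by
  have hfm : AEStronglyMeasurable f (volume.restrict Ω) :=
    (hf.locallyIntegrableOn hΩ).aestronglyMeasurable
  induction s generalizing g with
  | zero => exact MemL2loc.inv_mul hfm hpos hg
  | succ s ih =>
    obtain ⟨p, rfl⟩ : ∃ p', p = p' + 1 := ⟨p - 1, by omega⟩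
    refine ⟨MemL2loc.inv_mul hfm hpos hg.1, fun i => ?_⟩
    obtain ⟨f', hf', hf'm⟩ := hf.2 i
    obtain ⟨g', hg', hg'm⟩ := hg.2 i
    have hv2 : MemL2loc Ω (fun y => (f y)⁻¹) := by
      simpa using MemL2loc.inv_mul hfm hpos (continuousOn_const (c := (1 : ℝ))).memL2loc
    have hv2' : MemL2loc Ω (fun y => -((f y)⁻¹ * ((f y)⁻¹ * f' y))) := by
      simpa using (MemL2loc.inv_mul hfm hpos
        (MemL2loc.inv_mul hfm hpos hf'm.memL2loc)).const_mul (-1)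
    have hd := (hf'.inv hΩ hf.1 hf'm.memL2loc hpos).mul hg' hΩ hv2 hv2' hg.1 hg'm.memL2loc
    refine ⟨_, hd, ?_⟩
    -- Here $(f^{-1}g)'=f^{-1}(g'-f^{-1}(f'g))$. The derivative `f'` may fall below the threshold
    -- $n/2$, but `g` has one order more than the product needs. Keeping the factor `g` in the
    -- statement lets the induction absorb both inverses.
    have h1 : MemHloc s Ω (fun y => f' y * g y) :=
      hf'm.mul_of_lt hg hΩ (by omega) (by omega) (by omega)
    have h2 := (ih (ih h1 (by omega)) (by omega)).neg.add (ih hg'm (by omega))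
    refine h2.congr_on hΩ fun y _ => ?_
    ring

theorem MemHloc.matrix_det {κ : Type*} [Fintype κ] [DecidableEq κ] (hp : n < 2 * p)
    (hΩ : IsOpen Ω) {A : EuclideanSpace ℝ (Fin n) → Matrix κ κ ℝ}
    (hA : ∀ c d, MemHloc p Ω (fun y => A y c d)) : MemHloc p Ω (fun y => (A y).det) := by
  simp only [Matrix.det_apply']
  exact MemHloc.sum _ hΩ fun σ _ =>
    (MemHloc.prod hp _ hΩ fun c _ => hA (σ c) c).const_mul _

theorem MemHloc.matrix_adjugate {κ : Type*} [Fintype κ] [DecidableEq κ] (hp : n < 2 * p)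
    (hΩ : IsOpen Ω) {A : EuclideanSpace ℝ (Fin n) → Matrix κ κ ℝ}
    (hA : ∀ c d, MemHloc p Ω (fun y => A y c d)) (c d : κ) :
    MemHloc p Ω (fun y => (A y).adjugate c d) := by
  simp only [Matrix.adjugate_apply]
  refine MemHloc.matrix_det hp hΩ fun c' d' => ?_
  simp only [Matrix.updateRow_apply]
  split_ifs
  · exact memHloc_const hΩ _
  · exact hA c' d'

/-- The determinant is the product of the eigenvalues, and testing with unit eigenvectors shows that
each is at least `c`. -/
theorem pow_card_le_det {κ : Type*} [Fintype κ] [DecidableEq κ] {A : Matrix κ κ ℝ}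
    (hA : A.IsSymm) {c : ℝ} (hc : 0 < c)
    (h : ∀ v : κ → ℝ, c * ∑ a, v a ^ 2 ≤ v ⬝ᵥ A.mulVec v) : c ^ Fintype.card κ ≤ A.det := by
  have hH : A.IsHermitian := by
    rw [Matrix.IsHermitian, Matrix.conjTranspose_eq_transpose_of_trivial]; exact hA
  have hev : ∀ a, c ≤ hH.eigenvalues a := by
    intro a
    have hn : ∑ b, (hH.eigenvectorBasis a b) ^ 2 = 1 := by
      have h1 := hH.eigenvectorBasis.orthonormal.1 a
      have h2 := EuclideanSpace.norm_sq_eq (hH.eigenvectorBasis a)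
      rw [h1] at h2
      simpa using h2.symm
    have h3 := h (hH.eigenvectorBasis a)
    rw [hn, mul_one] at h3
    rw [hH.eigenvalues_eq]
    simpa using h3
  rw [hH.det_eq_prod_eigenvalues]
  have := Finset.prod_le_prod (s := Finset.univ) (f := fun _ : κ => c) (g := hH.eigenvalues)
    (fun _ _ => hc.le) fun a _ => hev a
  simpa using this

/-- Cramer's rule: the entries of the adjugate and the determinant are polynomials in the entries.
-/
theorem MemHloc.matrix_inv {κ : Type*} [Fintype κ] [DecidableEq κ] (hp : n < 2 * p)
    (hΩ : IsOpen Ω) {A : EuclideanSpace ℝ (Fin n) → Matrix κ κ ℝ}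
    (hA : ∀ c d, MemHloc p Ω (fun y => A y c d))
    (hpos : LocallyUniformlyPos Ω (fun y => (A y).det)) (c d : κ) :
    MemHloc p Ω (fun y => (A y)⁻¹ c d) := by
  refine (MemHloc.inv_mul hp (MemHloc.matrix_det hp hΩ hA) hΩ hpos
    (MemHloc.matrix_adjugate hp hΩ hA c d) le_rfl).congr_on hΩ fun y _ => ?_
  simp [Matrix.inv_def]

end SobolevAlgebra

/-! ## Sobolev functions on a manifold -/

section SobolevOnManifold

variable {n m p s : ℕ} {M : Type*} [TopologicalSpace M]
  [ChartedSpace (EuclideanSpace ℝ (Fin n)) M] {U U' W : Set M} {f g χ : M → ℝ}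

/-- `χ` is a smooth function supported in `U` and equal to `1` on the open set `W`. -/
structure IsCutoff (n : ℕ) {M : Type*} [TopologicalSpace M]
    [ChartedSpace (EuclideanSpace ℝ (Fin n)) M] (U W : Set M) (χ : M → ℝ) : Prop where
  contMDiff : ContMDiff (𝓡 n) 𝓘(ℝ) ∞ χ
  tsupport_subset : tsupport χ ⊆ U
  isOpen : IsOpen W
  eq_one : ∀ x ∈ W, χ x = 1

theorem IsCutoff.subset (h : IsCutoff n U W χ) : W ⊆ U := fun x hx =>
  h.tsupport_subset (subset_tsupport _ (by simp [h.eq_one x hx]))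

theorem exists_isCutoff [T2Space M] [CompactSpace M] [IsManifold (𝓡 n) ∞ M] (hU : IsOpen U)
    {x₀ : M} (hx : x₀ ∈ U) : ∃ W χ, x₀ ∈ W ∧ IsCutoff n U W χ := by
  obtain ⟨t, ht, htc, htU⟩ := exists_mem_nhds_isClosed_subset (hU.mem_nhds hx)
  obtain ⟨f, hf1, hf0, -⟩ := exists_contMDiffMap_one_nhds_of_subset_interior (n := (⊤ : ℕ∞))
    (𝓡 n) (s := {x₀}) (t := t) isClosed_singleton
    (by simpa [mem_interior_iff_mem_nhds] using ht)
  rw [nhdsSet_singleton] at hf1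
  obtain ⟨W, hW, hWo, hxW⟩ := eventually_nhds_iff.1 hf1
  refine ⟨W, f, hxW, f.contMDiff, ?_, hWo, hW⟩
  refine (closure_minimal (fun x hx' => ?_) htc).trans htU
  by_contra hxt
  exact hx' (hf0 x hxt)

theorem OpenPartialHomeomorph.contDiffOn_comp_symm
    {φ : OpenPartialHomeomorph M (EuclideanSpace ℝ (Fin n))}
    (hφ : φ ∈ IsManifold.maximalAtlas (𝓡 n) ∞ M) (hχ : ContMDiffOn (𝓡 n) 𝓘(ℝ) ∞ χ U) :
    ContDiffOn ℝ ∞ (fun y => χ (φ.symm y)) (φ.target ∩ φ.symm ⁻¹' U) := by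
  rw [← contMDiffOn_iff_contDiffOn]
  exact hχ.comp ((contMDiffOn_symm_of_mem_maximalAtlas hφ).mono inter_subset_left)
    (fun y hy => hy.2)

theorem MemHlocOn.mono (hf : MemHlocOn n m U f) (h : U' ⊆ U) : MemHlocOn n m U' f :=
  fun φ hφ => (hf φ hφ).mono fun _ hy => ⟨hy.1, h hy.2⟩

theorem MemHlocOn.of_le (hf : MemHlocOn n m U f) (h : s ≤ m) : MemHlocOn n s U f :=
  fun φ hφ => (hf φ hφ).of_le h

theorem MemHlocOn.congr_on (hf : MemHlocOn n m U f) (hU : IsOpen U) (h : ∀ x ∈ U, f x = g x) :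
    MemHlocOn n m U g :=
  fun φ hφ => (hf φ hφ).congr_on (φ.isOpen_inter_preimage_symm hU) fun _ hy => h _ hy.2

theorem MemHlocOn.sum {σ : Type*} (t : Finset σ) {F : σ → M → ℝ} (hU : IsOpen U)
    (h : ∀ a ∈ t, MemHlocOn n m U (F a)) : MemHlocOn n m U (fun x => ∑ a ∈ t, F a x) :=
  fun φ hφ => MemHloc.sum t (φ.isOpen_inter_preimage_symm hU) fun a ha => h a ha φ hφ

theorem MemHlocOn.mul (hp : n < 2 * p) (hf : MemHlocOn n p U f) (hg : MemHlocOn n s U g)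
    (hU : IsOpen U) (hs : s ≤ p) : MemHlocOn n s U (fun x => f x * g x) :=
  fun φ hφ => MemHloc.mul hp (hf φ hφ) (hg φ hφ) (φ.isOpen_inter_preimage_symm hU) hs

theorem ContMDiffOn.memHlocOn (hf : ContMDiffOn (𝓡 n) 𝓘(ℝ) ∞ f U) (hU : IsOpen U) :
    MemHlocOn n m U f :=
  fun φ hφ => ContDiffOn.memHloc (φ.isOpen_inter_preimage_symm hU)
    (OpenPartialHomeomorph.contDiffOn_comp_symm hφ hf)

theorem MemHlocOn.smooth_mul (hf : MemHlocOn n m U f) (hU : IsOpen U)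
    (hχ : ContMDiffOn (𝓡 n) 𝓘(ℝ) ∞ χ U) : MemHlocOn n m U (fun x => χ x * f x) :=
  fun φ hφ => (hf φ hφ).smooth_mul (φ.isOpen_inter_preimage_symm hU)
    (OpenPartialHomeomorph.contDiffOn_comp_symm hφ hχ)

theorem IsCutoff.contMDiff_mul (hχ : IsCutoff n U W χ) (hU : IsOpen U)
    (hf : ContMDiffOn (𝓡 n) 𝓘(ℝ) ∞ f U) : ContMDiff (𝓡 n) 𝓘(ℝ) ∞ (fun x => χ x * f x) := by
  refine contMDiff_of_tsupport fun x hx => ?_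
  have hxU : x ∈ U := hχ.tsupport_subset (tsupport_mul_subset_left hx)
  exact hχ.contMDiff.contMDiffAt.mul (hf.contMDiffAt (hU.mem_nhds hxU))

/-- Extension by zero of a Sobolev function multiplied by a cutoff. -/
theorem MemHlocOn.cutoff_mul (hf : MemHlocOn n m U' f) (hU : IsOpen U)
    (hχ : ContMDiff (𝓡 n) 𝓘(ℝ) ∞ χ) (h : tsupport χ ∩ U ⊆ U') :
    MemHlocOn n m U (fun x => χ x * f x) := fun φ hφ => by
  refine (hf φ hφ).smooth_mul_of_eventuallyEq_zero (χ := fun y => χ (φ.symm y))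
    (φ.isOpen_inter_preimage_symm hU)
    (OpenPartialHomeomorph.contDiffOn_comp_symm hφ hχ.contMDiffOn) fun y hy hy' => ?_
  have hx : φ.symm y ∉ tsupport χ := fun hx => hy' ⟨hy.1, h ⟨hx, hy.2⟩⟩
  exact (φ.continuousAt_symm hy.1).eventually (notMem_tsupport_iff_eventuallyEq.1 hx)

variable {ι : Type*} {C : BaseCharts n ι M} {j : ι}

theorem BaseCharts.target_inter_preimage (C : BaseCharts n ι M) (j : ι) :
    (C.chart j).target ∩ (C.chart j).symm ⁻¹' (C.chart j).source = (C.chart j).target :=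
  inter_eq_left.2 fun _ hy => (C.chart j).map_target hy

theorem MemHlocOn.memHloc_chart (hf : MemHlocOn n m (C.chart j).source f) :
    MemHloc m (C.chart j).target (fun y => f ((C.chart j).symm y)) := by
  have := hf _ (C.mem_maximalAtlas j)
  rwa [C.target_inter_preimage] at this

theorem MemHlocOn.isWeakDeriv_chart (hf : MemHlocOn n 1 (C.chart j).source f) (i : Fin n) :
    IsWeakDeriv i (C.chart j).target (fun y => f ((C.chart j).symm y))
      (weakDeriv i (C.chart j).target fun y => f ((C.chart j).symm y)) :=
  hf.memHloc_chart.isWeakDeriv i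

/-- Properties that hold almost everywhere near every point of `U` hold almost everywhere
on `U`. -/
theorem BaseCharts.ae_of_locally (C : BaseCharts n ι M) (j : ι)
    {P : EuclideanSpace ℝ (Fin n) → Prop}
    (h : ∀ x₀ ∈ (C.chart j).source, x₀ ∈ U → ∃ W, IsOpen W ∧ x₀ ∈ W ∧
      ∀ᵐ y ∂(volume.restrict (C.chart j).target), (C.chart j).symm y ∈ W →
        (C.chart j).symm y ∈ U → P y) :
    ∀ᵐ y ∂(volume.restrict (C.chart j).target), (C.chart j).symm y ∈ U → P y := by
  have hT := (C.chart j).open_target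
  rw [ae_restrict_iff' hT.measurableSet, ae_iff]
  -- Second countability of Euclidean space allows possibly uncountably many neighbourhoods `W`.
  refine measure_null_of_locally_null _ fun y hy => ?_
  simp only [mem_ofPred_eq, Classical.not_imp] at hy
  obtain ⟨W, hW, hyW, hae⟩ := h _ ((C.chart j).map_target hy.1) hy.2.1
  refine ⟨_, inter_mem_nhdsWithin _
    (((C.chart j).isOpen_inter_preimage_symm hW).mem_nhds ⟨hy.1, hyW⟩), ?_⟩
  rw [ae_restrict_iff' hT.measurableSet, ae_iff] at hae
  refine measure_mono_null (fun z hz => ?_) hae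
  simp only [mem_inter_iff, mem_ofPred_eq, Classical.not_imp, mem_preimage] at hz ⊢
  exact ⟨hz.2.1, hz.2.2, hz.1.2⟩

theorem BaseCharts.AE_of_locally (C : BaseCharts n ι M) {P : M → Prop}
    (h : ∀ x₀ ∈ U, ∃ W, IsOpen W ∧ x₀ ∈ W ∧ C.AE fun x => x ∈ W → x ∈ U → P x) :
    C.AE fun x => x ∈ U → P x :=
  fun j => C.ae_of_locally j fun x₀ _ hx₀ =>
    let ⟨W, hW, hx, hae⟩ := h x₀ hx₀
    ⟨W, hW, hx, hae j⟩

theorem BaseCharts.AE.mono {P Q : M → Prop} (h : C.AE P) (hPQ : ∀ x, P x → Q x) : C.AE Q :=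
  fun j => (h j).mono fun _ hy => hPQ _ hy

/-- Weak derivatives only depend on the function near the point. -/
theorem IsWeakDeriv.ae_eq_of_eqOn {i : Fin n} {f f' g g' : EuclideanSpace ℝ (Fin n) → ℝ}
    (hf : IsWeakDeriv i (C.chart j).target f g) (hf' : IsWeakDeriv i (C.chart j).target f' g')
    (hW : IsOpen W) (h : ∀ y ∈ (C.chart j).target, (C.chart j).symm y ∈ W → f y = f' y) :
    ∀ᵐ y ∂(volume.restrict (C.chart j).target), (C.chart j).symm y ∈ W → g y = g' y := by
  have hO := (C.chart j).isOpen_inter_preimage_symm hW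
  have h1 := hf.mono (Ω' := (C.chart j).target ∩ (C.chart j).symm ⁻¹' W) inter_subset_left
  have h2 := hf'.mono (Ω' := (C.chart j).target ∩ (C.chart j).symm ⁻¹' W) inter_subset_left
  have h3 := (h1.congr hO (ae_restrict_of_forall_mem hO.measurableSet fun y hy => h y hy.1 hy.2)
    (ae_eq_refl _)).ae_eq h2 hO
  have h4 := (ae_restrict_iff' hO.measurableSet).1 h3
  rw [ae_restrict_iff' (C.chart j).open_target.measurableSet]
  exact h4.mono fun y hy hyT hyW => hy ⟨hyT, hyW⟩

end SobolevOnManifold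

/-! ## Sections of Sobolev bundles -/

section SobolevSections

variable {n m p s k : ℕ} {M : Type*} [TopologicalSpace M]
  [ChartedSpace (EuclideanSpace ℝ (Fin n)) M] {U W : Set M} {f χ : M → ℝ}
  {ι : Type*} {C : BaseCharts n ι M} {j : ι} {κ : Type} {V : M → Type*}
  [∀ x, AddCommGroup (V x)] [∀ x, Module ℝ (V x)] {B : BundleCharts C κ V} {u v : ∀ x, V x}

theorem BundleCharts.coord_basisSection [DecidableEq κ] (B : BundleCharts C κ V) {x : M}
    (hx : x ∈ (C.chart j).source) (a : κ) :
    B.coord j x (B.basisSection j a x) = Pi.single a 1 :=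
  B.coord_frame j x hx _

theorem BundleCharts.sum_coord_smul [Fintype κ] [DecidableEq κ] (B : BundleCharts C κ V) {x : M}
    (hx : x ∈ (C.chart j).source) (v : V x) :
    ∑ a, B.coord j x v a • B.basisSection j a x = v := by
  have h := B.frame_coord j x hx v
  rw [pi_eq_sum_univ' (B.coord j x v), map_sum] at h
  simp only [map_smul] at h
  exact h

theorem BundleCharts.MemH.of_le (hu : B.MemH m u) (h : s ≤ m) : B.MemH s u :=
  fun j a => (hu j a).of_le h

theorem BundleCharts.memH_zero : B.MemH m (fun _ => 0) := fun j a => by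
  simpa using (contMDiff_const (c := (0 : ℝ))).contMDiffOn.memHlocOn (C.chart j).open_source

theorem BundleCharts.MemH.sum {σ : Type*} (t : Finset σ) {s : σ → ∀ x, V x}
    (h : ∀ a ∈ t, B.MemH m (s a)) : B.MemH m (fun x => ∑ a ∈ t, s a x) := fun j b => by
  simpa using MemHlocOn.sum t (C.chart j).open_source fun a ha => h a ha j b

theorem BundleCharts.MemH.smooth_smul (hu : B.MemH m u) (hχ : ContMDiff (𝓡 n) 𝓘(ℝ) ∞ χ) :
    B.MemH m (fun x => χ x • u x) := fun j a => by
  simpa using (hu j a).smooth_mul (C.chart j).open_source hχ.contMDiffOn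

theorem BundleCharts.MemH.memHloc (hu : B.MemH m u) (j : ι) (a : κ) :
    MemHloc m (C.chart j).target (fun y => B.localRep j u y a) :=
  (hu j a).memHloc_chart

/-- Multiples of the local frame, cut off, are sections of class `Hᵐ`. -/
theorem BundleCharts.IsSobolev.memH_cutoff_smul [DecidableEq κ] (hB : B.IsSobolev k)
    (hk : n < 2 * k) (hm : m ≤ k) (hf : MemHlocOn n m (C.chart j).source f)
    (hχ : IsCutoff n (C.chart j).source W χ) (a : κ) :
    B.MemH m (fun x => (χ x * f x) • B.basisSection j a x) := fun i b => by
  have h1 := (hB i j a b).mul hk (hf.mono inter_subset_right)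
    ((C.chart i).open_source.inter (C.chart j).open_source) hm
  refine (h1.cutoff_mul (C.chart i).open_source hχ.contMDiff ?_).congr_on
    (C.chart i).open_source fun x _ => ?_
  · exact fun x hx => ⟨hx.2, hχ.tsupport_subset hx.1⟩
  · simp only [map_smul, Pi.smul_apply, smul_eq_mul]
    ring

theorem BundleCharts.IsSobolev.memH_cutoff_basisSection [DecidableEq κ] (hB : B.IsSobolev k)
    (hk : n < 2 * k) (hχ : IsCutoff n (C.chart j).source W χ) (a : κ) :
    B.MemH k (fun x => χ x • B.basisSection j a x) := by
  simpa using hB.memH_cutoff_smul hk le_rfl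
    (f := fun _ => 1) (contMDiff_const.contMDiffOn.memHlocOn (C.chart j).open_source) hχ a

theorem IsCutoff.memHlocOn_univ (hχ : IsCutoff n U W χ) : MemHlocOn n m univ χ :=
  hχ.contMDiff.contMDiffOn.memHlocOn isOpen_univ

theorem IsCutoff.weakDeriv_eq_zero (hχ : IsCutoff n U W χ) (j : ι) (i : Fin n) :
    ∀ᵐ y ∂(volume.restrict (C.chart j).target), (C.chart j).symm y ∈ W →
      weakDeriv i (C.chart j).target (fun y => χ ((C.chart j).symm y)) y = 0 := by
  have h1 := isWeakDeriv_of_contDiffOn (f := fun _ => (1 : ℝ)) (C.chart j).open_target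
    contDiffOn_const i
  refine ((hχ.memHlocOn_univ.mono (subset_univ _)).isWeakDeriv_chart i).ae_eq_of_eqOn
    (g' := fun _ => 0) (f' := fun _ => 1) ?_ hχ.isOpen fun y _ hy => hχ.eq_one _ hy
  simpa using h1

/-! ## Connections are local operators -/

variable [IsManifold (𝓡 n) ∞ M]

/-- The coordinate fields span each tangent space, so `n` null sets per chart suffice to compare the
maps on all tangent vectors at once. -/
theorem BaseCharts.AE_ext (C : BaseCharts n ι M)
    {L L' : ∀ x : M, TangentSpace (𝓡 n) x →ₗ[ℝ] V x} {P : M → Prop}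
    (h : ∀ j i, ∀ᵐ y ∂(volume.restrict (C.chart j).target), P ((C.chart j).symm y) →
      L ((C.chart j).symm y) (C.partialVec j i ((C.chart j).symm y)) =
        L' ((C.chart j).symm y) (C.partialVec j i ((C.chart j).symm y))) :
    C.AE fun x => P x → L x = L' x := fun j => by
  filter_upwards [ae_all_iff.2 (h j), ae_restrict_mem (C.chart j).open_target.measurableSet]
    with y hy hyT hP
  ext X
  rw [← C.tangent.sum_coord_smul ((C.chart j).map_target hyT) X, map_sum, map_sum]
  refine Finset.sum_congr rfl fun i _ => ?_
  rw [map_smul, map_smul]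
  exact congrArg _ (hy i hP)

variable (conn : SobolevConnection B)

theorem SobolevConnection.leibniz_weakDeriv (hf : MemHlocOn n 1 univ f) (hu : B.MemH 1 u)
    (hfu : B.MemH 1 (fun x => f x • u x)) (j : ι) (i : Fin n) :
    ∀ᵐ y ∂(volume.restrict (C.chart j).target),
      conn.toFun (fun x => f x • u x) ((C.chart j).symm y)
          (C.partialVec j i ((C.chart j).symm y)) =
        weakDeriv i (C.chart j).target (fun y => f ((C.chart j).symm y)) y •
            u ((C.chart j).symm y) + f ((C.chart j).symm y) •
          conn.toFun u ((C.chart j).symm y) (C.partialVec j i ((C.chart j).symm y)) :=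
  conn.leibniz f u hf hu hfu j i _ ((hf.mono (subset_univ _)).isWeakDeriv_chart i)

/-- On `W` the Leibniz rule degenerates, since `χ = 1` and its derivative vanishes there. -/
theorem SobolevConnection.toFun_cutoff_smul (hu : B.MemH 1 u) (hχ : IsCutoff n U W χ) :
    C.AE fun x => x ∈ W → conn.toFun (fun z => χ z • u z) x = conn.toFun u x :=
  C.AE_ext fun j i => by
    filter_upwards [conn.leibniz_weakDeriv hχ.memHlocOn_univ hu (hu.smooth_smul hχ.contMDiff) j i,
      hχ.weakDeriv_eq_zero (C := C) j i] with y hy h0 hyW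
    rw [hy, h0 hyW, hχ.eq_one _ hyW, zero_smul, zero_add, one_smul]

theorem SobolevConnection.toFun_zero : C.AE fun x => conn.toFun (fun _ => 0) x = 0 := by
  have h1 : MemHlocOn n 1 (univ : Set M) fun _ => (0 : ℝ) :=
    contMDiff_const.contMDiffOn.memHlocOn isOpen_univ
  have h : C.AE fun x => True → conn.toFun (fun _ => 0) x = 0 := C.AE_ext fun j i => by
    have := conn.leibniz_weakDeriv (f := fun _ => 0) (u := fun _ => 0) h1
      BundleCharts.memH_zero (by simpa using BundleCharts.memH_zero) j i
    simpa using this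
  exact h.mono fun x hx => hx trivial

theorem SobolevConnection.toFun_sum {σ : Type*} (t : Finset σ) {s : σ → ∀ x, V x}
    (h : ∀ a ∈ t, B.MemH 1 (s a)) :
    C.AE fun x => conn.toFun (fun z => ∑ a ∈ t, s a z) x = ∑ a ∈ t, conn.toFun (s a) x := by
  classical
  induction t using Finset.induction_on with
  | empty => simpa using conn.toFun_zero
  | insert a t ha ih =>
    have h1 := ih fun b hb => h b (Finset.mem_insert_of_mem hb)
    have h2 := conn.add (s a) (fun x => ∑ b ∈ t, s b x) (h a (Finset.mem_insert_self _ _))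
      (BundleCharts.MemH.sum t fun b hb => h b (Finset.mem_insert_of_mem hb))
    intro j
    filter_upwards [h1 j, h2 j] with y h1 h2
    simp only [Finset.sum_insert ha]
    rw [h2, h1]

variable [T2Space M] [CompactSpace M]

/-- A connection is a local operator. -/
theorem SobolevConnection.toFun_eq_of_eqOn (hu : B.MemH 1 u) (hv : B.MemH 1 v) (hU : IsOpen U)
    (h : ∀ x ∈ U, u x = v x) : C.AE fun x => x ∈ U → conn.toFun u x = conn.toFun v x := by
  refine C.AE_of_locally fun x₀ hxU => ?_
  obtain ⟨W, χ, hxW, hχ⟩ := exists_isCutoff (n := n) hU hxU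
  -- As `χ` is supported in `U`, the cut-off sections coincide on all of `M`, while near `x₀` the
  -- cutoff does not affect the connection.
  have h1 : (fun z => χ z • u z) = fun z => χ z • v z := by
    funext z
    by_cases hz : z ∈ U
    · rw [h z hz]
    · rw [image_eq_zero_of_notMem_tsupport fun hz' => hz (hχ.tsupport_subset hz'), zero_smul,
        zero_smul]
  refine ⟨W, hχ.isOpen, hxW, fun j => ?_⟩
  filter_upwards [conn.toFun_cutoff_smul hu hχ j, conn.toFun_cutoff_smul hv hχ j]
    with y h2 h3 hyW _
  rw [← h2 hyW, ← h3 hyW, h1]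

/-- A connection acts on global sections only, so frame expansions on `W` enter through globally
defined `F l` and `s l`. -/
theorem SobolevConnection.toFun_eq_sum {σ : Type*} [Fintype σ] {F : σ → M → ℝ}
    {s : σ → ∀ x, V x} (hu : B.MemH 1 u) (hW : IsOpen W) (hF : ∀ l, MemHlocOn n 1 univ (F l))
    (hs : ∀ l, B.MemH 1 (s l)) (hFs : ∀ l, B.MemH 1 (fun x => F l x • s l x))
    (h : ∀ x ∈ W, u x = ∑ l, F l x • s l x) (j : ι) (i : Fin n) :
    ∀ᵐ y ∂(volume.restrict (C.chart j).target), (C.chart j).symm y ∈ W →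
      conn.toFun u ((C.chart j).symm y) (C.partialVec j i ((C.chart j).symm y)) =
        ∑ l, (weakDeriv i (C.chart j).target (fun y => F l ((C.chart j).symm y)) y •
            s l ((C.chart j).symm y) + F l ((C.chart j).symm y) •
          conn.toFun (s l) ((C.chart j).symm y) (C.partialVec j i ((C.chart j).symm y))) := by
  have h0 : B.MemH 1 (fun x => ∑ l, F l x • s l x) :=
    BundleCharts.MemH.sum Finset.univ fun l _ => hFs l
  filter_upwards [conn.toFun_eq_of_eqOn hu h0 hW h j,
    conn.toFun_sum Finset.univ (fun l _ => hFs l) j,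
    ae_all_iff.2 fun l => conn.leibniz_weakDeriv (hF l) (hs l) (hFs l) j i] with y h1 h2 h3 hyW
  rw [h1 hyW, h2, LinearMap.sum_apply]
  exact Finset.sum_congr rfl fun l _ => h3 l

/-- The local expression of a connection: `(∇_i u)^b = ∂_i u^b + ∑ a, Γ i a b u^a`. -/
theorem SobolevConnection.IsChristoffel.coord_eq [Fintype κ] [DecidableEq κ]
    {conn : SobolevConnection B} {Γ : Fin n → κ → κ → EuclideanSpace ℝ (Fin n) → ℝ}
    (hΓ : conn.IsChristoffel j Γ) (hB : B.IsSobolev k) (hk : n < 2 * k) (hu : B.MemH 1 u)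
    (i : Fin n) (b : κ) :
    ∀ᵐ y ∂(volume.restrict (C.chart j).target),
      B.coord j ((C.chart j).symm y)
        (conn.toFun u ((C.chart j).symm y) (C.partialVec j i ((C.chart j).symm y))) b =
      weakDeriv i (C.chart j).target (fun z => B.localRep j u z b) y +
        ∑ a, Γ i a b y * B.localRep j u y a := by
  have hk1 : 1 ≤ k := by omega
  have hT := (C.chart j).open_target.measurableSet
  suffices h : ∀ᵐ y ∂(volume.restrict (C.chart j).target),
      (C.chart j).symm y ∈ (C.chart j).source → B.coord j ((C.chart j).symm y)
        (conn.toFun u ((C.chart j).symm y) (C.partialVec j i ((C.chart j).symm y))) b =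
      weakDeriv i (C.chart j).target (fun z => B.localRep j u z b) y +
        ∑ a, Γ i a b y * B.localRep j u y a by
    filter_upwards [h, ae_restrict_mem hT] with y hy hyT using hy ((C.chart j).map_target hyT)
  refine C.ae_of_locally j fun x₀ hx₀ _ => ?_
  obtain ⟨W, χ, hxW, hχ⟩ := exists_isCutoff (n := n) (C.chart j).open_source hx₀
  refine ⟨W, hχ.isOpen, hxW, ?_⟩
  -- Coefficients and frame are both cut off, making each of them global; on `W` both cutoffs are
  -- `1`.
  set F : κ → M → ℝ := fun a x => χ x * B.coord j x (u x) a with hFdef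
  set s : κ → ∀ x, V x := fun a x => χ x • B.basisSection j a x with hsdef
  have hF : ∀ a, MemHlocOn n 1 univ (F a) := fun a =>
    (hu j a).cutoff_mul isOpen_univ hχ.contMDiff fun x hx => hχ.tsupport_subset hx.1
  have hs : ∀ a, B.MemH 1 (s a) := fun a => (hB.memH_cutoff_basisSection hk hχ a).of_le hk1
  have hFs : ∀ a, B.MemH 1 (fun x => F a x • s a x) := fun a => by
    have := hB.memH_cutoff_smul hk hk1 ((hF a).mono (subset_univ _)) hχ a
    simpa [hsdef, smul_smul, mul_comm] using this
  have hsum : ∀ x ∈ W, u x = ∑ a, F a x • s a x := fun x hx => by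
    simp only [hFdef, hsdef, hχ.eq_one x hx, one_mul, one_smul]
    exact (B.sum_coord_smul (hχ.subset hx) _).symm
  have hΓW : ∀ a, ∀ᵐ y ∂(volume.restrict (C.chart j).target), (C.chart j).symm y ∈ W →
      B.coord j ((C.chart j).symm y) (conn.toFun (s a) ((C.chart j).symm y)
        (C.partialVec j i ((C.chart j).symm y))) b = Γ i a b y := fun a => by
    have h := hΓ a W hχ.isOpen hχ.subset (s a) (hs a)
      (fun x hx => by simp only [hsdef, hχ.eq_one x hx, one_smul]) i b
    rw [ae_restrict_iff' ((C.chart j).isOpen_inter_preimage_symm hχ.isOpen).measurableSet] at h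
    rw [ae_restrict_iff' hT]
    exact h.mono fun y hy hyT hyW => hy ⟨hyT, hyW⟩
  have hd : ∀ᵐ y ∂(volume.restrict (C.chart j).target), (C.chart j).symm y ∈ W →
      weakDeriv i (C.chart j).target (fun y => F b ((C.chart j).symm y)) y =
        weakDeriv i (C.chart j).target (fun z => B.localRep j u z b) y :=
    (((hF b).mono (subset_univ _)).isWeakDeriv_chart i).ae_eq_of_eqOn
      ((hu.memHloc j b).isWeakDeriv i) hχ.isOpen fun y _ hyW => by
        simp only [hFdef, hχ.eq_one _ hyW, one_mul]; rfl
  filter_upwards [conn.toFun_eq_sum hu hχ.isOpen hF hs hFs hsum j i, ae_all_iff.2 hΓW, hd,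
    ae_restrict_mem hT] with y h1 h2 h3 hyT hyW _
  have hyS := (C.chart j).map_target hyT
  rw [h1 hyW, map_sum, Finset.sum_apply, ← h3 hyW]
  simp only [map_add, map_smul, Pi.add_apply, Pi.smul_apply, smul_eq_mul, h2 _ hyW]
  rw [Finset.sum_add_distrib]
  congr 1
  · simp [hsdef, hχ.eq_one _ hyW, B.coord_basisSection hyS, Pi.single_apply]
  · refine Finset.sum_congr rfl fun a _ => ?_
    simp only [hFdef, hχ.eq_one _ hyW, one_mul, BundleCharts.localRep]
    ring

end SobolevSections

/-! ## A connection is a safe operator of order one -/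

section SafeConnection

variable {n k : ℕ} {M : Type*} [TopologicalSpace M]
  [ChartedSpace (EuclideanSpace ℝ (Fin n)) M] [IsManifold (𝓡 n) ∞ M] [T2Space M] [CompactSpace M]
  {ι : Type*} {C : BaseCharts n ι M} {κ : Type} [Fintype κ] [DecidableEq κ] {V : M → Type*}
  [∀ x, AddCommGroup (V x)] [∀ x, Module ℝ (V x)] {B : BundleCharts C κ V}

theorem sum_monotone_zero {R : Type*} [AddCommMonoid R] (F : (Fin 0 → Fin n) → R)
    [DecidablePred fun I : Fin 0 → Fin n => Monotone I] :
    ∑ I : Fin 0 → Fin n with Monotone I, F I = F Fin.elim0 := by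
  rw [Finset.filter_true_of_mem fun I _ => Subsingleton.monotone I, Fintype.sum_unique]
  congr 1

theorem sum_monotone_one {R : Type*} [AddCommMonoid R] (F : (Fin 1 → Fin n) → R)
    [DecidablePred fun I : Fin 1 → Fin n => Monotone I] :
    ∑ I : Fin 1 → Fin n with Monotone I, F I = ∑ i, F fun _ => i := by
  rw [Finset.filter_true_of_mem fun I _ => Subsingleton.monotone I]
  exact Fintype.sum_equiv (Equiv.funUnique (Fin 1) (Fin n)) _ _ fun I =>
    congrArg F (funext fun i => by rw [Subsingleton.elim i 0]; rfl)

theorem sum_monotone_two {R : Type*} [AddCommMonoid R] (F : (Fin 2 → Fin n) → R)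
    [DecidablePred fun I : Fin 2 → Fin n => Monotone I] :
    ∑ I : Fin 2 → Fin n with Monotone I, F I =
      ∑ i, ∑ l, if i ≤ l then F ![i, l] else 0 := by
  rw [Finset.sum_filter, ← Fintype.sum_prod_type'
    (f := fun i l => if i ≤ l then F ![i, l] else 0)]
  refine Fintype.sum_equiv (finTwoArrowEquiv (Fin n)) _ _ fun I => ?_
  have hI : I = ![I 0, I 1] := by ext i; fin_cases i <;> rfl
  have hm : Monotone I ↔ I 0 ≤ I 1 :=
    ⟨fun h => h (by simp), fun h => Fin.monotone_iff_le_succ.2 fun i => by fin_cases i; exact h⟩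
  change _ = if I 0 ≤ I 1 then F ![I 0, I 1] else 0
  rw [← hI]
  simp only [hm]

theorem iterWeakDeriv_zero (I : Fin 0 → Fin n) (Ω : Set (EuclideanSpace ℝ (Fin n)))
    (f : EuclideanSpace ℝ (Fin n) → ℝ) : iterWeakDeriv I Ω f = f := by
  simp [iterWeakDeriv]

theorem iterWeakDeriv_one (I : Fin 1 → Fin n) (Ω : Set (EuclideanSpace ℝ (Fin n)))
    (f : EuclideanSpace ℝ (Fin n) → ℝ) : iterWeakDeriv I Ω f = weakDeriv (I 0) Ω f := by
  simp [iterWeakDeriv]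

theorem iterWeakDeriv_two (I : Fin 2 → Fin n) (Ω : Set (EuclideanSpace ℝ (Fin n)))
    (f : EuclideanSpace ℝ (Fin n) → ℝ) :
    iterWeakDeriv I Ω f = weakDeriv (I 0) Ω (weakDeriv (I 1) Ω f) := by
  simp [iterWeakDeriv, List.ofFn_succ]

theorem SobolevConnection.isSafe (conn : SobolevConnection B) (hB : B.IsSobolev k)
    (hΓ : conn.ChristoffelRegular (k - 1)) (hk : n < 2 * k) :
    IsSafe k 1 B B.hom conn.toFun := by
  refine ⟨by omega, fun j => ?_⟩
  obtain ⟨Γ, hΓ, hreg⟩ := hΓ j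
  refine ⟨fun r => match r with
    | 0 => fun _ y => Matrix.of fun p a => Γ p.1 a p.2 y
    | 1 => fun I _ => Matrix.of fun p a => if I 0 = p.1 ∧ p.2 = a then 1 else 0
    | _ => fun _ _ => 0, ?_, fun u hu => ?_⟩
  · intro r hr I _ p a
    interval_cases r
    -- The second entry of the maximum is $\lfloor n/2\rfloor\le k-1$.
    · have : safeExponent n k 1 0 = k - 1 := by unfold safeExponent; omega
      rw [this]
      exact hreg _ _ _
    · exact memHloc_const (C.chart j).open_target _
  · filter_upwards [ae_all_iff.2 fun i => ae_all_iff.2 fun b => hΓ.coord_eq hB hk hu i b] with y hy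
    ext ⟨i, b⟩
    rw [Finset.sum_range_succ, Finset.sum_range_one, sum_monotone_zero, sum_monotone_one]
    simp only [iterWeakDeriv_zero, iterWeakDeriv_one, Pi.add_apply, Finset.sum_apply,
      Matrix.mulVec, dotProduct, Matrix.of_apply, ite_mul, one_mul, zero_mul]
    rw [add_comm]
    refine (hy i b).trans (congrArg₂ (· + ·) ?_ rfl)
    simp [ite_and]

end SafeConnection

/-! ## Smooth vector fields -/

section VectorFields

variable {n m : ℕ} {M : Type*} [TopologicalSpace M]
  [ChartedSpace (EuclideanSpace ℝ (Fin n)) M] [IsManifold (𝓡 n) ∞ M] {U W : Set M} {χ : M → ℝ}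
  {ι : Type*} {C : BaseCharts n ι M} {j : ι}

/-- The constant vector field `e_a` on Euclidean space. -/
noncomputable def euclideanVec (a : Fin n) (y : EuclideanSpace ℝ (Fin n)) :
    TangentSpace (𝓡 n) y :=
  (EuclideanSpace.single a 1 : EuclideanSpace ℝ (Fin n))

theorem mlieBracket_euclideanVec (a b : Fin n) (y : EuclideanSpace ℝ (Fin n)) :
    VectorField.mlieBracket (𝓡 n) (euclideanVec a) (euclideanVec b) y = 0 := by
  rw [← VectorField.mlieBracketWithin_univ, VectorField.mlieBracketWithin_eq_lieBracketWithin]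
  change VectorField.lieBracketWithin ℝ
    (fun _ => (EuclideanSpace.single a 1 : EuclideanSpace ℝ (Fin n)))
    (fun _ => EuclideanSpace.single b 1) univ y = 0
  rw [VectorField.lieBracketWithin_univ, VectorField.lieBracket_eq]
  simp

theorem BaseCharts.mfderiv_inverse (C : BaseCharts n ι M) {x : M}
    (hx : x ∈ (C.chart j).source) :
    (mfderiv (𝓡 n) (𝓡 n) (C.chart j) x).IsInvertible ∧
      (mfderiv (𝓡 n) (𝓡 n) (C.chart j) x).inverse =
        mfderiv (𝓡 n) (𝓡 n) (C.chart j).symm (C.chart j x) := by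
  have : IsManifold (𝓡 n) 1 M := IsManifold.of_le (n := ∞) (by simp)
  have h1 := (C.mdifferentiable j).symm_comp_deriv hx
  have h2 := (C.mdifferentiable j).comp_symm_deriv ((C.chart j).map_source hx)
  rw [(C.chart j).left_inv hx] at h2
  exact ⟨ContinuousLinearMap.IsInvertible.of_inverse h2 h1, ContinuousLinearMap.inverse_eq h2 h1⟩

/-- As pullbacks of constant fields, the coordinate fields inherit smoothness and vanishing Lie
brackets. -/
theorem BaseCharts.partialVec_eq_mpullback (C : BaseCharts n ι M) {x : M}
    (hx : x ∈ (C.chart j).source) (a : Fin n) :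
    C.partialVec j a x = VectorField.mpullback (𝓡 n) (𝓡 n) (C.chart j)
      (euclideanVec a) x :=
  (DFunLike.congr_fun (C.mfderiv_inverse hx).2 (euclideanVec a (C.chart j x))).symm

theorem BaseCharts.contMDiffOn_partialVec (C : BaseCharts n ι M) (j : ι) (a : Fin n) :
    ContMDiffOn (𝓡 n) (𝓡 n).tangent ∞
      (fun x => (⟨x, C.partialVec j a x⟩ : TangentBundle (𝓡 n) M)) (C.chart j).source := by
  have : IsManifold (𝓡 n) 1 M := IsManifold.of_le (n := ∞) (by simp)
  intro x hx
  have h := ContMDiffAt.mpullback_vectorField_preimage (I := 𝓡 n) (I' := 𝓡 n) (m := ∞) (n := ∞)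
    (f := C.chart j) (x₀ := x)
    (V := euclideanVec a)
    (contMDiffAt_vectorSpace_iff_contDiffAt.2 contDiffAt_const)
    ((contMDiffOn_of_mem_maximalAtlas (C.mem_maximalAtlas j)).contMDiffAt
      ((C.chart j).open_source.mem_nhds hx)) (C.mfderiv_inverse hx).1 (by simp)
  refine (h.congr_of_eventuallyEq ?_).contMDiffWithinAt
  filter_upwards [(C.chart j).open_source.mem_nhds hx] with z hz
  rw [C.partialVec_eq_mpullback hz]

theorem IsCutoff.isSmoothVectorField (hχ : IsCutoff n (C.chart j).source W χ) (a : Fin n) :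
    IsSmoothVectorField n (fun x => χ x • C.partialVec j a x) :=
  ContMDiffOn.smul_section_of_tsupport hχ.contMDiff.contMDiffOn (C.chart j).open_source
    hχ.tsupport_subset (C.contMDiffOn_partialVec j a)

theorem IsSmoothVectorField.contMDiffOn_coord {Y : ∀ x : M, TangentSpace (𝓡 n) x}
    (hY : IsSmoothVectorField n Y) (C : BaseCharts n ι M) (j : ι) (i : Fin n) :
    ContMDiffOn (𝓡 n) 𝓘(ℝ) ∞ (fun x => C.tangent.coord j x (Y x) i) (C.chart j).source := by
  have : IsManifold (𝓡 n) 1 M := IsManifold.of_le (n := ∞) (by simp)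
  have hS := (C.chart j).open_source
  have h1 := (contMDiffOn_of_mem_maximalAtlas (C.mem_maximalAtlas j)).contMDiffOn_tangentMapWithin
    (m := ∞) (by simp) hS.uniqueMDiffOn
  have h2 := h1.comp (t := Bundle.TotalSpace.proj ⁻¹' (C.chart j).source) (s := (C.chart j).source)
    (ContMDiff.contMDiffOn hY) (fun x hx => hx)
  have h3 := (contMDiff_snd_tangentBundle_modelSpace (n := ∞) (EuclideanSpace ℝ (Fin n))
    (𝓡 n)).comp_contMDiffOn h2
  have h4 : ContDiff ℝ ∞ fun v : EuclideanSpace ℝ (Fin n) => v i :=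
    (EuclideanSpace.proj (𝕜 := ℝ) i).contDiff
  refine (h4.contMDiff.comp_contMDiffOn h3).congr fun x hx => ?_
  have h5 : (tangentMapWithin (𝓡 n) (𝓡 n) (C.chart j) (C.chart j).source ⟨x, Y x⟩).2 =
      mfderiv (𝓡 n) (𝓡 n) (C.chart j) x (Y x) :=
    DFunLike.congr_fun (mfderivWithin_of_isOpen hS hx) (Y x)
  exact congrArg (fun v : EuclideanSpace ℝ (Fin n) => v i) h5.symm

theorem IsSmoothVectorField.memH {Y : ∀ x : M, TangentSpace (𝓡 n) x}
    (hY : IsSmoothVectorField n Y) : C.tangent.MemH m Y := fun j i =>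
  (hY.contMDiffOn_coord C j i).memHlocOn (C.chart j).open_source

theorem IsCutoff.mlieBracket_eq_zero (hχ : IsCutoff n (C.chart j).source W χ) (a b : Fin n)
    {x : M} (hx : x ∈ W) :
    VectorField.mlieBracket (𝓡 n) (fun x => χ x • C.partialVec j a x)
      (fun x => χ x • C.partialVec j b x) x = 0 := by
  have h2 : minSmoothness ℝ 2 ≤ ∞ := by
    simpa using WithTop.coe_le_coe.2 (le_top : (2 : ℕ∞) ≤ ⊤)
  have : IsManifold (𝓡 n) (minSmoothness ℝ 2) M := IsManifold.of_le (n := ∞) h2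
  have h : ∀ c, (fun x => χ x • C.partialVec j c x) =ᶠ[𝓝 x]
      VectorField.mpullback (𝓡 n) (𝓡 n) (C.chart j)
        (euclideanVec c) := fun c => by
    filter_upwards [hχ.isOpen.mem_nhds hx] with z hz
    rw [hχ.eq_one z hz, one_smul, C.partialVec_eq_mpullback (hχ.subset hz)]
  have hV : ∀ c : Fin n, MDifferentiableAt (𝓡 n) (𝓡 n).tangent (fun y =>
      (⟨y, euclideanVec c y⟩ : TangentBundle (𝓡 n) (EuclideanSpace ℝ (Fin n)))) (C.chart j x) := fun c =>
    (contMDiffAt_vectorSpace_iff_contDiffAt (n := 1).2 contDiffAt_const).mdifferentiableAt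
      one_ne_zero
  rw [Filter.EventuallyEq.mlieBracket_vectorField_eq (h a) (h b),
    ← VectorField.mpullback_mlieBracket (n := ∞) (hV a) (hV b)
      ((contMDiffOn_of_mem_maximalAtlas (C.mem_maximalAtlas j)).contMDiffAt
        ((C.chart j).open_source.mem_nhds (hχ.subset hx))) h2,
    VectorField.mpullback_apply, mlieBracket_euclideanVec, map_zero]

end VectorFields

/-! ## The Gram matrix of a metric and the Levi-Civita connection -/

section GramMatrix

variable {n p m : ℕ} {M : Type*} [TopologicalSpace M]
  [ChartedSpace (EuclideanSpace ℝ (Fin n)) M] [IsManifold (𝓡 n) ∞ M]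
  {ι : Type*} {C : BaseCharts n ι M} {j : ι}

/-- The Gram matrix `h(∂_a, ∂_b)` in the `j`-th chart. -/
noncomputable def SobolevMetric.gram (h : SobolevMetric C.tangent p) (j : ι)
    (y : EuclideanSpace ℝ (Fin n)) : Matrix (Fin n) (Fin n) ℝ :=
  Matrix.of fun a b => h.inner ((C.chart j).symm y) (C.partialVec j a ((C.chart j).symm y))
    (C.partialVec j b ((C.chart j).symm y))

variable (h : SobolevMetric C.tangent p)

theorem SobolevMetric.memHloc_gram (j : ι) (a b : Fin n) :
    MemHloc p (C.chart j).target (fun y => h.gram j y a b) :=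
  (h.regular j a b).memHloc_chart

theorem SobolevMetric.dotProduct_gram_mulVec {y : EuclideanSpace ℝ (Fin n)}
    (hy : y ∈ (C.chart j).target) (X Y : TangentSpace (𝓡 n) ((C.chart j).symm y)) :
    C.tangent.coord j _ X ⬝ᵥ (h.gram j y).mulVec (C.tangent.coord j _ Y) =
      h.inner ((C.chart j).symm y) X Y := by
  have hx := (C.chart j).map_target hy
  conv_rhs => rw [← C.tangent.sum_coord_smul hx X, ← C.tangent.sum_coord_smul hx Y]
  simp only [map_sum, map_smul, LinearMap.sum_apply, LinearMap.smul_apply, dotProduct,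
    Matrix.mulVec, SobolevMetric.gram, Matrix.of_apply, smul_eq_mul, Finset.mul_sum]
  rw [Finset.sum_comm]
  exact Finset.sum_congr rfl fun a _ => Finset.sum_congr rfl fun b _ => by
    rw [mul_left_comm, mul_comm (h.inner _ _ _), ← mul_assoc,
      mul_comm (C.tangent.coord j ((C.chart j).symm y) X b)]; rfl

theorem SobolevMetric.isSymm_gram (j : ι) (y : EuclideanSpace ℝ (Fin n)) :
    (h.gram j y).IsSymm := by
  ext a b
  exact h.symm _ _ _

theorem SobolevMetric.det_gram_ne_zero {y : EuclideanSpace ℝ (Fin n)}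
    (hy : y ∈ (C.chart j).target) : (h.gram j y).det ≠ 0 := by
  intro h0
  obtain ⟨v, hv, hv0⟩ := Matrix.exists_mulVec_eq_zero_iff.2 h0
  have hx := (C.chart j).map_target hy
  have h1 := h.dotProduct_gram_mulVec hy (C.tangent.frame j _ v) (C.tangent.frame j _ v)
  rw [C.tangent.coord_frame j _ hx, hv0, dotProduct_zero] at h1
  refine (h.pos _ (C.tangent.frame j _ v) fun h2 => hv ?_).ne h1
  rw [← C.tangent.coord_frame j _ hx v, h2, map_zero]

/-- Pointwise positivity only makes the determinant nonzero. The uniform bound, needed for the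
regularity of the inverse, comes from `locally_uniformly_pos`. -/
theorem SobolevMetric.locallyUniformlyPos_det (j : ι) :
    LocallyUniformlyPos (C.chart j).target (fun y => (h.gram j y).det) := by
  intro K hK hKc
  obtain ⟨c, hc, hae⟩ := h.locally_uniformly_pos j K hK hKc
  refine ⟨c ^ Fintype.card (Fin n), pow_pos hc _, ?_⟩
  filter_upwards [hae, ae_restrict_mem hKc.measurableSet] with y hy hyK
  refine pow_card_le_det (h.isSymm_gram j y) hc fun v => (hy v).trans_eq ?_
  rw [← h.dotProduct_gram_mulVec (hK hyK), C.tangent.coord_frame j _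
    ((C.chart j).map_target (hK hyK))]

theorem SobolevMetric.memHloc_gram_inv (hp : n < 2 * p) (j : ι) (a b : Fin n) :
    MemHloc p (C.chart j).target (fun y => (h.gram j y)⁻¹ a b) :=
  MemHloc.matrix_inv hp (C.chart j).open_target (h.memHloc_gram j) (h.locallyUniformlyPos_det j)
    a b

/-- The Christoffel symbols of the Levi-Civita connection:
`Γ i a m = ½ ∑ b, (∂_i h_ab + ∂_a h_ib - ∂_b h_ia) h^bm`. -/
noncomputable def SobolevMetric.leviCivita (h : SobolevMetric C.tangent p) (j : ι)
    (i a m : Fin n) (y : EuclideanSpace ℝ (Fin n)) : ℝ :=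
  ∑ b, (1 / 2) * (weakDeriv i (C.chart j).target (fun z => h.gram j z a b) y +
    weakDeriv a (C.chart j).target (fun z => h.gram j z i b) y -
    weakDeriv b (C.chart j).target (fun z => h.gram j z i a) y) * (h.gram j y)⁻¹ b m

theorem SobolevMetric.memHloc_leviCivita (hp : n < 2 * p) (j : ι) (i a m : Fin n) :
    MemHloc (p - 1) (C.chart j).target (h.leviCivita j i a m) := by
  have hT := (C.chart j).open_target
  have hd : ∀ i a b, MemHloc (p - 1) (C.chart j).target
      (weakDeriv i (C.chart j).target fun z => h.gram j z a b) := fun i a b => by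
    have := h.memHloc_gram j a b
    exact (this.of_le (by omega : p - 1 + 1 ≤ p)).weakDeriv hT i
  refine MemHloc.sum _ hT fun b _ => ?_
  have h1 := MemHloc.mul hp (h.memHloc_gram_inv hp j b m)
    ((((hd i a b).add (hd a i b)).sub (hd b i a)).const_mul (1 / 2)) hT (Nat.sub_le _ _)
  exact h1.congr_on hT fun y _ => mul_comm _ _

variable [T2Space M] [CompactSpace M]

/-- The Koszul formula. Metricity expands $\partial_i h_{ab}$, torsion-freeness gives
$D_i\partial_a=D_a\partial_i$ because coordinate fields commute, and the alternating combination
leaves $2h(D_i\partial_a,\partial_b)$. Both properties concern global fields, hence the cut-off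
coordinate fields. -/
theorem SobolevConnection.IsMetric.isChristoffel_leviCivita {D : SobolevConnection C.tangent}
    (hD : D.IsMetric h) (hT : D.IsTorsionFree) (hp : n < 2 * p) (j : ι) :
    D.IsChristoffel j (h.leviCivita j) := by
  intro a U hU hUS u hu heq i m
  have hTo := (C.chart j).open_target
  rw [ae_restrict_iff' ((C.chart j).isOpen_inter_preimage_symm hU).measurableSet]
  suffices hs : ∀ᵐ y ∂(volume.restrict (C.chart j).target), (C.chart j).symm y ∈ U →
      C.tangent.coord j ((C.chart j).symm y) (D.toFun u ((C.chart j).symm y)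
        (C.partialVec j i ((C.chart j).symm y))) m = h.leviCivita j i a m y by
    rw [ae_restrict_iff' hTo.measurableSet] at hs
    exact hs.mono fun y hy hyT => hy hyT.1 hyT.2
  refine C.ae_of_locally j fun x₀ hx₀ hxU => ?_
  obtain ⟨W, χ, hxW, hχ⟩ := exists_isCutoff (n := n) (C.chart j).open_source hx₀
  refine ⟨W, hχ.isOpen, hxW, ?_⟩
  set Z : Fin n → ∀ x : M, TangentSpace (𝓡 n) x := fun a x => χ x • C.partialVec j a x with hZ
  have hZs : ∀ a, IsSmoothVectorField n (Z a) := fun a => hχ.isSmoothVectorField a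
  have hZW : ∀ a, ∀ x ∈ W, Z a x = C.partialVec j a x := fun a x hx => by
    simp only [hZ, hχ.eq_one x hx, one_smul]
  have h1 : ∀ i a b, ∀ᵐ y ∂(volume.restrict (C.chart j).target), (C.chart j).symm y ∈ W →
      _ = _ := fun i a b =>
    (MemHloc.isWeakDeriv (m := 0) ((h.memHloc_gram j a b).of_le (by omega)) i).ae_eq_of_eqOn
      (hD (Z a) (Z b) (hZs a).memH (hZs b).memH j i) hχ.isOpen fun y _ hy => by
        rw [hZW a _ hy, hZW b _ hy]; rfl
  have h2 : ∀ i a, ∀ᵐ y ∂(volume.restrict (C.chart j).target), (C.chart j).symm y ∈ W →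
      D.toFun (Z a) ((C.chart j).symm y) (C.partialVec j i ((C.chart j).symm y)) =
      D.toFun (Z i) ((C.chart j).symm y) (C.partialVec j a ((C.chart j).symm y)) := fun i a => by
    filter_upwards [hT (Z i) (Z a) (hZs i) (hZs a) j] with y hy hyW
    rw [hχ.mlieBracket_eq_zero i a hyW, sub_eq_zero, hZW i _ hyW, hZW a _ hyW] at hy
    exact hy
  filter_upwards [ae_all_iff.2 fun i => ae_all_iff.2 fun a => ae_all_iff.2 fun b => h1 i a b,
    ae_all_iff.2 fun i => ae_all_iff.2 fun a => h2 i a,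
    D.toFun_eq_of_eqOn hu ((hZs a).memH) (hU.inter hχ.isOpen)
      (fun x hx => (heq x hx.1).trans (hZW a x hx.2).symm) j,
    ae_restrict_mem hTo.measurableSet] with y h1 h2 h3 hyT hyW hyU
  rw [h3 ⟨hyU, hyW⟩]
  set x := (C.chart j).symm y with hx
  set S := D.toFun (Z a) x (C.partialVec j i x) with hS
  have hK : ∀ b, (1 / 2) * (weakDeriv i (C.chart j).target (fun z => h.gram j z a b) y +
      weakDeriv a (C.chart j).target (fun z => h.gram j z i b) y -
      weakDeriv b (C.chart j).target (fun z => h.gram j z i a) y) =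
      h.inner x S (C.partialVec j b x) := fun b => by
    rw [h1 i a b hyW, h1 a i b hyW, h1 b i a hyW]
    simp only [hZW _ _ hyW]
    rw [h2 a i hyW, h2 b i hyW, h2 b a hyW, h.symm _ (C.partialVec j a x),
      h.symm _ (C.partialVec j i x)]
    ring
  -- The Koszul formula determines the covector `h(S, ·)`; the components of `S` follow by inverting
  -- the Gram matrix.
  have hc : Matrix.vecMul (C.tangent.coord j x S) (h.gram j y) =
      fun b => h.inner x S (C.partialVec j b x) := by
    funext b
    have := h.dotProduct_gram_mulVec hyT S (C.partialVec j b x)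
    rw [← this, Matrix.dotProduct_mulVec]
    have hb : C.tangent.coord j x (C.partialVec j b x) = Pi.single b 1 :=
      C.tangent.coord_basisSection ((C.chart j).map_target hyT) b
    rw [hb, dotProduct_single, mul_one]
  have hinv : C.tangent.coord j x S =
      Matrix.vecMul (fun b => h.inner x S (C.partialVec j b x)) (h.gram j y)⁻¹ := by
    rw [← hc, Matrix.vecMul_vecMul, Matrix.mul_nonsing_inv _
      (isUnit_iff_ne_zero.2 (h.det_gram_ne_zero hyT)), Matrix.vecMul_one]
  rw [hinv]
  simp only [SobolevMetric.leviCivita, hK, Matrix.vecMul, dotProduct]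

end GramMatrix

/-! ## The induced connection on `Hom(TM, V)` -/

/-! ### Basis independence of the metric trace -/

section Trace

variable {T F : Type*} [AddCommGroup T] [Module ℝ T] [Module.Finite ℝ T]
    [AddCommGroup F] [Module ℝ F]

/-- The metric trace can be computed in any basis. -/
theorem metricTrace_eq {κ : Type*} [Fintype κ] [DecidableEq κ] (h : T →ₗ[ℝ] T →ₗ[ℝ] ℝ)
    (W : T →ₗ[ℝ] T →ₗ[ℝ] F) (b : κ → T) (c : T →ₗ[ℝ] κ → ℝ) (hb : ∀ v, ∑ k, c v k • b k = v)
    (hc : ∀ k, c (b k) = Pi.single k 1)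
    (hG : (Matrix.of fun k l => h (b k) (b l)).det ≠ 0) :
    metricTrace h W = ∑ k, ∑ l, ((Matrix.of fun k l => h (b k) (b l))⁻¹ k l) • W (b k) (b l) := by
  classical
  set f := Module.finBasis ℝ T
  set G : Matrix κ κ ℝ := Matrix.of fun k l => h (b k) (b l) with hGdef
  set P : Matrix (Fin (Module.finrank ℝ T)) κ ℝ := Matrix.of fun i k => c (f i) k with hP
  set R : Matrix κ (Fin (Module.finrank ℝ T)) ℝ := Matrix.of fun k i => f.repr (b k) i with hR
  have hf : ∀ i, ∑ k, P i k • b k = f i := fun i => hb (f i)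
  have hbk : ∀ k, ∑ i, R k i • f i = b k := fun k => f.sum_repr (b k)
  have hPR : P * R = 1 := by
    ext i i'
    have h1 := congrArg (fun v => f.repr v i') (hf i)
    simp only [map_sum, map_smul, Finsupp.coe_finsetSum, Finset.sum_apply, Finsupp.smul_apply,
      f.repr_self, smul_eq_mul] at h1
    rw [Matrix.mul_apply, Matrix.one_apply]
    exact h1.trans (by rw [Finsupp.single_apply])
  have hRP : R * P = 1 := by
    ext k l
    have h1 := congrArg (fun v => c v l) (hbk k)
    simp only [map_sum, map_smul, Finset.sum_apply, Pi.smul_apply, hc, smul_eq_mul] at h1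
    rw [Matrix.mul_apply, Matrix.one_apply]
    exact h1.trans (by rw [Pi.single_apply]; simp only [eq_comm])
  -- The Gram matrix transforms by congruence and its inverse by the inverse congruence, which
  -- compensates the change of basis in `W`.
  have hGf : (Matrix.of fun i i' => h (f i) (f i')) = P * G * P.transpose := by
    ext i i'
    conv_lhs => rw [Matrix.of_apply, ← hf i, ← hf i']
    simp only [map_sum, map_smul, LinearMap.sum_apply, LinearMap.smul_apply, Matrix.mul_apply,
      Matrix.transpose_apply, hGdef, Matrix.of_apply, smul_eq_mul, Finset.sum_mul, Finset.mul_sum]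
    exact Finset.sum_congr rfl fun k _ => Finset.sum_congr rfl fun l _ => by ring
  have hGi : G * G⁻¹ = 1 := Matrix.mul_nonsing_inv _ (isUnit_iff_ne_zero.2 hG)
  have hinv : (Matrix.of fun i i' => h (f i) (f i'))⁻¹ = R.transpose * G⁻¹ * R := by
    refine Matrix.inv_eq_right_inv ?_
    calc (Matrix.of fun i i' => h (f i) (f i')) * (R.transpose * G⁻¹ * R)
        = P * G * (P.transpose * R.transpose) * G⁻¹ * R := by
          rw [hGf]; simp only [Matrix.mul_assoc]
      _ = P * (G * G⁻¹) * R := by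
          rw [← Matrix.transpose_mul, hRP, Matrix.transpose_one, Matrix.mul_one, Matrix.mul_assoc P]
      _ = 1 := by rw [hGi, Matrix.mul_one, hPR]
  have hE : ∀ k l, W (b k) (b l) = ∑ i, ∑ i', (R k i * R l i') • W (f i) (f i') := fun k l => by
    conv_lhs => rw [← hbk k, ← hbk l]
    simp only [map_sum, map_smul, LinearMap.sum_apply, LinearMap.smul_apply, smul_smul,
      Finset.smul_sum]
    rw [Finset.sum_comm]
    exact Finset.sum_congr rfl fun i _ => Finset.sum_congr rfl fun i' _ => by rw [mul_comm]
  unfold metricTrace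
  simp only [hE, Finset.smul_sum, smul_smul]
  change ∑ i, ∑ i', ((Matrix.of fun i i' => h (f i) (f i'))⁻¹ i i') • W (f i) (f i') = _
  rw [hinv]
  simp only [Matrix.mul_apply, Matrix.transpose_apply, Finset.sum_mul, Finset.sum_smul]
  simp only [← Finset.sum_product']
  exact Finset.sum_nbij' (fun q => (q.2.2.2, q.2.2.1, q.1, q.2.1))
    (fun q => (q.2.2.1, q.2.2.2, q.2.1, q.1)) (by simp) (by simp) (by simp) (by simp)
    fun q _ => by congr 1; ring

end Trace

/-! ### Existence and local form of the induced connection -/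

section InducedConnection

variable {n m k : ℕ} {M : Type*} [TopologicalSpace M]
  [ChartedSpace (EuclideanSpace ℝ (Fin n)) M] [IsManifold (𝓡 n) ∞ M] {U W : Set M} {f χ : M → ℝ}
  {ι : Type*} {C : BaseCharts n ι M} {j : ι} {κ : Type} {V : M → Type*}
  [∀ x, AddCommGroup (V x)] [∀ x, Module ℝ (V x)] {B : BundleCharts C κ V}
  {w : ∀ x : M, TangentSpace (𝓡 n) x →ₗ[ℝ] V x} {Y : ∀ x : M, TangentSpace (𝓡 n) x}

theorem BundleCharts.hom_coord (B : BundleCharts C κ V) (j : ι) (x : M)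
    (w : TangentSpace (𝓡 n) x →ₗ[ℝ] V x) (l : Fin n) (b : κ) :
    B.hom.coord j x w (l, b) = B.coord j x (w (C.partialVec j l x)) b := rfl

theorem BaseCharts.sum_coord_smul_partialVec (C : BaseCharts n ι M) {x : M}
    (hx : x ∈ (C.chart j).source) (X : TangentSpace (𝓡 n) x) :
    ∑ l, C.tangent.coord j x X l • C.partialVec j l x = X :=
  C.tangent.sum_coord_smul hx X

/-- The evaluation of a Sobolev section of `Hom(TM, V)` on a smooth vector field. -/
theorem BundleCharts.MemH.apply (hw : B.hom.MemH m w) (hY : IsSmoothVectorField n Y) :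
    B.MemH m (fun x => w x (Y x)) := fun j b => by
  have hS := (C.chart j).open_source
  refine (MemHlocOn.sum Finset.univ hS fun l _ =>
    (hw j (l, b)).smooth_mul hS (hY.contMDiffOn_coord C j l)).congr_on hS fun x hx => ?_
  change _ = B.coord j x (w x (Y x)) b
  conv_rhs => rw [← C.sum_coord_smul_partialVec hx (Y x)]
  simp only [map_sum, map_smul, Finset.sum_apply, Pi.smul_apply, smul_eq_mul, B.hom_coord]

variable (conn : SobolevConnection B) (D : SobolevConnection C.tangent)

variable [T2Space M] [CompactSpace M]

/-- The expression defining the induced connection is tensorial in the vector field. -/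
theorem IsCutoff.sum_smul_induced (hχ : IsCutoff n (C.chart j).source W χ)
    (hw : B.hom.MemH 1 w) (hY : IsSmoothVectorField n Y) :
    C.AE fun x => x ∈ W → ∀ X : TangentSpace (𝓡 n) x,
      ∑ l, C.tangent.coord j x (Y x) l •
        (conn.toFun (fun z => w z (χ z • C.partialVec j l z)) x X -
          w x (D.toFun (fun z => χ z • C.partialVec j l z) x X)) =
      conn.toFun (fun z => w z (Y z)) x X - w x (D.toFun Y x X) := by
  set Z : Fin n → ∀ x : M, TangentSpace (𝓡 n) x := fun l z => χ z • C.partialVec j l z with hZ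
  set F : Fin n → M → ℝ := fun l x => χ x * C.tangent.coord j x (Y x) l with hFdef
  have hZs : ∀ l, IsSmoothVectorField n (Z l) := fun l => hχ.isSmoothVectorField l
  have hFs : ∀ l, ContMDiff (𝓡 n) 𝓘(ℝ) ∞ (F l) := fun l =>
    hχ.contMDiff_mul (C.chart j).open_source (hY.contMDiffOn_coord C j l)
  have hF : ∀ l, MemHlocOn n 1 univ (F l) := fun l => (hFs l).contMDiffOn.memHlocOn isOpen_univ
  have hYZ : ∀ x ∈ W, Y x = ∑ l, F l x • Z l x := fun x hx => by
    simp only [hFdef, hZ, hχ.eq_one x hx, one_mul, one_smul]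
    exact (C.sum_coord_smul_partialVec (hχ.subset hx) _).symm
  have hwYZ : ∀ x ∈ W, w x (Y x) = ∑ l, F l x • w x (Z l x) := fun x hx => by
    conv_lhs => rw [hYZ x hx]
    simp only [map_sum, map_smul]
  have hwZ : ∀ l, B.MemH 1 fun x => w x (Z l x) := fun l => hw.apply (hZs l)
  have hZ1 : ∀ l, C.tangent.MemH 1 (Z l) := fun l => (hZs l).memH
  suffices h : C.AE fun x => x ∈ W →
      (∑ l, C.tangent.coord j x (Y x) l •
        (conn.toFun (fun z => w z (Z l z)) x - w x ∘ₗ D.toFun (Z l) x)) =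
      conn.toFun (fun z => w z (Y z)) x - w x ∘ₗ D.toFun Y x by
    refine h.mono fun x hx hxW X => ?_
    simpa only [LinearMap.sum_apply, LinearMap.smul_apply, LinearMap.sub_apply,
      LinearMap.comp_apply] using DFunLike.congr_fun (hx hxW) X
  refine C.AE_ext fun j' i => ?_
  filter_upwards [conn.toFun_eq_sum (hw.apply hY) hχ.isOpen hF hwZ
      (fun l => (hwZ l).smooth_smul (hFs l)) hwYZ j' i,
    D.toFun_eq_sum hY.memH hχ.isOpen hF hZ1 (fun l => (hZ1 l).smooth_smul (hFs l)) hYZ j' i]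
    with y h1 h2 hyW
  simp only [LinearMap.sum_apply, LinearMap.smul_apply, LinearMap.sub_apply,
    LinearMap.comp_apply]
  rw [h1 hyW, h2 hyW, map_sum, ← Finset.sum_sub_distrib]
  refine Finset.sum_congr rfl fun l _ => ?_
  have hFl : F l ((C.chart j').symm y) = C.tangent.coord j _ (Y ((C.chart j').symm y)) l := by
    simp only [hFdef, hχ.eq_one _ hyW, one_mul]
  -- The terms with derivatives of `F l` occur in both Leibniz expansions and cancel.
  rw [map_add, (w _).map_smul (weakDeriv _ _ _ y), (w _).map_smul (F l _),
    add_sub_add_left_eq_sub, ← smul_sub, hFl]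

/-- At each point the defining expression is evaluated on a cut-off coordinate frame and extended
linearly in `Y`. The frame is selected by the point alone, and tensoriality makes the result correct
for every smooth `Y`. -/
theorem exists_isInducedConnection : ∃ conn', IsInducedConnection conn D conn' := by
  have hcut : ∀ x₀ : M, ∃ j W χ, x₀ ∈ W ∧ IsCutoff n (C.chart j).source W χ := fun x₀ =>
    let ⟨j, hj⟩ := C.cover x₀
    let ⟨W, χ, h⟩ := exists_isCutoff (n := n) (C.chart j).open_source hj
    ⟨j, W, χ, h⟩
  choose J W χ hxW hχ using hcut
  obtain ⟨t, -, ht⟩ := isCompact_univ.elim_nhds_subcover W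
    fun x _ => (hχ x).isOpen.mem_nhds (hxW x)
  have hsel : ∀ x : M, ∃ x₀ ∈ t, x ∈ W x₀ := fun x => by simpa using ht (mem_univ x)
  choose sel hselt hselW using hsel
  refine ⟨fun w x => ∑ l, (LinearMap.smulRightₗ
    (LinearMap.proj l ∘ₗ C.tangent.coord (J (sel x)) x)) ∘ₗ
      (conn.toFun (fun z => w z (χ (sel x) z • C.partialVec (J (sel x)) l z)) x -
        w x ∘ₗ D.toFun (fun z => χ (sel x) z • C.partialVec (J (sel x)) l z) x),
    fun w hw Y hY j' => ?_⟩
  -- Only finitely many frames are ever selected, so their exceptional sets have a null union.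
  filter_upwards [(Finset.eventually_all t).2 fun x₀ _ =>
    (hχ x₀).sum_smul_induced conn D hw hY j'] with y hy X
  rw [← hy _ (hselt _) (hselW _) X]
  simp

/-- The local expression of the induced connection. -/
theorem IsInducedConnection.coord_eq [Fintype κ] [DecidableEq κ] {conn : SobolevConnection B}
    {D : SobolevConnection C.tangent} {conn'} (h : IsInducedConnection conn D conn')
    {Γ : Fin n → κ → κ → EuclideanSpace ℝ (Fin n) → ℝ} (hΓ : conn.IsChristoffel j Γ)
    {Λ : Fin n → Fin n → Fin n → EuclideanSpace ℝ (Fin n) → ℝ} (hΛ : D.IsChristoffel j Λ)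
    (hB : B.IsSobolev k) (hk : n < 2 * k) (hw : B.hom.MemH 1 w) (i l : Fin n) (b : κ) :
    ∀ᵐ y ∂(volume.restrict (C.chart j).target),
      B.coord j ((C.chart j).symm y) (conn' w ((C.chart j).symm y)
        (C.partialVec j i ((C.chart j).symm y)) (C.partialVec j l ((C.chart j).symm y))) b =
      weakDeriv i (C.chart j).target (fun z => B.hom.localRep j w z (l, b)) y +
        ∑ a, Γ i a b y * B.hom.localRep j w y (l, a) -
        ∑ m, Λ i l m y * B.hom.localRep j w y (m, b) := by
  have hT := (C.chart j).open_target.measurableSet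
  suffices hs : ∀ᵐ y ∂(volume.restrict (C.chart j).target),
      (C.chart j).symm y ∈ (C.chart j).source →
      B.coord j ((C.chart j).symm y) (conn' w ((C.chart j).symm y)
        (C.partialVec j i ((C.chart j).symm y)) (C.partialVec j l ((C.chart j).symm y))) b =
      weakDeriv i (C.chart j).target (fun z => B.hom.localRep j w z (l, b)) y +
        ∑ a, Γ i a b y * B.hom.localRep j w y (l, a) -
        ∑ m, Λ i l m y * B.hom.localRep j w y (m, b) by
    filter_upwards [hs, ae_restrict_mem hT] with y hy hyT using hy ((C.chart j).map_target hyT)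
  refine C.ae_of_locally j fun x₀ hx₀ _ => ?_
  obtain ⟨W, χ, hxW, hχ⟩ := exists_isCutoff (n := n) (C.chart j).open_source hx₀
  refine ⟨W, hχ.isOpen, hxW, ?_⟩
  -- The defining identity is tested with a globally smooth field that equals `∂_l` on `W`.
  set Z : ∀ x : M, TangentSpace (𝓡 n) x := fun z => χ z • C.partialVec j l z with hZ
  have hZs : IsSmoothVectorField n Z := hχ.isSmoothVectorField l
  have hZW : ∀ x ∈ W, Z x = C.partialVec j l x := fun x hx => by
    simp only [hZ, hχ.eq_one x hx, one_smul]
  have hwZ : B.MemH 1 (fun x => w x (Z x)) := hw.apply hZs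
  have hrep : ∀ a, ∀ y, (C.chart j).symm y ∈ W →
      B.localRep j (fun x => w x (Z x)) y a = B.hom.localRep j w y (l, a) := fun a y hy => by
    simp only [BundleCharts.localRep, hZW _ hy]; rfl
  have hd : ∀ᵐ y ∂(volume.restrict (C.chart j).target), (C.chart j).symm y ∈ W → _ = _ :=
    ((hwZ.memHloc j b).isWeakDeriv i).ae_eq_of_eqOn
      ((hw.memHloc j (l, b)).isWeakDeriv i) hχ.isOpen fun y _ hy => hrep b y hy
  have hΛW : ∀ m, ∀ᵐ y ∂(volume.restrict (C.chart j).target), (C.chart j).symm y ∈ W →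
      C.tangent.coord j ((C.chart j).symm y) (D.toFun Z ((C.chart j).symm y)
        (C.partialVec j i ((C.chart j).symm y))) m = Λ i l m y := fun m => by
    have h := hΛ l W hχ.isOpen hχ.subset Z hZs.memH hZW i m
    rw [ae_restrict_iff' ((C.chart j).isOpen_inter_preimage_symm hχ.isOpen).measurableSet] at h
    rw [ae_restrict_iff' hT]
    exact h.mono fun y hy hyT hyW => hy ⟨hyT, hyW⟩
  filter_upwards [h w hw Z hZs j, hΓ.coord_eq hB hk hwZ i b, hd, ae_all_iff.2 hΛW,
    ae_restrict_mem hT] with y h1 h2 h3 h4 hyT hyW _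
  have hyS := (C.chart j).map_target hyT
  rw [← hZW _ hyW, h1, map_sub, Pi.sub_apply, h2, h3 hyW]
  simp only [hrep _ y hyW]
  congr 1
  conv_lhs => rw [← C.sum_coord_smul_partialVec hyS (D.toFun Z ((C.chart j).symm y) _)]
  simp only [map_sum, map_smul, Finset.sum_apply, Pi.smul_apply, smul_eq_mul, h4 _ hyW]
  rfl

end InducedConnection

/-! ## The Bochner Laplacian -/

section CovariantDerivative

variable {n k : ℕ} {M : Type*} [TopologicalSpace M]
  [ChartedSpace (EuclideanSpace ℝ (Fin n)) M]
  {ι : Type*} {C : BaseCharts n ι M} {j : ι} {κ : Type} {V : M → Type*}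
  [∀ x, AddCommGroup (V x)] [∀ x, Module ℝ (V x)] {B : BundleCharts C κ V} {u : ∀ x, V x}

/-- Regularity of first order can be checked in the given charts. -/
theorem MemHlocOn.of_chart {f : M → ℝ}
    (hf : MemHloc 1 (C.chart j).target (fun y => f ((C.chart j).symm y))) :
    MemHlocOn n 1 (C.chart j).source f := fun φ hφ => by
  have hΩ := (C.chart j).isOpen_inter_preimage_symm φ.open_source
  have hΩ' := φ.isOpen_inter_preimage_symm (C.chart j).open_source
  refine MemHloc.congr_on ((hf.mono inter_subset_left).comp_diffeo hΩ hΩ'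
    (Φ := fun y => C.chart j (φ.symm y)) (Ψ := fun y => φ ((C.chart j).symm y)) ?_ ?_ ?_ ?_) hΩ' ?_
  · exact contMDiffOn_iff_contDiffOn.1
      ((contMDiffOn_of_mem_maximalAtlas (C.mem_maximalAtlas j)).comp
        ((contMDiffOn_symm_of_mem_maximalAtlas hφ).mono inter_subset_left) fun y hy => hy.2)
  · exact contMDiffOn_iff_contDiffOn.1
      ((contMDiffOn_of_mem_maximalAtlas hφ).comp
        ((contMDiffOn_symm_of_mem_maximalAtlas (C.mem_maximalAtlas j)).mono inter_subset_left)
        fun y hy => hy.2)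
  · intro y hy
    refine ⟨(C.chart j).map_source hy.2, ?_⟩
    rw [mem_preimage, (C.chart j).left_inv hy.2]
    exact φ.map_target hy.1
  · intro y hy
    rw [(C.chart j).left_inv hy.2, φ.right_inv hy.1]
  · intro y hy
    rw [(C.chart j).left_inv hy.2]

variable [IsManifold (𝓡 n) ∞ M]

theorem coord_bochnerLaplacian {p : ℕ} (h : SobolevMetric C.tangent p)
    (conn : SobolevConnection B) (conn') (u : ∀ x, V x) {y : EuclideanSpace ℝ (Fin n)}
    (hy : y ∈ (C.chart j).target) (b : κ) :
    B.localRep j (bochnerLaplacian h conn conn' u) y b =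
      ∑ i, ∑ l, (h.gram j y)⁻¹ i l *
        B.coord j ((C.chart j).symm y) (conn' (conn.toFun u) ((C.chart j).symm y)
          (C.partialVec j i ((C.chart j).symm y)) (C.partialVec j l ((C.chart j).symm y))) b := by
  have hx := (C.chart j).map_target hy
  have : Module.Finite ℝ (TangentSpace (𝓡 n) ((C.chart j).symm y)) :=
    inferInstanceAs (Module.Finite ℝ (EuclideanSpace ℝ (Fin n)))
  have h1 := metricTrace_eq (h.inner ((C.chart j).symm y))
    (conn' (conn.toFun u) ((C.chart j).symm y))
    (fun l => C.partialVec j l ((C.chart j).symm y)) (C.tangent.coord j ((C.chart j).symm y))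
    (C.sum_coord_smul_partialVec hx) (fun l => C.tangent.coord_basisSection hx l)
    (h.det_gram_ne_zero hy)
  have h2 : B.localRep j (bochnerLaplacian h conn conn' u) y =
    B.coord j ((C.chart j).symm y) (metricTrace (h.inner ((C.chart j).symm y))
      (conn' (conn.toFun u) ((C.chart j).symm y))) := rfl
  rw [h2, h1]
  simp only [map_sum, map_smul, Finset.sum_apply, Pi.smul_apply, smul_eq_mul]
  rfl

variable [T2Space M] [CompactSpace M]

/-- The induced connection is determined only on sections of class $H^1$, so this legitimates the
composition. The products $\Gamma u$ stay in $H^1$ because $k-1>n/2$ and $1\le k-1$. -/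
theorem SobolevConnection.memH_one [Fintype κ] [DecidableEq κ] (conn : SobolevConnection B)
    (hB : B.IsSobolev k) (hΓ : conn.ChristoffelRegular (k - 1)) (hk : n < 2 * (k - 1))
    (hu : B.MemH 2 u) : B.hom.MemH 1 (conn.toFun u) := by
  rintro j ⟨l, b⟩
  obtain ⟨Γ, hΓ, hreg⟩ := hΓ j
  have hT := (C.chart j).open_target
  have hu1 : B.MemH 1 u := hu.of_le one_le_two
  refine MemHlocOn.of_chart (MemHloc.congr ?_ hT
    ((hΓ.coord_eq hB (by omega) hu1 l b).mono fun y hy => hy.symm))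
  exact ((hu.memHloc j b).weakDeriv hT l).add (MemHloc.sum _ hT fun a _ =>
    MemHloc.mul hk (hreg l a b) (hu1.memHloc j a) hT (by omega))

/-- The local expression of the second covariant derivative. -/
theorem IsInducedConnection.coord_toFun_eq [Fintype κ] [DecidableEq κ]
    {conn : SobolevConnection B} {D : SobolevConnection C.tangent} {conn'}
    (h : IsInducedConnection conn D conn')
    (hreg : conn.ChristoffelRegular (k - 1))
    {Γ : Fin n → κ → κ → EuclideanSpace ℝ (Fin n) → ℝ} (hΓ : conn.IsChristoffel j Γ)
    (hΓr : ∀ i a b, MemHloc (k - 1) (C.chart j).target (Γ i a b))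
    {Λ : Fin n → Fin n → Fin n → EuclideanSpace ℝ (Fin n) → ℝ} (hΛ : D.IsChristoffel j Λ)
    (hB : B.IsSobolev k) (hk : n < 2 * (k - 1)) (hu : B.MemH 2 u) (i l : Fin n) (b : κ) :
    ∀ᵐ y ∂(volume.restrict (C.chart j).target),
      B.coord j ((C.chart j).symm y) (conn' (conn.toFun u) ((C.chart j).symm y)
        (C.partialVec j i ((C.chart j).symm y)) (C.partialVec j l ((C.chart j).symm y))) b =
      (weakDeriv i (C.chart j).target (weakDeriv l (C.chart j).target
          fun z => B.localRep j u z b) y +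
        ∑ a, (weakDeriv i (C.chart j).target (Γ l a b) y * B.localRep j u y a +
          Γ l a b y * weakDeriv i (C.chart j).target (fun z => B.localRep j u z a) y)) +
        ∑ a, Γ i a b y * (weakDeriv l (C.chart j).target (fun z => B.localRep j u z a) y +
          ∑ c, Γ l c a y * B.localRep j u y c) -
        ∑ m, Λ i l m y * (weakDeriv m (C.chart j).target (fun z => B.localRep j u z b) y +
          ∑ a, Γ m a b y * B.localRep j u y a) := by
  have hT := (C.chart j).open_target
  have hu1 : B.MemH 1 u := hu.of_le one_le_two
  have hw := conn.memH_one hB hreg hk hu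
  have hΓ1 : ∀ i a b, MemHloc 1 (C.chart j).target (Γ i a b) := fun i a b =>
    (hΓr i a b).of_le (by omega)
  have hrep := fun l b => hΓ.coord_eq hB (by omega) hu1 l b
  -- The local formula for `∇u` is differentiated termwise; uniqueness of weak derivatives then
  -- identifies the result with the chosen `weakDeriv`.
  have hd : IsWeakDeriv i (C.chart j).target _ _ :=
    ((((hu.memHloc j b).weakDeriv hT l).isWeakDeriv i).add
      (IsWeakDeriv.sum Finset.univ hT fun a _ =>
        ((hΓ1 l a b).isWeakDeriv i).mul ((hu1.memHloc j a).isWeakDeriv i) hT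
          (hΓ1 l a b).memL2loc ((hΓ1 l a b).weakDeriv hT i)
          (hu1.memHloc j a).memL2loc ((hu1.memHloc j a).weakDeriv hT i)))
  have hd' := ((hw.memHloc j (l, b)).isWeakDeriv i).ae_eq
    (hd.congr hT ((hrep l b).mono fun y hy => hy.symm) (ae_eq_refl _)) hT
  filter_upwards [h.coord_eq hΓ hΛ hB (by omega) hw i l b, hd',
    ae_all_iff.2 fun l => ae_all_iff.2 fun b => hrep l b] with y h1 h2 h3
  have h4 : ∀ l b, B.hom.localRep j (conn.toFun u) y (l, b) = _ := h3
  rw [h1, h2]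
  simp only [h4]

end CovariantDerivative

/-! ### Coefficients of the Bochner Laplacian -/

section LaplacianIsSafe

variable {n k : ℕ}

/-- The safe form admits only ordered index tuples. Mixed second derivatives are therefore merged,
and off-diagonal coefficients add up. -/
theorem sum_mul_symm_eq_sum_le (g t : Fin n → Fin n → ℝ) (ht : ∀ i l, t i l = t l i) :
    ∑ i, ∑ l, g i l * t i l =
      ∑ i, ∑ l, if i ≤ l then (if i = l then g i i else g i l + g l i) * t i l else 0 := by
  have h1 : ∑ i, ∑ l, g i l * t i l = ∑ i, ∑ l, (if i ≤ l then g i l * t i l else 0) +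
      ∑ i, ∑ l, (if l < i then g i l * t i l else 0) := by
    simp only [← Finset.sum_add_distrib]
    refine Finset.sum_congr rfl fun i _ => Finset.sum_congr rfl fun l _ => ?_
    by_cases h : i ≤ l
    · simp [h, not_lt.2 h]
    · simp [h, not_le.1 h]
  rw [h1, Finset.sum_comm (f := fun i l => if l < i then g i l * t i l else 0)]
  simp only [← Finset.sum_add_distrib]
  refine Finset.sum_congr rfl fun i _ => Finset.sum_congr rfl fun l _ => ?_
  rcases lt_trichotomy i l with h | h | h
  · simp only [h, h.le, h.ne, if_true, if_false, ht l i]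
    ring
  · simp [h]
  · simp [not_le.2 h, not_lt.2 h.le]

/-- Collecting the terms of order zero, one and two in the second covariant derivative. -/
theorem sum_collect_orders {κ : Type*} [Fintype κ] [DecidableEq κ] (b : κ)
    (g : Fin n → Fin n → ℝ) (dd : Fin n → Fin n → κ → ℝ) (d : Fin n → κ → ℝ) (u : κ → ℝ)
    (dΓ : Fin n → Fin n → κ → κ → ℝ) (Γ : Fin n → κ → κ → ℝ) (Λ : Fin n → Fin n → Fin n → ℝ)
    (hdd : ∀ i l a, dd i l a = dd l i a) :
    ∑ i, ∑ l, g i l * ((dd i l b + ∑ a, (dΓ i l a b * u a + Γ l a b * d i a)) +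
        ∑ a, Γ i a b * (d l a + ∑ c, Γ l c a * u c) -
        ∑ m, Λ i l m * (d m b + ∑ a, Γ m a b * u a)) =
      ∑ a, (∑ i, ∑ l, g i l * (dΓ i l a b + ∑ c, Γ i c b * Γ l a c -
          ∑ m, Λ i l m * Γ m a b)) * u a +
      ∑ m, ∑ a, (∑ l, g m l * Γ l a b + ∑ l, g l m * Γ l a b -
          (if a = b then 1 else 0) * ∑ i, ∑ l, g i l * Λ i l m) * d m a +
      ∑ i, ∑ l, if i ≤ l then
        ∑ a, ((if a = b then 1 else 0) * (if i = l then g i i else g i l + g l i)) * dd i l a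
        else 0 := by
  have h0 : ∀ X : κ → Fin n → Fin n → ℝ, ∑ a, (∑ i, ∑ l, g i l * X a i l) * u a =
      ∑ i, ∑ l, g i l * ∑ a, X a i l * u a := fun X => by
    simp only [Finset.sum_mul, Finset.mul_sum]
    rw [Finset.sum_comm]
    refine Finset.sum_congr rfl fun i _ => ?_
    rw [Finset.sum_comm]
    exact Finset.sum_congr rfl fun l _ => Finset.sum_congr rfl fun a _ => by ring
  have h1 : ∑ m, ∑ a, (∑ l, g m l * Γ l a b + ∑ l, g l m * Γ l a b -
      (if a = b then 1 else 0) * ∑ i, ∑ l, g i l * Λ i l m) * d m a =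
      ∑ i, ∑ l, g i l * (∑ a, Γ l a b * d i a + ∑ a, Γ i a b * d l a -
        ∑ m, Λ i l m * d m b) := by
    have e1 : ∑ m, ∑ a, (∑ l, g m l * Γ l a b) * d m a =
        ∑ i, ∑ l, g i l * ∑ a, Γ l a b * d i a := by
      simp only [Finset.sum_mul, Finset.mul_sum]
      refine Finset.sum_congr rfl fun i _ => ?_
      rw [Finset.sum_comm]
      exact Finset.sum_congr rfl fun l _ => Finset.sum_congr rfl fun a _ => by ring
    have e2 : ∑ m, ∑ a, (∑ l, g l m * Γ l a b) * d m a =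
        ∑ i, ∑ l, g i l * ∑ a, Γ i a b * d l a := by
      rw [Finset.sum_comm (f := fun i l => g i l * ∑ a, Γ i a b * d l a)]
      simp only [Finset.sum_mul, Finset.mul_sum]
      refine Finset.sum_congr rfl fun i _ => ?_
      rw [Finset.sum_comm]
      exact Finset.sum_congr rfl fun l _ => Finset.sum_congr rfl fun a _ => by ring
    have e3 : ∑ m, ∑ a, ((if a = b then 1 else 0) * ∑ i, ∑ l, g i l * Λ i l m) * d m a =
        ∑ i, ∑ l, g i l * ∑ m, Λ i l m * d m b := by
      simp only [ite_mul, one_mul, zero_mul, Finset.sum_ite_eq', Finset.mem_univ, if_true]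
      simp only [Finset.sum_mul, Finset.mul_sum]
      rw [Finset.sum_comm]
      refine Finset.sum_congr rfl fun i _ => ?_
      rw [Finset.sum_comm]
      exact Finset.sum_congr rfl fun l _ => Finset.sum_congr rfl fun a _ => by ring
    simp only [add_mul, sub_mul, mul_add, mul_sub, Finset.sum_add_distrib,
      Finset.sum_sub_distrib]
    rw [e1, e2, e3]
  have h2 : (∑ i, ∑ l, if i ≤ l then
      ∑ a, ((if a = b then 1 else 0) * (if i = l then g i i else g i l + g l i)) * dd i l a
      else 0) = ∑ i, ∑ l, g i l * dd i l b := by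
    rw [sum_mul_symm_eq_sum_le g (fun i l => dd i l b) fun i l => hdd i l b]
    simp [ite_mul]
  rw [h0, h1, h2]
  simp only [← Finset.sum_add_distrib, ← mul_add]
  refine Finset.sum_congr rfl fun i _ => Finset.sum_congr rfl fun l _ => congrArg _ ?_
  have e1 : ∑ a, (∑ c, Γ i c b * Γ l a c) * u a = ∑ a, Γ i a b * ∑ c, Γ l c a * u c := by
    simp only [Finset.sum_mul, Finset.mul_sum]
    rw [Finset.sum_comm]
    exact Finset.sum_congr rfl fun l _ => Finset.sum_congr rfl fun a _ => by ring
  have e2 : ∑ a, (∑ m, Λ i l m * Γ m a b) * u a = ∑ m, Λ i l m * ∑ a, Γ m a b * u a := by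
    simp only [Finset.sum_mul, Finset.mul_sum]
    rw [Finset.sum_comm]
    exact Finset.sum_congr rfl fun l _ => Finset.sum_congr rfl fun a _ => by ring
  simp only [add_mul, sub_mul, mul_add, Finset.sum_add_distrib, Finset.sum_sub_distrib]
  rw [e1, e2]
  ring

variable {M : Type*} [TopologicalSpace M] [ChartedSpace (EuclideanSpace ℝ (Fin n)) M]
  [IsManifold (𝓡 n) ∞ M] [T2Space M] [CompactSpace M]
  {ι : Type*} {C : BaseCharts n ι M} {j : ι} {κ : Type} [Fintype κ] [DecidableEq κ]
  {V : M → Type*} [∀ x, AddCommGroup (V x)] [∀ x, Module ℝ (V x)] {B : BundleCharts C κ V}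

/-- Each product in the coefficients of order at most one has a factor of class $H^{k-2}$ and
otherwise factors of class $H^{k-1}$, an algebra acting on $H^{k-2}$. The second order coefficients
are built from the inverse Gram matrix alone. -/
theorem IsInducedConnection.isSafe_bochnerLaplacian {conn : SobolevConnection B}
    {D : SobolevConnection C.tangent} {conn'} (hind : IsInducedConnection conn D conn')
    (h : SobolevMetric C.tangent (k - 1)) (hΓ : conn.ChristoffelRegular (k - 1))
    (hΛ : D.ChristoffelRegular (k - 2)) (hB : B.IsSobolev k) (hk : n < 2 * (k - 1)) :
    IsSafe k 2 B B (bochnerLaplacian h conn conn') := by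
  refine ⟨by omega, fun j => ?_⟩
  obtain ⟨Γ, hΓj, hΓr⟩ := hΓ j
  obtain ⟨Λ, hΛj, hΛr⟩ := hΛ j
  have hT := (C.chart j).open_target
  set T := (C.chart j).target with hTdef
  set g : Fin n → Fin n → EuclideanSpace ℝ (Fin n) → ℝ := fun i l y => (h.gram j y)⁻¹ i l with hg
  have hgr : ∀ i l, MemHloc (k - 1) T (g i l) := h.memHloc_gram_inv hk j
  have hle : k - 2 ≤ k - 1 := by omega
  have hΓ2 : ∀ i a b, MemHloc (k - 2) T (Γ i a b) := fun i a b => (hΓr i a b).of_le hle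
  have hdΓ : ∀ i l a b, MemHloc (k - 2) T (weakDeriv i T (Γ l a b)) := fun i l a b =>
    ((hΓr l a b).of_le (by omega : k - 2 + 1 ≤ k - 1)).weakDeriv hT i
  have hmul : ∀ {f f' : EuclideanSpace ℝ (Fin n) → ℝ}, MemHloc (k - 1) T f →
      MemHloc (k - 2) T f' → MemHloc (k - 2) T fun y => f y * f' y := fun hf hf' =>
    MemHloc.mul hk hf hf' hT hle
  refine ⟨fun r => match r with
    | 0 => fun _ y => Matrix.of fun b a => ∑ i, ∑ l, g i l y * (weakDeriv i T (Γ l a b) y +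
        ∑ c, Γ i c b y * Γ l a c y - ∑ m, Λ i l m y * Γ m a b y)
    | 1 => fun I y => Matrix.of fun b a => ∑ l, g (I 0) l y * Γ l a b y +
        ∑ l, g l (I 0) y * Γ l a b y -
          (if a = b then 1 else 0) * ∑ i, ∑ l, g i l y * Λ i l (I 0) y
    | 2 => fun I y => Matrix.of fun b a => (if a = b then 1 else 0) *
        (if I 0 = I 1 then g (I 0) (I 0) y else g (I 0) (I 1) y + g (I 1) (I 0) y)
    | _ => fun _ _ => 0, ?_, fun u hu => ?_⟩
  · intro r hr I _ b a
    interval_cases r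
    · have : safeExponent n k 2 0 = k - 2 := by unfold safeExponent; omega
      rw [this]
      simp only [Matrix.of_apply]
      -- Differentiating $\Gamma\in H^{k-1}$ costs one order, and $\Lambda$ is only in $H^{k-2}$;
      -- the other factor of each quadratic term is kept in $H^{k-1}$.
      refine MemHloc.sum _ hT fun i _ => MemHloc.sum _ hT fun l _ => hmul (hgr i l) ?_
      refine ((hdΓ i l a b).add (MemHloc.sum _ hT fun c _ => hmul (hΓr i c b) (hΓ2 l a c))).sub
        (MemHloc.sum _ hT fun m _ => ?_)
      exact (hmul (hΓr m a b) (hΛr i l m)).congr_on hT fun y _ => mul_comm _ _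
    · have : safeExponent n k 2 1 = k - 2 := by unfold safeExponent; omega
      rw [this]
      simp only [Matrix.of_apply]
      exact ((MemHloc.sum _ hT fun l _ => hmul (hgr _ l) (hΓ2 l a b)).add
        (MemHloc.sum _ hT fun l _ => hmul (hgr l _) (hΓ2 l a b))).sub
        ((MemHloc.sum _ hT fun i _ => MemHloc.sum _ hT fun l _ =>
          hmul (hgr i l) (hΛr i l _)).const_mul _)
    -- The exponent is $\max\{k-2,\lfloor n/2\rfloor+1\}$, and $\lfloor n/2\rfloor+1\le k-1$ is
    -- precisely $k-1>n/2$.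
    · have : safeExponent n k 2 2 ≤ k - 1 := by unfold safeExponent; omega
      simp only [Matrix.of_apply]
      refine MemHloc.of_le (m := k - 1) (MemHloc.const_mul ?_ _) this
      by_cases hI : I 0 = I 1
      · simpa only [hI, if_true] using hgr (I 1) (I 1)
      · simpa only [hI, if_false] using (hgr (I 0) (I 1)).add (hgr (I 1) (I 0))
  · have hu1 : B.MemH 1 u := hu.of_le one_le_two
    -- Merging the mixed terms requires that weak second derivatives commute almost everywhere.
    have hsymm : ∀ i l a, weakDeriv i T (weakDeriv l T fun z => B.localRep j u z a)
        =ᵐ[volume.restrict T] weakDeriv l T (weakDeriv i T fun z => B.localRep j u z a) :=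
      fun i l a => (((hu1.memHloc j a).isWeakDeriv i).comm ((hu1.memHloc j a).isWeakDeriv l)
        (((hu.memHloc j a).weakDeriv hT i).isWeakDeriv l)).weakDeriv_ae_eq hT
    filter_upwards [ae_all_iff.2 fun i => ae_all_iff.2 fun l => ae_all_iff.2 fun b =>
        hind.coord_toFun_eq hΓ hΓj hΓr hΛj hB hk hu i l b,
      ae_all_iff.2 fun i => ae_all_iff.2 fun l => ae_all_iff.2 fun a => hsymm i l a,
      ae_restrict_mem hT.measurableSet] with y hy hs hyT
    ext b
    rw [coord_bochnerLaplacian h conn conn' u hyT b, Finset.sum_range_succ,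
      Finset.sum_range_succ, Finset.sum_range_one, sum_monotone_zero, sum_monotone_one,
      sum_monotone_two]
    simp only [iterWeakDeriv_zero, iterWeakDeriv_one, iterWeakDeriv_two, Pi.add_apply,
      Finset.sum_apply, hy, apply_ite (fun v : κ → ℝ => v b), Pi.zero_apply,
      Matrix.mulVec, dotProduct, Matrix.of_apply]
    exact sum_collect_orders b (fun i l => g i l y)
      (fun i l a => weakDeriv i T (weakDeriv l T fun z => B.localRep j u z a) y)
      (fun i a => weakDeriv i T (fun z => B.localRep j u z a) y)
      (fun a => B.localRep j u y a) (fun i l a b => weakDeriv i T (Γ l a b) y)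
      (fun i a b => Γ i a b y) (fun i l m => Λ i l m y) (fun i l a => hs i l a)

end LaplacianIsSafe
-- The main theorem
theorem theorem3 {n k q : ℕ} {M : Type*} [TopologicalSpace M] [T2Space M] [CompactSpace M]
    [ChartedSpace (EuclideanSpace ℝ (Fin n)) M] [IsManifold (𝓡 n) ∞ M]
    {ι : Type*} (C : BaseCharts n ι M)
    {E : M → Type*} [∀ x, AddCommGroup (E x)] [∀ x, Module ℝ (E x)]
    (B : BundleCharts C (Fin q) E) (hB : B.IsSobolev k)
    (γ : SobolevMetric B k) (conn : SobolevConnection B) (hconn : conn.IsMetric γ)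
    (hΓ : conn.ChristoffelRegular (k - 1)) (hk : n < 2 * k) :
    IsSafe k 1 B B.hom conn.toFun ∧
    (n < 2 * (k - 1) → ∀ (h : SobolevMetric C.tangent (k - 1)) (D : SobolevConnection C.tangent),
      D.IsMetric h → (D.ChristoffelRegular (k - 2) ∨ D.IsTorsionFree) →
        (∃ conn', IsInducedConnection conn D conn') ∧
        ∀ conn', IsInducedConnection conn D conn' →
          IsSafe k 2 B B (bochnerLaplacian h conn conn')) := by
  refine ⟨conn.isSafe hB hΓ hk, fun hk' h D hD hcases => ⟨exists_isInducedConnection conn D,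
    fun conn' hind => hind.isSafe_bochnerLaplacian h hΓ ?_ hB hk'⟩⟩
  rcases hcases with hreg | htor
  · exact hreg
  -- One derivative of the metric of class $H^{k-1}$ is lost, which gives exactly the regularity
  -- $H^{k-2}$ assumed in the other case.
  · exact fun j => ⟨_, hD.isChristoffel_leviCivita h htor hk' j, h.memHloc_leviCivita hk' j⟩
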